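/- Notation. Put $[x]=x-x^{-1}$. Let $N\ge 1$, $n=\lfloor N/2\rfloor$, $\bar n=\lceil N/2\rceil$, $q\in\mathbb C\setminus\{0,1,-1\}$, $\beta\in\mathbb C\setminus\{0\}$, and $V^N=(\mathbb C^2)^{\otimes N}$ with the canonical basis of spin configurations, $|{\uparrow}\rangle=(1,0)^t$, $|{\downarrow}\rangle=(0,1)^t$. An index on an operator indicates the tensor factors on which it acts. For $1\le a_1<\dots<a_n\le N$ and $1\le b_1<\dots<b_{\bar n}\le N$ put $$(\Psi_N)_{a_1,\dots,a_n}(z)=(-[q])^n\prod_{1\le i<j\le N}[qz_j/z_i][q^2z_iz_j]\oint\!\cdots\!\oint\prod_{\ell=1}^n\frac{dw_\ell}{\pi \mathrm i\,w_\ell}\;\frac{\prod_{1\le i<j\le n}[qw_j/w_i][w_i/w_j][qw_iw_j]\prod_{1\le i\le j\le n}[q^2w_iw_j]\prod_{i=1}^n[\beta w_i]}{\prod_{i=1}^n\bigl(\prod_{j=1}^{a_i}[z_j/w_i]\prod_{j=a_i}^N[qz_j/w_i]\prod_{j=1}^N[q^2w_iz_j]\bigr)},$$ $$(\overline\Psi_N)_{b_1,\dots,b_{\bar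 n}}(z)=[q]^{\bar n}\prod_{1\le i<j\le N}[qz_j/z_i][qz_iz_j]\prod_{i=1}^N[\beta z_i]\oint\!\cdots\!\oint\prod_{\ell=1}^{\bar n}\frac{dw_\ell}{\pi \mathrm i\,w_\ell}\;\frac{\prod_{1\le i<j\le \bar n}[qw_j/w_i][w_i/w_j][q^2w_iw_j]\prod_{1\le i\le j\le \bar n}[qw_iw_j]}{\prod_{i=1}^{\bar n}\bigl(\prod_{j=1}^{b_i}[qw_i/z_j]\prod_{j=b_i}^N[w_i/z_j]\prod_{j=1}^N[qw_iz_j]\bigr)\prod_{i=1}^{\bar n}[\beta w_i]}.$$ In the first integral, the contour of each $w_\ell$ consists of positively oriented circles around $z_1,\dots,z_N$, where the closed disc bounded by the circle around $z_j$ contains no other $z_i$ and none of the other singularities $0,-z_k,\pm qz_k,\pm q^{-2}z_k^{-1}$ $(1\le k\le N)$; in the second integral the latter are replaced by $0,-z_k,\pm q^{-1}z_k,\pm q^{-1}z_k^{-1},\pm\beta^{-1}$. The radii are otherwise arbitrary, and may depend on $z$, $\ell$ and $j$. Such contours exist precisely if the $z_j$ are pairwise distinct and distinct from all these other singularities; then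 $z=(z_1,\dots,z_N)$ is called *generic* for $\Psi_N$, respectively for $\overline\Psi_N$. For generic $z$ let $|\Psi_N(z)\rangle\in V^N$ be the vector whose component along the configuration with down spins exactly at $a_1,\dots,a_n$ is $(\Psi_N)_{a_1,\dots,a_n}(z)$, and $|\overline\Psi_N(z)\rangle\in V^N$ the vector whose component along the configuration with up spins exactly at $b_1,\dots,b_{\bar n}$ is $(\overline\Psi_N)_{b_1,\dots,b_{\bar n}}(z)$, all other components being zero (so $|\Psi_1\rangle=|{\uparrow}\rangle$). Let $\check R(z)=PR(z)$, where $P(v\otimes w)=w\otimes v$ and $$R(z)=\frac1{[q/z]}\begin{pmatrix}[qz]&0&0&0\\0&[z]&[q]&0\\0&[q]&[z]&0\\0&0&0&[qz]\end{pmatrix},\qquad K(z;\beta)=\begin{pmatrix}1&0\\0&[\beta z]/[\beta/z]\end{pmatrix}.$$ Statement. (1) Exchange relations. For $1\le i\le N-1$ and $z$ generic for $\Psi_N$, $$\check R_{i,i+1}(z_i/z_{i+1})|\Psi_N(\dots,z_i,z_{i+1},\dots)\rangle=|\Psi_N(\dots,z_{i+1},z_i,\dots)\rangle,$$ and the same holds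 for $|\overline\Psi_N\rangle$ if $z$ is generic for $\overline\Psi_N$. Now let $s,\bar\beta\in\mathbb C$ with $s^4=q^6$ and $\bar\beta^2\beta^2q^2=1$. (2) Reflection relations. One has $$K_1(z_1^{-1};\beta)|\Psi_N(z_1,\dots,z_N)\rangle=|\Psi_N(z_1^{-1},z_2,\dots,z_N)\rangle,$$ $$K_N(sz_N;s\bar\beta)|\Psi_N(z_1,\dots,z_N)\rangle=|\Psi_N(z_1,\dots,z_{N-1},s^{-2}z_N^{-1})\rangle,$$ whenever the arguments of $\Psi_N$ on both sides are generic and the denominator of the $K$-matrix does not vanish ($[\beta z_1]\ne0$, respectively $[\bar\beta/z_N]\ne0$). (3) Boundary quantum Knizhnik–Zamolodchikov equations. For $i=1,\dots,N$ put $$S^{(i)}(z)=\check R_{i-1,i}(s^2z_i/z_{i-1})\cdots\check R_{1,2}(s^2z_i/z_1)\;K_1(s^2z_i;\beta)\;\check R_{1,2}(s^2z_iz_1)\cdots\check R_{i-1,i}(s^2z_iz_{i-1})$$ $$\times\;\check R_{i,i+1}(s^2z_iz_{i+1})\cdots\check R_{N-1,N}(s^2z_iz_N)\;K_N(sz_i;s\bar\beta)\;\check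 R_{N-1,N}(z_i/z_N)\cdots\check R_{i,i+1}(z_i/z_{i+1}).$$ Then $$S^{(i)}(z_1,\dots,z_N)|\Psi_N(\dots,z_i,\dots)\rangle=|\Psi_N(\dots,s^2z_i,\dots)\rangle$$ whenever the arguments of $\Psi_N$ on both sides are generic and $[\beta/(s^2z_i)]\neq0$, $[\bar\beta/z_i]\ne0$. -/

import Mathlib

open scoped Matrix

noncomputable section

namespace BqKZ

/-- The bracket `[x] = x - x⁻¹`. -/
def br (x : ℂ) : ℂ := x - x⁻¹

/-! ### The space `V^N` and the operators acting on it -/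

/-- Spin configurations of `N` sites; `0` stands for `↑` and `1` for `↓`. -/
abbrev Config (N : ℕ) : Type := Fin N → Fin 2

/-- The space `V^N = (ℂ²)^{⊗ N}`, in coordinates with respect to the canonical basis. -/
abbrev VN (N : ℕ) : Type := Config N → ℂ

/-- Linear operators on `V^N`, as matrices with respect to the canonical basis. -/
abbrev Op (N : ℕ) : Type := Matrix (Config N) (Config N) ℂ

/-- The canonical basis vector of `V^N` attached to a spin configuration. -/
def ket {N : ℕ} (σ : Config N) : VN N := Pi.single σ 1

/-- Tensor-leg notation `A_i`: the operator `A` on the factor `i`, the identity elsewhere. -/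
def leg₁ {N : ℕ} (i : Fin N) (A : Matrix (Fin 2) (Fin 2) ℂ) : Op N :=
  Matrix.of fun σ τ => if ∀ k, k ≠ i → σ k = τ k then A (σ i) (τ i) else 0

/-- Tensor-leg notation `A_{i,j}`: the operator `A` on the factors `i, j`, the identity
elsewhere. -/
def leg₂ {N : ℕ} (i j : Fin N) (A : Matrix (Fin 2 × Fin 2) (Fin 2 × Fin 2) ℂ) : Op N :=
  Matrix.of fun σ τ =>
    if ∀ k, k ≠ i → k ≠ j → σ k = τ k then A (σ i, σ j) (τ i, τ j) else 0

/-- The `R`-matrix of the six-vertex model, with weights `a = [qz]/[q/z]`, `b = [z]/[q/z]`,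
`c = [q]/[q/z]`. -/
def R (q z : ℂ) : Matrix (Fin 2 × Fin 2) (Fin 2 × Fin 2) ℂ :=
  Matrix.of fun s t =>
    if s = t then (if s.1 = s.2 then br (q * z) / br (q / z) else br z / br (q / z))
    else if s = t.swap then br q / br (q / z)
    else 0

/-- The permutation operator `P (v ⊗ w) = w ⊗ v`. -/
def P : Matrix (Fin 2 × Fin 2) (Fin 2 × Fin 2) ℂ :=
  Matrix.of fun s t => if s = t.swap then 1 else 0

/-- The matrix `Ř(z) = P R(z)`. -/
def Rcheck (q z : ℂ) : Matrix (Fin 2 × Fin 2) (Fin 2 × Fin 2) ℂ := P * R q z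

/-- Cherednik's diagonal `K`-matrix `K(z; β) = diag(1, [βz]/[β/z])`. -/
def K (z β : ℂ) : Matrix (Fin 2) (Fin 2) ℂ :=
  Matrix.diagonal ![1, br (β * z) / br (β / z)]

/-- The point `z` is not a pole of the entries of `K(·; β)`. -/
def KRegular (z β : ℂ) : Prop := br (β / z) ≠ 0

/-- The first site of a nonempty chain. -/
def firstSite (N : ℕ) [NeZero N] : Fin N := 0

/-- The last site of a nonempty chain. -/
def lastSite (N : ℕ) [NeZero N] : Fin N :=
  ⟨N - 1, Nat.sub_lt (Nat.pos_of_ne_zero (NeZero.ne N)) Nat.one_pos⟩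

/-! ### Contours and generic points -/

/-- Points other than `w = z_j` at which the integrand of `Ψ_N` may be singular in an integration
variable `w`: the points `0, -z_j, ±q z_j, ±q⁻² z_j⁻¹`. -/
def singPsi (q : ℂ) {N : ℕ} (z : Fin N → ℂ) : Set ℂ :=
  {0} ∪ ⋃ j, {-z j, q * z j, -(q * z j), q⁻¹ ^ 2 * (z j)⁻¹, -(q⁻¹ ^ 2 * (z j)⁻¹)}

/-- Points other than `w = z_j` at which the integrand of `Ψ̄_N` may be singular in an integration
variable `w`: the points `0, ±β⁻¹, -z_j, ±q⁻¹ z_j, ±q⁻¹ z_j⁻¹`. -/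
def singPsiBar (q β : ℂ) {N : ℕ} (z : Fin N → ℂ) : Set ℂ :=
  {0, β⁻¹, -β⁻¹} ∪
    ⋃ j, {-z j, q⁻¹ * z j, -(q⁻¹ * z j), q⁻¹ * (z j)⁻¹, -(q⁻¹ * (z j)⁻¹)}

/-- The radii `r j` define an admissible contour: the union of the positively oriented circles
of centre `z j` and radius `r j`, each of which surrounds `z j`, but neither another
`z i` nor a point of `S` (the circles themselves avoid these points as well). -/
def IsContour {N : ℕ} (S : Set ℂ) (z : Fin N → ℂ) (r : Fin N → ℝ) : Prop :=
  ∀ j, 0 < r j ∧ (∀ i, i ≠ j → z i ∉ Metric.closedBall (z j) (r j)) ∧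
    ∀ p ∈ S, p ∉ Metric.closedBall (z j) (r j)

/-- Admissible contours exist as soon as the `z_j` are distinct and not in the finite set `S`. -/
theorem exists_isContour {N : ℕ} {S : Set ℂ} (hS : S.Finite) {z : Fin N → ℂ}
    (hz : Function.Injective z) (hzS : ∀ j, z j ∉ S) : ∃ r, IsContour S z r := by
  have key : ∀ j, ∃ r : ℝ, 0 < r ∧ (∀ i, i ≠ j → z i ∉ Metric.closedBall (z j) r) ∧
      ∀ p ∈ S, p ∉ Metric.closedBall (z j) r := by
    intro j
    have hfin : (S ∪ z '' {i | i ≠ j}).Finite := hS.union ((Set.toFinite _).image z)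
    have hmem : z j ∈ (S ∪ z '' {i | i ≠ j})ᶜ := by
      rintro (h | ⟨i, hi, h⟩)
      · exact hzS j h
      · exact hi (hz h)
    obtain ⟨r, hr, hsub⟩ :=
      Metric.nhds_basis_closedBall.mem_iff.1 (hfin.isClosed.isOpen_compl.mem_nhds hmem)
    exact ⟨r, hr, fun i hi h => hsub h (Or.inr ⟨i, hi, rfl⟩), fun p hp h => hsub h (Or.inl hp)⟩
  choose r hr using key
  exact ⟨r, hr⟩

/-- The generic points: the `z_j` are pairwise distinct, and distinct from the other
singularities `S z`. -/
def generic {N : ℕ} (S : (Fin N → ℂ) → Set ℂ) : Set (Fin N → ℂ) :=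
  {z | Function.Injective z ∧ ∀ j, z j ∉ S z}

/-- A choice, for each generic `z` and each of `n` integration variables, of an admissible
contour. -/
def IsContourChoice {N n : ℕ} (S : (Fin N → ℂ) → Set ℂ)
    (ρ : (Fin N → ℂ) → Fin n → Fin N → ℝ) : Prop :=
  ∀ z ∈ generic S, ∀ l, IsContour (S z) z (ρ z l)

/-- The multiple contour integral `∮ ⋯ ∮ ∏_l dw_l / (π i w_l) F(w_1, …, w_n)`, where the contour
of `w_l` is the union over `j` of the circles of centre `z j` and radius `r l j`: it is the sum,
over all ways `κ` of choosing one of these circles for each variable, of the integrals over the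
corresponding tori. -/
def multiContour {N n : ℕ} (z : Fin N → ℂ) (r : Fin n → Fin N → ℝ) (F : (Fin n → ℂ) → ℂ) : ℂ :=
  ∑ κ : Fin n → Fin N,
    torusIntegral (fun w => (∏ l, ((Real.pi : ℂ) * Complex.I * w l)⁻¹) * F w)
      (fun l => z (κ l)) (fun l => r l (κ l))

/-! ### The vectors `|Ψ_N⟩` and `|Ψ̄_N⟩` -/

/-- The integrand `Ξ_{a_1,…,a_n}(w_1,…,w_n | z_1,…,z_N)`. -/
def Xi (q β : ℂ) {N n : ℕ} (a : Fin n ↪o Fin N) (z : Fin N → ℂ) (w : Fin n → ℂ) : ℂ :=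
  ((∏ i, ∏ j ∈ Finset.Ioi i,
      br (q * w j / w i) * br (w i / w j) * br (q * w i * w j)) *
    (∏ i, ∏ j ∈ Finset.Ici i, br (q ^ 2 * w i * w j)) * ∏ i, br (β * w i)) /
  ∏ i, ((∏ j ∈ Finset.Iic (a i), br (z j / w i)) *
    (∏ j ∈ Finset.Ici (a i), br (q * z j / w i)) * ∏ j, br (q ^ 2 * w i * z j))

/-- The component `(Ψ_N)_{a_1,…,a_n}(z_1,…,z_N)`, computed with the contours of radii `r`. -/
def psiComp (q β : ℂ) {N n : ℕ} (a : Fin n ↪o Fin N) (r : Fin n → Fin N → ℝ) (z : Fin N → ℂ) : ℂ :=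
  (-br q) ^ n * (∏ i, ∏ j ∈ Finset.Ioi i, br (q * z j / z i) * br (q ^ 2 * z i * z j)) *
    multiContour z r (Xi q β a z)

/-- The integrand `Ξ̄_{b_1,…,b_n}(w_1,…,w_n | z_1,…,z_N)`. -/
def XiBar (q β : ℂ) {N n : ℕ} (b : Fin n ↪o Fin N) (z : Fin N → ℂ) (w : Fin n → ℂ) : ℂ :=
  ((∏ i, ∏ j ∈ Finset.Ioi i,
      br (q * w j / w i) * br (w i / w j) * br (q ^ 2 * w i * w j)) *
    ∏ i, ∏ j ∈ Finset.Ici i, br (q * w i * w j)) /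
  ((∏ i, ((∏ j ∈ Finset.Iic (b i), br (q * w i / z j)) *
    (∏ j ∈ Finset.Ici (b i), br (w i / z j)) * ∏ j, br (q * w i * z j))) *
    ∏ i, br (β * w i))

/-- The component `(Ψ̄_N)_{b_1,…,b_n}(z_1,…,z_N)`, computed with the contours of radii `r`. -/
def psiBarComp (q β : ℂ) {N n : ℕ} (b : Fin n ↪o Fin N) (r : Fin n → Fin N → ℝ)
    (z : Fin N → ℂ) : ℂ :=
  br q ^ n * (∏ i, ∏ j ∈ Finset.Ioi i, br (q * z j / z i) * br (q * z i * z j)) *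
    (∏ i, br (β * z i)) * multiContour z r (XiBar q β b z)

open Classical in
/-- The configuration with down spins exactly at the sites `a_1 < ⋯ < a_n`. -/
def downAt {N n : ℕ} (a : Fin n ↪o Fin N) : Config N :=
  fun k => if k ∈ Set.range a then 1 else 0

open Classical in
/-- The configuration with up spins exactly at the sites `b_1 < ⋯ < b_n`. -/
def upAt {N n : ℕ} (b : Fin n ↪o Fin N) : Config N :=
  fun k => if k ∈ Set.range b then 0 else 1

/-- The vector `|Ψ_N(z_1,…,z_N)⟩`, with `n = ⌊N/2⌋`, for the choice of contours `ρ`.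
For `N = 1` there is no integration, and the vector is `|↑⟩`. -/
def Psi (q β : ℂ) {N : ℕ} (ρ : (Fin N → ℂ) → Fin (N / 2) → Fin N → ℝ) (z : Fin N → ℂ) : VN N :=
  ∑ a : Fin (N / 2) ↪o Fin N, psiComp q β a (ρ z) z • ket (downAt a)

/-- The vector `|Ψ̄_N(z_1,…,z_N)⟩`, with `n̄ = ⌈N/2⌉`, for the choice of contours `ρ`
(used for `N ≥ 2`). -/
def PsiBar (q β : ℂ) {N : ℕ} (ρ : (Fin N → ℂ) → Fin ((N + 1) / 2) → Fin N → ℝ)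
    (z : Fin N → ℂ) : VN N :=
  ∑ b : Fin ((N + 1) / 2) ↪o Fin N, psiBarComp q β b (ρ z) z • ket (upAt b)

/-! ### The relations -/

/-- The exchange relations
`Ř_{i,i+1}(z_i/z_{i+1}) |Φ(…,z_i,z_{i+1},…)⟩ = |Φ(…,z_{i+1},z_i,…)⟩` on the domain `D`. -/
def ExchangeRelations (q : ℂ) {N : ℕ} (D : Set (Fin N → ℂ)) (Φ : (Fin N → ℂ) → VN N) : Prop :=
  ∀ z ∈ D, ∀ i j : Fin N, (i : ℕ) + 1 = j →
    leg₂ i j (Rcheck q (z i / z j)) *ᵥ Φ z = Φ (z ∘ Equiv.swap i j)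

/-- The left reflection relation `K_1(z_1⁻¹; β) |Φ(z_1,…,z_N)⟩ = |Φ(z_1⁻¹,…,z_N)⟩`. -/
def LeftReflectionRelation (β : ℂ) {N : ℕ} [NeZero N] (D : Set (Fin N → ℂ))
    (Φ : (Fin N → ℂ) → VN N) : Prop :=
  ∀ z ∈ D, Function.update z (firstSite N) (z (firstSite N))⁻¹ ∈ D →
    KRegular (z (firstSite N))⁻¹ β →
    leg₁ (firstSite N) (K (z (firstSite N))⁻¹ β) *ᵥ Φ z =
      Φ (Function.update z (firstSite N) (z (firstSite N))⁻¹)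

/-- The right reflection relation
`K_N(s z_N; s β̄) |Φ(z_1,…,z_N)⟩ = |Φ(z_1,…,s⁻² z_N⁻¹)⟩`. -/
def RightReflectionRelation (s βbar : ℂ) {N : ℕ} [NeZero N] (D : Set (Fin N → ℂ))
    (Φ : (Fin N → ℂ) → VN N) : Prop :=
  ∀ z ∈ D, Function.update z (lastSite N) (s⁻¹ ^ 2 * (z (lastSite N))⁻¹) ∈ D →
    KRegular (s * z (lastSite N)) (s * βbar) →
    leg₁ (lastSite N) (K (s * z (lastSite N)) (s * βbar)) *ᵥ Φ z =
      Φ (Function.update z (lastSite N) (s⁻¹ ^ 2 * (z (lastSite N))⁻¹))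

/-- `Ř_{j,j+1}(u)`, for `j` running over the sites to the left of the site `i` (sites are numbered
from `0`). -/
def leftRcheck (q : ℂ) {N : ℕ} (i : Fin N) (u : ℂ) (j : Fin i) : Op N :=
  leg₂ ⟨j, by omega⟩ ⟨j + 1, by omega⟩ (Rcheck q u)

/-- The site `j = i + k`, for `i ≤ j` and `j + 1` a site (sites are numbered from `0`). -/
def rightSite {N : ℕ} (i : Fin N) (k : Fin (N - 1 - i)) : Fin N := ⟨i + k, by omega⟩

/-- The site `j + 1 = i + k + 1` following `rightSite i k`. -/
def rightSiteSucc {N : ℕ} (i : Fin N) (k : Fin (N - 1 - i)) : Fin N := ⟨i + k + 1, by omega⟩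

/-- `Ř_{j,j+1}(u)` with `j = i + k`. -/
def rightRcheck (q : ℂ) {N : ℕ} (i : Fin N) (u : ℂ) (k : Fin (N - 1 - i)) : Op N :=
  leg₂ (rightSite i k) (rightSiteSucc i k) (Rcheck q u)

/-- The scattering operator `S^{(i)}(z_1,…,z_N)`, i.e. the product (in this order) of
`∏_{j=i-1,…,1} Ř_{j,j+1}(s² z_i/z_j)`, `K_1(s² z_i; β)`, `∏_{j=1,…,i-1} Ř_{j,j+1}(s² z_i z_j)`,
`∏_{j=i,…,N-1} Ř_{j,j+1}(s² z_i z_{j+1})`, `K_N(s z_i; s β̄)`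
and `∏_{j=N-1,…,i} Ř_{j,j+1}(z_i/z_{j+1})`. -/
def scattering (q β s βbar : ℂ) {N : ℕ} [NeZero N] (i : Fin N) (z : Fin N → ℂ) : Op N :=
  (List.ofFn fun j : Fin i => leftRcheck q i (s ^ 2 * z i / z (j.castLE i.isLt.le)) j).reverse.prod *
  leg₁ (firstSite N) (K (s ^ 2 * z i) β) *
  (List.ofFn fun j : Fin i => leftRcheck q i (s ^ 2 * z i * z (j.castLE i.isLt.le)) j).prod *
  (List.ofFn fun k : Fin (N - 1 - i) =>
    rightRcheck q i (s ^ 2 * z i * z (rightSiteSucc i k)) k).prod *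
  leg₁ (lastSite N) (K (s * z i) (s * βbar)) *
  (List.ofFn fun k : Fin (N - 1 - i) =>
    rightRcheck q i (z i / z (rightSiteSucc i k)) k).reverse.prod

/-- The boundary quantum Knizhnik–Zamolodchikov equations
`S^{(i)}(z_1,…,z_N) |Φ(…,z_i,…)⟩ = |Φ(…,s² z_i,…)⟩`, `i = 1,…,N`. -/
def BoundaryQKZ (q β s βbar : ℂ) {N : ℕ} [NeZero N] (D : Set (Fin N → ℂ))
    (Φ : (Fin N → ℂ) → VN N) : Prop :=
  ∀ z ∈ D, ∀ i : Fin N, Function.update z i (s ^ 2 * z i) ∈ D →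
    KRegular (s ^ 2 * z i) β → KRegular (s * z i) (s * βbar) →
    scattering q β s βbar i z *ᵥ Φ z = Φ (Function.update z i (s ^ 2 * z i))

end BqKZ

end

open scoped Matrix

noncomputable section

namespace BqKZ

/-! ### Brackets -/

/-! Residues. The only singularities inside the contours are the simple poles w_l = z_{κ(l)}, so
each component is a finite sum over maps κ (`multiContour_eq_sum`) and the radii play no role. Over
a denominator symmetric in the z_j, only the factor `numAt` of a residue depends on the position of
a spin; this gives the common form `phi`. The substitution z_j ↦ c/z_{N+1-j} with c²q³ = -1
interchanges [quv] and [q²uv] and brings Ψ̄_N to the same form, with up spins marked in place of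
down spins and `dualB` in place of w ↦ [βw].

Exchange relations. If exactly one of two neighbouring sites is marked, the relation holds residue
by residue, by a three-term identity for the bracket. If both are marked, it holds after adding the
residues of κ and of κ with two entries interchanged. If neither is marked, only the prefactor
changes.

Propagation. For unequal neighbouring spins the exchange relation expresses the component of the
exchanged configuration through the other one, at z and at the exchanged point. Hence a difference
of two solutions that vanishes in one component, on a set of points stable under the exchanges,
vanishes in all components with the same number of down spins (`eq_zero_of_exchange`). A reflection
relation leaves its boundary site alone, so it needs checking in one component for each value of
that boundary spin.

Extremal components. If the marked sites are the first m, the residue sum is triangular: a single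
term survives and is a product (`extremal`) whose behaviour under both reflections is visible. With
one more marked spin at the last site, a single sum over k survives. In the variable `tau` it has
Lagrange form, and its reflection is the vanishing of ∑ P(t_i)/∏_{j≠i}(t_j - t_i) for P of small
degree (`phi_snoc_last_update`). The degree bound is where the numbers ⌊N/2⌋ and ⌈N/2⌉ of marked
spins enter. This settles the right reflection, and the left one for a down spin at site 1. For an
up spin at site 1, one extremal component shows that Ψ_N = Ψ̄_N (`psiVec_eq_dualVec`); in the dual
form z_1 becomes the last variable, and the same Lagrange argument applies.

The boundary equations follow by composition: z_i is carried to the right end, reflected, carried to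
the left end, reflected, and carried back. Nondegeneracy conditions that the theorem does not
assume, such as genericity of the intermediate point, are removed by continuity along the path z_j
t^j as t → 1 (`eq_of_eventually_path`). -/

theorem br_neg (x : ℂ) : br (-x) = -br x := by
  simp only [br, inv_neg]; ring

theorem br_inv (x : ℂ) : br x⁻¹ = -br x := by
  simp only [br, inv_inv]; ring

theorem br_eq_zero_iff {x : ℂ} (hx : x ≠ 0) : br x = 0 ↔ x = 1 ∨ x = -1 := by
  rw [br, sub_eq_zero, ← mul_self_eq_one_iff, ← mul_eq_one_iff_eq_inv₀ hx]

theorem br_div {x y : ℂ} (hx : x ≠ 0) (hy : y ≠ 0) :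
    br (x / y) = (x - y) * (x + y) / (x * y) := by
  unfold br; field_simp; ring

theorem br_div_eq_zero_iff {x y : ℂ} (hx : x ≠ 0) (hy : y ≠ 0) :
    br (x / y) = 0 ↔ x = y ∨ x = -y := by
  rw [br_eq_zero_iff (div_ne_zero hx hy), div_eq_one_iff_eq hy, div_eq_iff hy, neg_one_mul]

theorem br_swap (x y : ℂ) : br (y / x) = -br (x / y) := by
  rw [← br_inv, inv_div]

theorem _root_.DifferentiableAt.br {E : Type*} [NormedAddCommGroup E] [NormedSpace ℂ E]
    {f : E → ℂ} {x : E} (hf : DifferentiableAt ℂ f x) (h : f x ≠ 0) :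
    DifferentiableAt ℂ (fun y => BqKZ.br (f y)) x :=
  hf.sub (hf.inv h)

theorem _root_.ContinuousAt.br {E : Type*} [TopologicalSpace E]
    {f : E → ℂ} {x : E} (hf : ContinuousAt f x) (h : f x ≠ 0) :
    ContinuousAt (fun y => BqKZ.br (f y)) x :=
  hf.sub (hf.inv₀ h)

theorem _root_.DifferentiableAt.prod_of_forall {E ι : Type*} [NormedAddCommGroup E]
    [NormedSpace ℂ E] {u : Finset ι} {f : ι → E → ℂ} {x : E}
    (hf : ∀ i ∈ u, DifferentiableAt ℂ (f i) x) :
    DifferentiableAt ℂ (fun y => ∏ i ∈ u, f i y) x := by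
  classical
  induction u using Finset.induction_on with
  | empty => simp
  | insert i u hi ih =>
    simp only [Finset.prod_insert hi]
    exact (hf i (Finset.mem_insert_self i u)).mul
      (ih fun j hj => hf j (Finset.mem_insert_of_mem hj))

theorem _root_.DifferentiableAt.div_of_ne {E : Type*} [NormedAddCommGroup E]
    [NormedSpace ℂ E] {f g : E → ℂ} {x : E} (hf : DifferentiableAt ℂ f x)
    (hg : DifferentiableAt ℂ g x) (h : g x ≠ 0) : DifferentiableAt ℂ (fun y => f y / g y) x := by
  simp only [div_eq_mul_inv]
  exact hf.mul (hg.fun_inv h)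

theorem _root_.DifferentiableAt.br_div {E : Type*} [NormedAddCommGroup E]
    [NormedSpace ℂ E] {f g : E → ℂ} {x : E} (hf : DifferentiableAt ℂ f x)
    (hg : DifferentiableAt ℂ g x) (h : f x ≠ 0) (h' : g x ≠ 0) :
    DifferentiableAt ℂ (fun y => BqKZ.br (f y / g y)) x :=
  (hf.div_of_ne hg h').br (div_ne_zero h h')

/-! ### Evaluation of the contour integrals -/

/-- Cauchy's integral formula for a polydisc, at its centre. -/
theorem torusIntegral_cauchy {n : ℕ} (c : Fin n → ℂ) (r : Fin n → ℝ) (hr : ∀ l, 0 < r l)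
    (G : (Fin n → ℂ) → ℂ)
    (hG : ∀ w, (∀ l, w l ∈ Metric.closedBall (c l) (r l)) → DifferentiableAt ℂ G w) :
    torusIntegral (fun w => (∏ l, (w l - c l)⁻¹) * G w) c r =
      (2 * Real.pi * Complex.I) ^ n * G c := by
  induction n with
  | zero => simp [torusIntegral_dim0]
  | succ n ih =>
    have hmap : ∀ θ l, torusMap c r θ l ∈ Metric.closedBall (c l) (r l) := by
      intro θ l
      simp [torusMap, dist_eq_norm, Complex.norm_exp_ofReal_mul_I, abs_of_pos (hr l)]
    have hne : ∀ θ l, torusMap c r θ l - c l ≠ 0 := by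
      intro θ l
      simp [torusMap, (hr l).ne']
    have hcont : Continuous (torusMap c r) := by
      unfold torusMap; fun_prop
    have hint : TorusIntegrable (fun w => (∏ l, (w l - c l)⁻¹) * G w) c r := by
      refine ContinuousOn.integrableOn_compact isCompact_Icc (Continuous.continuousOn ?_)
      refine Continuous.mul (continuous_finsetProd _ fun l _ => ?_) ?_
      · exact Continuous.inv₀ (by fun_prop) (hne · l)
      · exact continuous_iff_continuousAt.2 fun θ =>
          ((hG _ (hmap θ)).continuousAt).comp hcont.continuousAt
    rw [torusIntegral_succ hint]
    have inner : ∀ x ∈ Metric.sphere (c 0) (r 0),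
        torusIntegral (fun y => (∏ l, ((Fin.cons x y : Fin (n + 1) → ℂ) l - c l)⁻¹) *
          G (Fin.cons x y)) (c ∘ Fin.succ) (r ∘ Fin.succ) =
        (x - c 0)⁻¹ • ((2 * Real.pi * Complex.I) ^ n * G (Fin.cons x (c ∘ Fin.succ))) := by
      intro x hx
      have := ih (c ∘ Fin.succ) (r ∘ Fin.succ) (fun l => hr _)
        (fun y => (x - c 0)⁻¹ * G (Fin.cons x y)) (by
          intro w hw
          refine DifferentiableAt.const_mul ?_ _
          have : DifferentiableAt ℂ (fun y : Fin n → ℂ => (Fin.cons x y : Fin (n + 1) → ℂ)) w := by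
            rw [differentiableAt_pi]
            intro i
            refine Fin.cases ?_ (fun j => ?_) i
            · simp
            · simp only [Fin.cons_succ]; fun_prop
          refine DifferentiableAt.comp w (hG _ ?_) this
          intro l
          refine Fin.cases ?_ (fun j => ?_) l
          · exact Metric.sphere_subset_closedBall hx
          · exact hw j)
      rw [smul_eq_mul, mul_left_comm, ← this]
      congr 1
      funext y
      rw [Fin.prod_univ_succ]
      simp only [Fin.cons_zero, Fin.cons_succ, Function.comp]
      ring
    rw [circleIntegral.integral_congr (hr 0).le inner]
    have hd : ∀ x ∈ Metric.closedBall (c 0) (r 0), DifferentiableAt ℂ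
        (fun x : ℂ => (2 * Real.pi * Complex.I) ^ n * G (Fin.cons x (c ∘ Fin.succ))) x := by
      intro x hx
      refine DifferentiableAt.const_mul ?_ _
      have : DifferentiableAt ℂ
          (fun x : ℂ => (Fin.cons x (c ∘ Fin.succ) : Fin (n + 1) → ℂ)) x := by
        rw [differentiableAt_pi]
        intro i
        refine Fin.cases ?_ (fun j => ?_) i
        · simp only [Fin.cons_zero]; fun_prop
        · simp
      refine DifferentiableAt.comp x (hG _ ?_) this
      intro l
      refine Fin.cases hx (fun j => ?_) l
      exact Metric.mem_closedBall_self (hr _).le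
    rw [Complex.circleIntegral_sub_inv_smul_of_differentiable_on_off_countable
      Set.countable_empty (Metric.mem_ball_self (hr 0))
      (fun x hx => (hd x hx).continuousAt.continuousWithinAt)
      (fun x hx => hd x (Metric.ball_subset_closedBall hx.1))]
    rw [smul_eq_mul, ← mul_assoc, pow_succ']
    congr 2
    funext l
    refine Fin.cases rfl (fun j => rfl) l

/-- The weight `∏_{j ≠ k} [z_j/z_k]⁻¹` of the residue at `w = z_k`. -/
def resWeight {N : ℕ} (z : Fin N → ℂ) (k : Fin N) : ℂ :=
  (∏ j ∈ Finset.univ.erase k, br (z j / z k))⁻¹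

/-- The multiple contour integral as a sum of residues. -/
theorem multiContour_eq_sum {N n : ℕ} {S : Set ℂ} {z : Fin N → ℂ} (hz0 : ∀ j, z j ≠ 0)
    (hS0 : 0 ∈ S) (hSz : ∀ j, -z j ∈ S) {r : Fin n → Fin N → ℝ}
    (hr : ∀ l, IsContour S z (r l)) (F G : (Fin n → ℂ) → ℂ)
    (hG : ∀ w, (∀ l, w l ∉ S) → DifferentiableAt ℂ G w)
    (hF : ∀ w, (∀ l, w l ∉ S ∧ ∀ j, w l ≠ z j) → F w = G w / ∏ l, ∏ j, br (z j / w l)) :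
    multiContour z r F =
      (-1) ^ n * ∑ κ : Fin n → Fin N, G (z ∘ κ) * ∏ l, resWeight z (κ l) := by
  rw [multiContour, Finset.mul_sum]
  refine Finset.sum_congr rfl fun κ _ => ?_
  have hball : ∀ w : Fin n → ℂ, (∀ l, w l ∈ Metric.closedBall (z (κ l)) (r l (κ l))) →
      ∀ l, w l ∉ S ∧ ∀ j, j ≠ κ l → w l ≠ z j := by
    intro w hw l
    exact ⟨fun h => ((hr l (κ l)).2.2 _ h) (hw l), fun j hj h => (hr l (κ l)).2.1 j hj (h ▸ hw l)⟩
  have hpi : (Real.pi : ℂ) * Complex.I ≠ 0 := by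
    simp [Real.pi_ne_zero]
  -- With k = κ l one has 1/(πi w [z_k/w]) = (w - z_k)⁻¹ · (-z_k)/(πi(z_k + w)). The second factor
  -- is regular on the disc and equals -1/(2πi) at w = z_k, whence the sign (-1)^n of the residue
  -- sum.
  set H : (Fin n → ℂ) → ℂ := fun w =>
    (∏ l, (-(z (κ l)) / (Real.pi * Complex.I * (z (κ l) + w l)) *
      (∏ j ∈ Finset.univ.erase (κ l), br (z j / w l))⁻¹)) * G w with hH
  have hHd : ∀ w, (∀ l, w l ∈ Metric.closedBall (z (κ l)) (r l (κ l))) →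
      DifferentiableAt ℂ H w := by
    intro w hw
    have hb := hball w hw
    have hw0 : ∀ l, w l ≠ 0 := fun l h => (hb l).1 (h ▸ hS0)
    refine DifferentiableAt.mul ?_ (hG w fun l => (hb l).1)
    refine DifferentiableAt.prod_of_forall fun l _ => ?_
    refine DifferentiableAt.mul ?_ ?_
    · refine DifferentiableAt.div_of_ne (by fun_prop) (by fun_prop) (mul_ne_zero hpi ?_)
      intro h
      exact (hb l).1 (by rw [← neg_eq_of_add_eq_zero_right h]; exact hSz _)
    · refine DifferentiableAt.fun_inv ?_ ?_
      · refine DifferentiableAt.prod_of_forall fun j _ => ?_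
        refine DifferentiableAt.br ?_ (div_ne_zero (hz0 j) (hw0 l))
        exact DifferentiableAt.div_of_ne (by fun_prop) (by fun_prop) (hw0 l)
      · refine Finset.prod_ne_zero_iff.2 fun j hj h => ?_
        rcases (br_div_eq_zero_iff (hz0 j) (hw0 l)).1 h with h | h
        · exact (hb l).2 j (Finset.ne_of_mem_erase hj) h.symm
        · exact (hb l).1 (by rw [← neg_eq_iff_eq_neg.2 h]; exact hSz _)
  have key := torusIntegral_cauchy (fun l => z (κ l)) (fun l => r l (κ l))
    (fun l => (hr l _).1) H hHd
  have hcongr : torusIntegral (fun w => (∏ l, ((Real.pi : ℂ) * Complex.I * w l)⁻¹) * F w)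
      (fun l => z (κ l)) (fun l => r l (κ l)) =
      torusIntegral (fun w => (∏ l, (w l - z (κ l))⁻¹) * H w)
      (fun l => z (κ l)) (fun l => r l (κ l)) := by
    unfold torusIntegral
    refine MeasureTheory.setIntegral_congr_fun measurableSet_Icc fun θ _ => ?_
    beta_reduce
    congr 1
    set w := torusMap (fun l => z (κ l)) (fun l => r l (κ l)) θ with hw
    have hwb : ∀ l, w l ∈ Metric.closedBall (z (κ l)) (r l (κ l)) := by
      intro l
      simp [hw, torusMap, dist_eq_norm, Complex.norm_exp_ofReal_mul_I,
        abs_of_pos (hr l (κ l)).1]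
    have hb := hball w hwb
    have hw0 : ∀ l, w l ≠ 0 := fun l h => (hb l).1 (h ▸ hS0)
    have hwz : ∀ l, w l ≠ z (κ l) := by
      intro l
      simp [hw, torusMap, ((hr l (κ l)).1).ne']
    have hwz' : ∀ l, z (κ l) + w l ≠ 0 := by
      intro l h
      exact (hb l).1 (by rw [← neg_eq_of_add_eq_zero_right h]; exact hSz _)
    rw [hF w fun l => ⟨(hb l).1, fun j => ?_⟩, hH]
    swap
    · by_cases h : j = κ l
      · exact h ▸ hwz l
      · exact (hb l).2 j h
    beta_reduce
    rw [div_eq_mul_inv, mul_comm (G w), ← mul_assoc, ← mul_assoc, ← Finset.prod_inv_distrib,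
      ← Finset.prod_mul_distrib, ← Finset.prod_mul_distrib]
    congr 1
    refine Finset.prod_congr rfl fun l _ => ?_
    rw [← Finset.mul_prod_erase _ _ (Finset.mem_univ (κ l)), mul_inv (br _), ← mul_assoc,
      ← mul_assoc]
    congr 1
    rw [br_div (hz0 _) (hw0 l)]
    have h1 := hwz' l
    have h2 : z (κ l) - w l ≠ 0 := sub_ne_zero.2 (hwz l).symm
    have h3 : w l - z (κ l) ≠ 0 := sub_ne_zero.2 (hwz l)
    have h4 := hw0 l
    have h5 := hz0 (κ l)
    have hpi' : (Real.pi : ℂ) ≠ 0 := by simp [Real.pi_ne_zero]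
    have hI := Complex.I_ne_zero
    field_simp
    ring
  rw [hcongr, key, hH]
  beta_reduce
  rw [Finset.prod_mul_distrib, mul_comm _ (G _), mul_left_comm]
  rw [mul_left_comm ((-1 : ℂ) ^ n)]
  congr 1
  rw [← mul_assoc]
  congr 1
  have hpow : ∀ a : ℂ, a ^ n = ∏ _l : Fin n, a := fun a => by simp
  rw [hpow, hpow, ← Finset.prod_mul_distrib]
  refine Finset.prod_congr rfl fun l _ => ?_
  have := hz0 (κ l)
  have hpi' : (Real.pi : ℂ) ≠ 0 := by simp [Real.pi_ne_zero]
  have hI := Complex.I_ne_zero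
  field_simp
  ring

/-! ### Products over pairs -/

theorem prod_Iic_mul_prod_Ioi {N : ℕ} (a : Fin N) (f : Fin N → ℂ) :
    (∏ j ∈ Finset.Iic a, f j) * ∏ j ∈ Finset.Ioi a, f j = ∏ j, f j := by
  rw [← Finset.prod_mul_prod_compl (Finset.Iic a)]
  congr 2
  ext; simp

theorem prod_Ici_mul_prod_Iio {N : ℕ} (a : Fin N) (f : Fin N → ℂ) :
    (∏ j ∈ Finset.Ici a, f j) * ∏ j ∈ Finset.Iio a, f j = ∏ j, f j := by
  rw [← Finset.prod_mul_prod_compl (Finset.Ici a)]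
  congr 2
  ext; simp

/-- The product of `f (x i) (x j)` over all pairs `i < j`. -/
def pairProd {n : ℕ} (f : ℂ → ℂ → ℂ) (x : Fin n → ℂ) : ℂ :=
  ∏ i, ∏ j ∈ Finset.Ioi i, f (x i) (x j)

theorem prod_pairs_eq {n : ℕ} (f : Fin n → Fin n → ℂ) :
    ∏ i, ∏ j ∈ Finset.Ioi i, f i j =
      ∏ p ∈ (Finset.univ : Finset (Fin n × Fin n)).filter (fun p => p.1 < p.2), f p.1 p.2 := by
  rw [Finset.prod_filter, ← Finset.univ_product_univ, Finset.prod_product]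
  refine Finset.prod_congr rfl fun i _ => ?_
  rw [← Finset.prod_filter]
  congr 1
  ext; simp

theorem pairProd_rev {n : ℕ} (f : ℂ → ℂ → ℂ) (x : Fin n → ℂ) :
    pairProd f (x ∘ Fin.rev) = pairProd (fun u v => f v u) x := by
  unfold pairProd
  rw [prod_pairs_eq (fun i j => f ((x ∘ Fin.rev) i) ((x ∘ Fin.rev) j)),
    prod_pairs_eq (fun i j => f (x j) (x i))]
  refine Finset.prod_nbij' (fun p => (p.2.rev, p.1.rev)) (fun p => (p.2.rev, p.1.rev)) ?_ ?_ ?_ ?_ ?_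
  all_goals simp

theorem pairProd_congr {n : ℕ} {f g : ℂ → ℂ → ℂ} {x y : Fin n → ℂ}
    (h : ∀ i j, i < j → f (x i) (x j) = g (y i) (y j)) : pairProd f x = pairProd g y :=
  Finset.prod_congr rfl fun i _ => Finset.prod_congr rfl fun j hj =>
    h i j (Finset.mem_Ioi.1 hj)

theorem prod_Ioi_rev {N : ℕ} (a : Fin N) (f : Fin N → ℂ) :
    ∏ j ∈ Finset.Ioi a.rev, f j = ∏ j ∈ Finset.Iio a, f j.rev := by
  refine Finset.prod_nbij' Fin.rev Fin.rev ?_ ?_ ?_ ?_ ?_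
  all_goals simp [Fin.lt_rev_iff, Fin.rev_lt_iff]

theorem prod_Iio_rev {N : ℕ} (a : Fin N) (f : Fin N → ℂ) :
    ∏ j ∈ Finset.Iio a.rev, f j = ∏ j ∈ Finset.Ioi a, f j.rev := by
  refine Finset.prod_nbij' Fin.rev Fin.rev ?_ ?_ ?_ ?_ ?_
  all_goals simp [Fin.lt_rev_iff]

/-! ### The components as finite sums -/

/-- Points at which none of the brackets occurring in the components of `Ψ_N` degenerates. -/
structure Good (q : ℂ) {N : ℕ} (z : Fin N → ℂ) : Prop where
  ne : ∀ j, z j ≠ 0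
  br_ne : ∀ j k, j ≠ k → br (z j / z k) ≠ 0
  qbr_ne : ∀ j k, br (q * z j / z k) ≠ 0
  qqbr_ne : ∀ j k, br (q ^ 2 * z j * z k) ≠ 0

theorem br_mul_div_ne_iff {c x y : ℂ} (hc : c ≠ 0) (hx : x ≠ 0) (hy : y ≠ 0) :
    br (c * x / y) ≠ 0 ↔ y ≠ c * x ∧ y ≠ -(c * x) := by
  rw [Ne, br_div_eq_zero_iff (mul_ne_zero hc hx) hy, not_or]
  exact and_congr ne_comm (not_congr (by rw [eq_comm (a := y), neg_eq_iff_eq_neg]))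

theorem br_mul_mul_ne_iff {c x y : ℂ} (hc : c ≠ 0) (hx : x ≠ 0) (hy : y ≠ 0) :
    br (c * x * y) ≠ 0 ↔ x ≠ c⁻¹ * y⁻¹ ∧ x ≠ -(c⁻¹ * y⁻¹) := by
  rw [Ne, br_eq_zero_iff (mul_ne_zero (mul_ne_zero hc hx) hy), not_or]
  refine and_congr (not_congr ?_) (not_congr ?_)
  · field_simp
  · field_simp

theorem br_ne_zero_of_ne {x : ℂ} (h0 : x ≠ 0) (h1 : x ≠ 1) (h2 : x ≠ -1) : br x ≠ 0 := by
  rw [Ne, br_eq_zero_iff h0]; tauto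

/-- Each excluded value is a zero of one bracket. Only z_j = -z_j has no counterpart among the
brackets; it is excluded by z_j ≠ 0. -/
theorem mem_generic_singPsi_iff {q : ℂ} (hq0 : q ≠ 0) {N : ℕ}
    {z : Fin N → ℂ} : z ∈ generic (singPsi q) ↔ Good q z := by
  have hmem : ∀ w, w ∈ singPsi q z ↔ w = 0 ∨ ∃ j, w = -z j ∨ w = q * z j ∨ w = -(q * z j) ∨
      w = (q ^ 2)⁻¹ * (z j)⁻¹ ∨ w = -((q ^ 2)⁻¹ * (z j)⁻¹) := by
    intro w; simp [singPsi]
  have hq2 : q ^ 2 ≠ 0 := pow_ne_zero _ hq0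
  constructor
  · rintro ⟨hinj, h⟩
    have h' : ∀ j k, z j ≠ -z k ∧ z j ≠ q * z k ∧ z j ≠ -(q * z k) ∧
        z j ≠ (q ^ 2)⁻¹ * (z k)⁻¹ ∧ z j ≠ -((q ^ 2)⁻¹ * (z k)⁻¹) := by
      intro j k
      have := h j
      rw [hmem, not_or, not_exists] at this
      simpa only [not_or] using this.2 k
    have ne : ∀ j, z j ≠ 0 := fun j h0 => h j ((hmem _).2 (Or.inl h0))
    refine ⟨ne, fun j k hjk => ?_, fun j k => ?_, fun j k => ?_⟩
    · rw [Ne, br_div_eq_zero_iff (ne j) (ne k), not_or]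
      exact ⟨fun e => hjk (hinj e), (h' j k).1⟩
    · exact (br_mul_div_ne_iff hq0 (ne j) (ne k)).2 ⟨(h' k j).2.1, (h' k j).2.2.1⟩
    · exact (br_mul_mul_ne_iff hq2 (ne j) (ne k)).2 (h' j k).2.2.2
  · intro h
    have hne : ∀ j k, j ≠ k → z j ≠ z k ∧ z j ≠ -z k := by
      intro j k hjk
      have := h.br_ne j k hjk
      rwa [Ne, br_div_eq_zero_iff (h.ne j) (h.ne k), not_or] at this
    refine ⟨fun j k e => by_contra fun hjk => (hne j k hjk).1 e, fun j hj => ?_⟩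
    rcases (hmem _).1 hj with h0 | ⟨k, h0 | h0 | h0 | h0 | h0⟩
    · exact h.ne j h0
    · by_cases hjk : j = k
      · subst hjk; exact h.ne j (self_eq_neg.1 h0)
      · exact (hne j k hjk).2 h0
    · exact ((br_mul_div_ne_iff hq0 (h.ne k) (h.ne j)).1 (h.qbr_ne k j)).1 h0
    · exact ((br_mul_div_ne_iff hq0 (h.ne k) (h.ne j)).1 (h.qbr_ne k j)).2 h0
    · exact ((br_mul_mul_ne_iff hq2 (h.ne j) (h.ne k)).1 (h.qqbr_ne j k)).1 h0
    · exact ((br_mul_mul_ne_iff hq2 (h.ne j) (h.ne k)).1 (h.qqbr_ne j k)).2 h0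

/-- The reflected point `z_j ↦ c / z_{N+1-j}`. -/
def dual (c : ℂ) {N : ℕ} (z : Fin N → ℂ) : Fin N → ℂ := fun j => c / z j.rev

/-- The condition on c gives q² y_j y_k = -(q z z')⁻¹ for dual variables y, and the bracket is
invariant under x ↦ -x⁻¹. The points ±β⁻¹ account for the last conclusion. -/
theorem good_dual_of_generic {q β c : ℂ} (hq0 : q ≠ 0) (hc : c ^ 2 * q ^ 3 = -1)
    (hβ : β ≠ 0) {N : ℕ} {z : Fin N → ℂ} (hz : z ∈ generic (singPsiBar q β)) :
    Good q (dual c z) ∧ ∀ j, z j ≠ 0 ∧ br (β * z j) ≠ 0 := by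
  have hmem : ∀ w, w ∈ singPsiBar q β z ↔ (w = 0 ∨ w = β⁻¹ ∨ w = -β⁻¹) ∨
      ∃ j, w = -z j ∨ w = q⁻¹ * z j ∨ w = -(q⁻¹ * z j) ∨
      w = q⁻¹ * (z j)⁻¹ ∨ w = -(q⁻¹ * (z j)⁻¹) := by
    intro w; simp [singPsiBar]
  obtain ⟨hinj, h⟩ := hz
  have h' : ∀ j k, z j ≠ -z k ∧ z j ≠ q⁻¹ * z k ∧ z j ≠ -(q⁻¹ * z k) ∧
      z j ≠ q⁻¹ * (z k)⁻¹ ∧ z j ≠ -(q⁻¹ * (z k)⁻¹) := by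
    intro j k
    have := h j
    rw [hmem, not_or, not_exists] at this
    simpa only [not_or] using this.2 k
  have ne : ∀ j, z j ≠ 0 := fun j h0 => h j ((hmem _).2 (Or.inl (Or.inl h0)))
  have hc0 : c ≠ 0 := by rintro rfl; simp at hc
  have e1 : ∀ j k, dual c z j / dual c z k = z k.rev / z j.rev := by
    intro j k
    have := ne j.rev; have := ne k.rev
    unfold dual; field_simp
  have e2 : ∀ j k, br (q ^ 2 * dual c z j * dual c z k) = br (q * z j.rev * z k.rev) := by
    intro j k
    have : q ^ 2 * dual c z j * dual c z k = -(q * z j.rev * z k.rev)⁻¹ := by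
      have := ne j.rev; have := ne k.rev
      unfold dual; field_simp; linear_combination hc
    rw [this, br_neg, br_inv, neg_neg]
  refine ⟨⟨fun j => div_ne_zero hc0 (ne _), fun j k hjk => ?_, fun j k => ?_, fun j k => ?_⟩,
    fun j => ⟨ne j, ?_⟩⟩
  · rw [e1, Ne, br_div_eq_zero_iff (ne _) (ne _), not_or]
    exact ⟨fun e => hjk (Fin.rev_injective (hinj e)).symm, (h' _ _).1⟩
  · rw [mul_div_assoc, e1, ← mul_div_assoc, br_mul_div_ne_iff hq0 (ne _) (ne _)]
    constructor
    · intro e; exact (h' k.rev j.rev).2.1 (by rw [e]; field_simp)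
    · intro e; exact (h' k.rev j.rev).2.2.1 (by rw [e]; field_simp)
  · rw [e2, br_mul_mul_ne_iff hq0 (ne _) (ne _)]
    exact (h' _ _).2.2.2
  · rw [Ne, br_eq_zero_iff (mul_ne_zero hβ (ne j)), not_or]
    constructor
    · intro e; exact h j ((hmem _).2 (Or.inl (Or.inr (Or.inl (eq_inv_of_mul_eq_one_right e)))))
    · intro e
      refine h j ((hmem _).2 (Or.inl (Or.inr (Or.inr ?_))))
      field_simp; linear_combination e

/-- The symmetric prefactor. -/
def pref (q : ℂ) {N : ℕ} (z : Fin N → ℂ) : ℂ :=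
  pairProd (fun u v => br (q * v / u) * br (q ^ 2 * u * v)) z

/-- The part of the numerator of the integrand that does not depend on the configuration. -/
def num (q : ℂ) (B : ℂ → ℂ) {n : ℕ} (w : Fin n → ℂ) : ℂ :=
  pairProd (fun u v => br (q * v / u) * br (u / v) * (br (q * u * v) * br (q ^ 2 * u * v))) w *
    ∏ l, (br (q ^ 2 * w l * w l) * B (w l))

/-- The part of the numerator that depends on the position `a` of one of the spins. -/
def numAt (q : ℂ) {N : ℕ} (z : Fin N → ℂ) (a : Fin N) (w : ℂ) : ℂ :=
  (∏ j ∈ Finset.Ioi a, br (z j / w)) * ∏ j ∈ Finset.Iio a, br (q * z j / w)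

/-- The part of the denominator that is symmetric in the `z_j` and regular at `w = z_k`. -/
def den (q : ℂ) {N : ℕ} (z : Fin N → ℂ) (w : ℂ) : ℂ :=
  ∏ j, (br (q * z j / w) * br (q ^ 2 * w * z j))

/-- The weight of the residue at `w = z_k` in the variable attached to the site `a`. -/
def siteWeight (q : ℂ) {N : ℕ} (z : Fin N → ℂ) (a k : Fin N) : ℂ :=
  numAt q z a (z k) / den q z (z k) * resWeight z k

/-- The common form of the components of `Ψ_N` and `Ψ̄_N`, as a finite sum of residues. -/
def phi (q : ℂ) (B : ℂ → ℂ) {N n : ℕ} (a : Fin n → Fin N) (z : Fin N → ℂ) : ℂ :=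
  br q ^ n * pref q z *
    ∑ κ : Fin n → Fin N, num q B (z ∘ κ) * ∏ l, siteWeight q z (a l) (κ l)

/-- The partial products over j ≤ a and j ≥ a are completed to full products, at the price of
`numAt`; the diagonal factors i = j of the numerator join the one-variable factors. -/
theorem xi_eq (q β : ℂ) {N n : ℕ} (a : Fin n ↪o Fin N) (z : Fin N → ℂ) (w : Fin n → ℂ)
    (h1 : ∀ l j, br (z j / w l) ≠ 0) (h2 : ∀ l j, br (q * z j / w l) ≠ 0) :
    Xi q β a z w = (num q (fun w => br (β * w)) w * ∏ l, (numAt q z (a l) (w l) /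
      den q z (w l))) / ∏ l, ∏ j, br (z j / w l) := by
  have hnum : ((∏ i, ∏ j ∈ Finset.Ioi i,
      br (q * w j / w i) * br (w i / w j) * br (q * w i * w j)) *
    (∏ i, ∏ j ∈ Finset.Ici i, br (q ^ 2 * w i * w j)) * ∏ i, br (β * w i)) =
      num q (fun w => br (β * w)) w := by
    simp only [num, pairProd, ← Finset.mul_prod_Ioi_eq_prod_Ici, Finset.prod_mul_distrib]
    ring
  rw [Xi, hnum, mul_div_assoc, ← Finset.prod_div_distrib, div_eq_mul_inv,
    ← Finset.prod_inv_distrib]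
  congr 1
  refine Finset.prod_congr rfl fun l _ => ?_
  rw [den, Finset.prod_mul_distrib, ← prod_Iic_mul_prod_Ioi (a l) (fun j => br (z j / w l)),
    ← prod_Ici_mul_prod_Iio (a l) (fun j => br (q * z j / w l)), numAt]
  have n1 : ∏ j ∈ Finset.Ioi (a l), br (z j / w l) ≠ 0 :=
    Finset.prod_ne_zero_iff.2 fun j _ => h1 l j
  have n2 : ∏ j ∈ Finset.Iic (a l), br (z j / w l) ≠ 0 :=
    Finset.prod_ne_zero_iff.2 fun j _ => h1 l j
  have n3 : ∏ j ∈ Finset.Iio (a l), br (q * z j / w l) ≠ 0 :=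
    Finset.prod_ne_zero_iff.2 fun j _ => h2 l j
  have n4 : ∏ j ∈ Finset.Ici (a l), br (q * z j / w l) ≠ 0 :=
    Finset.prod_ne_zero_iff.2 fun j _ => h2 l j
  -- If this product vanishes, both sides are 0 by the convention for division by zero, so no
  -- regularity is needed here.
  by_cases n5 : ∏ j, br (q ^ 2 * w l * z j) = 0
  · simp [n5]
  · field_simp

/-- Here the poles come from [w/z_j]; rewriting these N brackets as [z_j/w] produces one sign (-1)^N
per variable. -/
theorem xiBar_eq (q β : ℂ) {N n : ℕ} (b : Fin n ↪o Fin N) (z : Fin N → ℂ) (w : Fin n → ℂ)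
    (h1 : ∀ l j, br (z j / w l) ≠ 0) (h2 : ∀ l j, br (q * w l / z j) ≠ 0) :
    XiBar q β b z w =
      (pairProd (fun u v => br (q * v / u) * br (u / v) * (br (q * u * v) * br (q ^ 2 * u * v))) w *
        ∏ l, (br (q * w l * w l) * (br (β * w l))⁻¹ *
          (((∏ j ∈ Finset.Iio (b l), br (w l / z j)) * ∏ j ∈ Finset.Ioi (b l), br (q * w l / z j)) /
            (∏ j, (br (q * w l / z j) * br (q * w l * z j))) * (-1) ^ N))) /
        ∏ l, ∏ j, br (z j / w l) := by
  have hnum : ((∏ i, ∏ j ∈ Finset.Ioi i,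
      br (q * w j / w i) * br (w i / w j) * br (q ^ 2 * w i * w j)) *
    ∏ i, ∏ j ∈ Finset.Ici i, br (q * w i * w j)) =
      pairProd (fun u v => br (q * v / u) * br (u / v) * (br (q * u * v) * br (q ^ 2 * u * v))) w *
        ∏ l, br (q * w l * w l) := by
    simp only [pairProd, ← Finset.mul_prod_Ioi_eq_prod_Ici, Finset.prod_mul_distrib]
    ring
  have hN : ∀ l, ∏ j, br (z j / w l) = (-1) ^ N * ∏ j, br (w l / z j) := by
    intro l
    simp_rw [br_swap (w l) (z _), ← neg_one_mul (br (w l / z _)), Finset.prod_mul_distrib,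
      Finset.prod_const, Finset.card_univ, Fintype.card_fin]
  have key : ∀ l, ((∏ j ∈ Finset.Iic (b l), br (q * w l / z j)) *
      (∏ j ∈ Finset.Ici (b l), br (w l / z j)) * ∏ j, br (q * w l * z j))⁻¹ =
      (((∏ j ∈ Finset.Iio (b l), br (w l / z j)) * ∏ j ∈ Finset.Ioi (b l), br (q * w l / z j)) /
            (∏ j, (br (q * w l / z j) * br (q * w l * z j))) * (-1) ^ N) /
            ∏ j, br (z j / w l) := by
    intro l
    have h1' : ∀ j, br (w l / z j) ≠ 0 := by
      intro j; rw [br_swap, neg_ne_zero]; exact h1 l j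
    rw [Finset.prod_mul_distrib, hN, ← prod_Iic_mul_prod_Ioi (b l) (fun j => br (q * w l / z j)),
      ← prod_Ici_mul_prod_Iio (b l) (fun j => br (w l / z j))]
    have n1 : ∏ j ∈ Finset.Iio (b l), br (w l / z j) ≠ 0 :=
      Finset.prod_ne_zero_iff.2 fun j _ => h1' j
    have n2 : ∏ j ∈ Finset.Ici (b l), br (w l / z j) ≠ 0 :=
      Finset.prod_ne_zero_iff.2 fun j _ => h1' j
    have n3 : ∏ j ∈ Finset.Iic (b l), br (q * w l / z j) ≠ 0 :=
      Finset.prod_ne_zero_iff.2 fun j _ => h2 l j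
    have n4 : ∏ j ∈ Finset.Ioi (b l), br (q * w l / z j) ≠ 0 :=
      Finset.prod_ne_zero_iff.2 fun j _ => h2 l j
    by_cases n5 : ∏ j, br (q * w l * z j) = 0
    · simp [n5]
    · field_simp
  rw [XiBar, hnum, div_eq_mul_inv, mul_inv, ← Finset.prod_inv_distrib, ← Finset.prod_inv_distrib,
    Finset.prod_congr rfl fun l _ => key l]
  simp only [Finset.prod_mul_distrib, Finset.prod_div_distrib]
  ring

theorem differentiableAt_pairProd {n : ℕ} {f : ℂ → ℂ → ℂ} {w : Fin n → ℂ}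
    (hf : ∀ i j, DifferentiableAt ℂ (fun w : Fin n → ℂ => f (w i) (w j)) w) :
    DifferentiableAt ℂ (fun w : Fin n → ℂ => pairProd f w) w :=
  DifferentiableAt.prod_of_forall fun i _ => DifferentiableAt.prod_of_forall fun j _ => hf i j

theorem psiComp_eq {q β : ℂ} (hq0 : q ≠ 0) (hβ : β ≠ 0) {N n : ℕ} (a : Fin n ↪o Fin N)
    {z : Fin N → ℂ} (hz : Good q z) {r : Fin n → Fin N → ℝ}
    (hr : ∀ l, IsContour (singPsi q z) z (r l)) :
    psiComp q β a r z = phi q (fun w => br (β * w)) a z := by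
  have hmem : ∀ w, w ∈ singPsi q z ↔ w = 0 ∨ ∃ j, w = -z j ∨ w = q * z j ∨ w = -(q * z j) ∨
      w = (q ^ 2)⁻¹ * (z j)⁻¹ ∨ w = -((q ^ 2)⁻¹ * (z j)⁻¹) := by
    intro w; simp [singPsi]
  have hq2 : q ^ 2 ≠ 0 := pow_ne_zero _ hq0
  have hreg : ∀ w, w ∉ singPsi q z → w ≠ 0 ∧ ∀ j, w ≠ -z j ∧ br (q * z j / w) ≠ 0 ∧
      br (q ^ 2 * w * z j) ≠ 0 := by
    intro w hw
    rw [hmem, not_or, not_exists] at hw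
    refine ⟨hw.1, fun j => ?_⟩
    have h := hw.2 j
    simp only [not_or] at h
    exact ⟨h.1, (br_mul_div_ne_iff hq0 (hz.ne j) hw.1).2 ⟨h.2.1, h.2.2.1⟩,
      (br_mul_mul_ne_iff hq2 hw.1 (hz.ne j)).2 h.2.2.2⟩
  rw [psiComp, multiContour_eq_sum (S := singPsi q z) hz.ne ((hmem _).2 (Or.inl rfl))
    (fun j => (hmem _).2 (Or.inr ⟨j, Or.inl rfl⟩)) hr _
    (fun w => num q (fun w => br (β * w)) w * ∏ l, (numAt q z (a l) (w l) / den q z (w l)))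
    ?_ ?_]
  · rw [phi, pref, pairProd, neg_pow (br q)]
    -- The sign of the residues cancels the sign in (-[q])^n.
    have : ∀ x y s : ℂ, (-1) ^ n * x * y * ((-1) ^ n * s) = x * y * s := by
      intro x y s
      linear_combination x * y * s * (by rw [← pow_add, ← two_mul, pow_mul, neg_one_sq, one_pow] :
        (-1 : ℂ) ^ n * (-1) ^ n = 1)
    rw [this]
    congr 1
    refine Finset.sum_congr rfl fun κ _ => ?_
    rw [mul_assoc, ← Finset.prod_mul_distrib]
    rfl
  · intro w hw
    have h0 : ∀ l, w l ≠ 0 := fun l => (hreg _ (hw l)).1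
    unfold num numAt den
    refine DifferentiableAt.mul (DifferentiableAt.mul ?_ ?_) ?_
    · refine differentiableAt_pairProd fun i j => ?_
      refine DifferentiableAt.mul (DifferentiableAt.mul ?_ ?_) (DifferentiableAt.mul ?_ ?_)
      · exact DifferentiableAt.br_div (by fun_prop) (by fun_prop) (mul_ne_zero hq0 (h0 j)) (h0 i)
      · exact DifferentiableAt.br_div (by fun_prop) (by fun_prop) (h0 i) (h0 j)
      · exact DifferentiableAt.br (by fun_prop) (mul_ne_zero (mul_ne_zero hq0 (h0 i)) (h0 j))
      · exact DifferentiableAt.br (by fun_prop) (mul_ne_zero (mul_ne_zero hq2 (h0 i)) (h0 j))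
    · refine DifferentiableAt.prod_of_forall fun l _ => DifferentiableAt.mul ?_ ?_
      · exact DifferentiableAt.br (by fun_prop) (mul_ne_zero (mul_ne_zero hq2 (h0 l)) (h0 l))
      · exact DifferentiableAt.br (by fun_prop) (mul_ne_zero hβ (h0 l))
    · refine DifferentiableAt.prod_of_forall fun l _ => DifferentiableAt.div_of_ne
        (DifferentiableAt.mul ?_ ?_) ?_ ?_
      · exact DifferentiableAt.prod_of_forall fun j _ => DifferentiableAt.br_div (by fun_prop) (by fun_prop) (hz.ne j) (h0 l)
      · exact DifferentiableAt.prod_of_forall fun j _ => DifferentiableAt.br_div (by fun_prop) (by fun_prop) (mul_ne_zero hq0 (hz.ne j)) (h0 l)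
      · refine DifferentiableAt.prod_of_forall fun j _ => DifferentiableAt.mul ?_ ?_
        · exact DifferentiableAt.br_div (by fun_prop) (by fun_prop) (mul_ne_zero hq0 (hz.ne j)) (h0 l)
        · exact DifferentiableAt.br (by fun_prop) (mul_ne_zero (mul_ne_zero hq2 (h0 l)) (hz.ne j))
      · exact Finset.prod_ne_zero_iff.2 fun j _ =>
          mul_ne_zero ((hreg _ (hw l)).2 j).2.1 ((hreg _ (hw l)).2 j).2.2
  · intro w hw
    refine xi_eq q β a z w (fun l j => ?_) (fun l j => ((hreg _ (hw l).1).2 j).2.1)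
    rw [Ne, br_div_eq_zero_iff (hz.ne j) (hreg _ (hw l).1).1, not_or]
    exact ⟨((hw l).2 j).symm, fun e => ((hreg _ (hw l).1).2 j).1 (by rw [e, neg_neg])⟩

/-- The function attached to the second boundary in the dual form of the components of `Ψ̄_N`. -/
def dualB (β c : ℂ) (v : ℂ) : ℂ := (br (β * c / v))⁻¹

/-- Inversion alone would turn [qz_j/z_i] into [qz_i/z_j]; reversing both the sites and the
integration variables restores the order, so the dual integrand has the shape of that of Ψ_N. -/
theorem psiBarComp_eq {q β c : ℂ} (hq0 : q ≠ 0) (hβ : β ≠ 0) (hc : c ^ 2 * q ^ 3 = -1)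
    {N n : ℕ} (b : Fin n ↪o Fin N)
    {z : Fin N → ℂ} (hz : z ∈ generic (singPsiBar q β)) {r : Fin n → Fin N → ℝ}
    (hr : ∀ l, IsContour (singPsiBar q β z) z (r l)) :
    psiBarComp q β b r z = (∏ i, br (β * z i)) *
      phi q (dualB β c) (Fin.rev ∘ b ∘ Fin.rev) (dual c z) := by
  have hmem : ∀ w, w ∈ singPsiBar q β z ↔ (w = 0 ∨ w = β⁻¹ ∨ w = -β⁻¹) ∨
      ∃ j, w = -z j ∨ w = q⁻¹ * z j ∨ w = -(q⁻¹ * z j) ∨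
      w = q⁻¹ * (z j)⁻¹ ∨ w = -(q⁻¹ * (z j)⁻¹) := by
    intro w; simp [singPsiBar]
  obtain ⟨hy, hz'⟩ := good_dual_of_generic hq0 hc hβ hz
  have hz0 : ∀ j, z j ≠ 0 := fun j => (hz' j).1
  have hq2 : q ^ 2 ≠ 0 := pow_ne_zero _ hq0
  have hc0 : c ≠ 0 := by rintro rfl; simp at hc
  have hreg : ∀ w, w ∉ singPsiBar q β z → w ≠ 0 ∧ br (β * w) ≠ 0 ∧
      ∀ j, w ≠ -z j ∧ br (q * w / z j) ≠ 0 ∧ br (q * w * z j) ≠ 0 := by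
    intro w hw
    rw [hmem, not_or, not_exists, not_or, not_or] at hw
    refine ⟨hw.1.1, ?_, fun j => ?_⟩
    · rw [Ne, br_eq_zero_iff (mul_ne_zero hβ hw.1.1), not_or]
      constructor
      · intro e; exact hw.1.2.1 (eq_inv_of_mul_eq_one_right e)
      · intro e
        refine hw.1.2.2 ?_
        field_simp; linear_combination e
    have h := hw.2 j
    simp only [not_or] at h
    refine ⟨h.1, (br_mul_div_ne_iff hq0 hw.1.1 (hz0 j)).2 ⟨?_, ?_⟩,
      (br_mul_mul_ne_iff hq0 hw.1.1 (hz0 j)).2 h.2.2.2⟩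
    · intro e; exact h.2.1 (by rw [e]; field_simp)
    · intro e; exact h.2.2.1 (by rw [e]; field_simp)
  rw [psiBarComp, multiContour_eq_sum (S := singPsiBar q β z) hz0
    ((hmem _).2 (Or.inl (Or.inl rfl))) (fun j => (hmem _).2 (Or.inr ⟨j, Or.inl rfl⟩)) hr _
    (fun w => pairProd (fun u v => br (q * v / u) * br (u / v) *
        (br (q * u * v) * br (q ^ 2 * u * v))) w *
        ∏ l, (br (q * w l * w l) * (br (β * w l))⁻¹ *
          (((∏ j ∈ Finset.Iio (b l), br (w l / z j)) * ∏ j ∈ Finset.Ioi (b l), br (q * w l / z j)) /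
            (∏ j, (br (q * w l / z j) * br (q * w l * z j))) * (-1) ^ N)))
    ?_ ?_]
  · have e1 : ∀ u v : ℂ, u ≠ 0 → v ≠ 0 → br (q ^ 2 * (c / u) * (c / v)) = br (q * u * v) := by
      intro u v hu hv
      have : q ^ 2 * (c / u) * (c / v) = -(q * u * v)⁻¹ := by
        field_simp; linear_combination hc
      rw [this, br_neg, br_inv, neg_neg]
    have e2 : ∀ u v : ℂ, u ≠ 0 → v ≠ 0 → br (q * (c / u) * (c / v)) = br (q ^ 2 * u * v) := by
      intro u v hu hv
      have : q * (c / u) * (c / v) = -(q ^ 2 * u * v)⁻¹ := by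
        field_simp; linear_combination hc
      rw [this, br_neg, br_inv, neg_neg]
    have e3 : ∀ u v : ℂ, u ≠ 0 → v ≠ 0 → c / u / (c / v) = v / u := by
      intro u v hu hv; field_simp
    have e4 : ∀ u v : ℂ, u ≠ 0 → v ≠ 0 → q * (c / u) / (c / v) = q * v / u := by
      intro u v hu hv; field_simp
    have hpref : pref q (dual c z) =
        ∏ i, ∏ j ∈ Finset.Ioi i, br (q * z j / z i) * br (q * z i * z j) := by
      have : dual c z = (fun j => c / z j) ∘ Fin.rev := rfl
      rw [pref, this, pairProd_rev]
      refine Finset.prod_congr rfl fun i _ => Finset.prod_congr rfl fun j _ => ?_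
      beta_reduce
      rw [e4 _ _ (hz0 _) (hz0 _), e1 _ _ (hz0 _) (hz0 _), mul_right_comm q]
    -- The signs balance: (-1)^N from the poles written as [w/z_j], (-1)^(N-1) from the N - 1
    -- inverted brackets of the residue weight, and one -1 per variable, which accounts for the
    -- (-1)^n of the residue sum.
    have hweight : ∀ a k, (∏ j ∈ Finset.Iio a, br (z k / z j)) *
        (∏ j ∈ Finset.Ioi a, br (q * z k / z j)) /
          (∏ j, (br (q * z k / z j) * br (q * z k * z j))) * (-1) ^ N * (-resWeight z k) =
        siteWeight q (dual c z) a.rev k.rev := by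
      intro a k
      have hd : ∀ j : Fin N, dual c z j.rev = c / z j := fun j => by rw [dual, Fin.rev_rev]
      have hden : den q (dual c z) (dual c z k.rev) =
          ∏ j, (br (q * z k / z j) * br (q * z k * z j)) := by
        rw [den, ← Equiv.prod_comp Fin.revPerm]
        refine Finset.prod_congr rfl fun j _ => ?_
        rw [Fin.revPerm_apply, hd, hd, e4 _ _ (hz0 _) (hz0 _), e1 _ _ (hz0 _) (hz0 _)]
      have hres : resWeight (dual c z) k.rev =
          (∏ j ∈ Finset.univ.erase k, -1 * br (z j / z k))⁻¹ := by
        rw [resWeight]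
        congr 1
        refine Finset.prod_nbij' Fin.rev Fin.rev ?_ ?_ ?_ ?_ ?_
        · intro j hj; simpa [Fin.rev_eq_iff] using hj
        · intro j hj; simpa [Fin.rev_eq_iff] using hj
        · simp
        · simp
        · intro j _
          rw [hd, dual, e3 _ _ (hz0 _) (hz0 _), br_swap, neg_one_mul]
      rw [siteWeight, numAt, prod_Ioi_rev, prod_Iio_rev, hden, hres, mul_assoc]
      simp only [hd]
      congr 1
      · congr 2
        · exact Finset.prod_congr rfl fun j _ => by rw [e3 _ _ (hz0 _) (hz0 _)]
        · exact Finset.prod_congr rfl fun j _ => by rw [e4 _ _ (hz0 _) (hz0 _)]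
      · rw [resWeight, Finset.prod_mul_distrib, Finset.prod_const, Finset.card_erase_of_mem
          (Finset.mem_univ _), Finset.card_univ, Fintype.card_fin]
        obtain ⟨M, rfl⟩ : ∃ M, N = M + 1 := ⟨N - 1, by have := k.pos; omega⟩
        rw [Nat.add_sub_cancel, mul_inv, pow_succ, ← inv_pow, inv_neg, inv_one]
        ring
    have hnum : ∀ κ : Fin n → Fin N, num q (dualB β c) ((fun l => c / z (κ l)) ∘ Fin.rev) =
        pairProd (fun u v => br (q * v / u) * br (u / v) *
        (br (q * u * v) * br (q ^ 2 * u * v))) (z ∘ κ) *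
        ∏ l, (br (q * z (κ l) * z (κ l)) * (br (β * z (κ l)))⁻¹) := by
      intro κ
      rw [num, pairProd_rev]
      congr 1
      · refine pairProd_congr fun i j _ => ?_
        simp only [Function.comp]
        rw [e4 _ _ (hz0 _) (hz0 _), e3 _ _ (hz0 _) (hz0 _), e1 _ _ (hz0 _) (hz0 _),
          e2 _ _ (hz0 _) (hz0 _), mul_right_comm q, mul_right_comm (q ^ 2), mul_comm (br (q ^ 2 * _ * _))]
      · rw [← Equiv.prod_comp Fin.revPerm]
        refine Finset.prod_congr rfl fun l _ => ?_
        have := hz0 (κ l)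
        simp only [Fin.revPerm_apply, Function.comp, Fin.rev_rev, dualB]
        rw [e1 _ _ (hz0 _) (hz0 _)]
        congr 3
        field_simp
    have hterm : ∀ κ : Fin n → Fin N,
        num q (dualB β c) (dual c z ∘ Equiv.arrowCongr Fin.revPerm Fin.revPerm κ) *
          ∏ l, siteWeight q (dual c z) ((Fin.rev ∘ b ∘ Fin.rev) l)
            (Equiv.arrowCongr Fin.revPerm Fin.revPerm κ l) =
        (-1) ^ n * ((pairProd (fun u v => br (q * v / u) * br (u / v) *
          (br (q * u * v) * br (q ^ 2 * u * v))) (z ∘ κ) *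
        ∏ l, (br (q * (z ∘ κ) l * (z ∘ κ) l) * (br (β * (z ∘ κ) l))⁻¹ *
          (((∏ j ∈ Finset.Iio (b l), br ((z ∘ κ) l / z j)) *
            ∏ j ∈ Finset.Ioi (b l), br (q * (z ∘ κ) l / z j)) /
            (∏ j, (br (q * (z ∘ κ) l / z j) * br (q * (z ∘ κ) l * z j))) * (-1) ^ N))) *
          ∏ l, resWeight z (κ l)) := by
      intro κ
      have hκ : dual c z ∘ Equiv.arrowCongr Fin.revPerm Fin.revPerm κ =
          (fun l => c / z (κ l)) ∘ Fin.rev := by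
        funext l
        simp [dual]
      rw [hκ, hnum, mul_assoc (pairProd _ _), mul_assoc (pairProd _ _),
        mul_left_comm ((-1 : ℂ) ^ n)]
      congr 1
      rw [← Equiv.prod_comp Fin.revPerm (fun l => siteWeight q (dual c z) _ _),
        ← Finset.prod_mul_distrib, ← Finset.prod_mul_distrib,
        (by simp : (-1 : ℂ) ^ n = ∏ _l : Fin n, -1), ← Finset.prod_mul_distrib]
      refine Finset.prod_congr rfl fun l _ => ?_
      simp only [Fin.revPerm_apply, Function.comp, Fin.rev_rev, Equiv.arrowCongr_apply,
        Fin.revPerm_symm]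
      rw [← hweight]
      ring
    -- The sum over κ is reindexed by conjugation with the reversal.
    rw [phi, hpref, ← Equiv.sum_comp (Equiv.arrowCongr Fin.revPerm Fin.revPerm)
      (fun κ => num q (dualB β c) (dual c z ∘ κ) * _), Finset.sum_congr rfl fun κ _ => hterm κ, ← Finset.mul_sum]
    ring
  · intro w hw
    have h0 : ∀ l, w l ≠ 0 := fun l => (hreg _ (hw l)).1
    refine DifferentiableAt.mul ?_ ?_
    · refine differentiableAt_pairProd fun i j => ?_
      refine DifferentiableAt.mul (DifferentiableAt.mul ?_ ?_) (DifferentiableAt.mul ?_ ?_)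
      · exact DifferentiableAt.br_div (by fun_prop) (by fun_prop) (mul_ne_zero hq0 (h0 j)) (h0 i)
      · exact DifferentiableAt.br_div (by fun_prop) (by fun_prop) (h0 i) (h0 j)
      · exact DifferentiableAt.br (by fun_prop) (mul_ne_zero (mul_ne_zero hq0 (h0 i)) (h0 j))
      · exact DifferentiableAt.br (by fun_prop) (mul_ne_zero (mul_ne_zero hq2 (h0 i)) (h0 j))
    · refine DifferentiableAt.prod_of_forall fun l _ => DifferentiableAt.mul
        (DifferentiableAt.mul ?_ ?_) (DifferentiableAt.mul (DifferentiableAt.div_of_ne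
          (DifferentiableAt.mul ?_ ?_) ?_ ?_) (by fun_prop))
      · exact DifferentiableAt.br (by fun_prop) (mul_ne_zero (mul_ne_zero hq0 (h0 l)) (h0 l))
      · refine DifferentiableAt.fun_inv (DifferentiableAt.br ?_ (mul_ne_zero hβ (h0 l)))
          (hreg _ (hw l)).2.1
        fun_prop
      · exact DifferentiableAt.prod_of_forall fun j _ => DifferentiableAt.br_div (by fun_prop) (by fun_prop) (h0 l) (hz0 j)
      · exact DifferentiableAt.prod_of_forall fun j _ => DifferentiableAt.br_div (by fun_prop) (by fun_prop) (mul_ne_zero hq0 (h0 l)) (hz0 j)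
      · refine DifferentiableAt.prod_of_forall fun j _ => DifferentiableAt.mul ?_ ?_
        · exact DifferentiableAt.br_div (by fun_prop) (by fun_prop) (mul_ne_zero hq0 (h0 l)) (hz0 j)
        · exact DifferentiableAt.br (by fun_prop) (mul_ne_zero (mul_ne_zero hq0 (h0 l)) (hz0 j))
      · exact Finset.prod_ne_zero_iff.2 fun j _ =>
          mul_ne_zero ((hreg _ (hw l)).2.2 j).2.1 ((hreg _ (hw l)).2.2 j).2.2
  · intro w hw
    refine xiBar_eq q β b z w (fun l j => ?_) (fun l j => ((hreg _ (hw l).1).2.2 j).2.1)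
    rw [Ne, br_div_eq_zero_iff (hz0 j) (hreg _ (hw l).1).1, not_or]
    exact ⟨((hw l).2 j).symm, fun e => ((hreg _ (hw l).1).2.2 j).1 (by rw [e, neg_neg])⟩

/-! ### Exchange relations for the components -/

theorem swap_lt_swap {n : ℕ} {l l' i j : Fin n} (h : (l : ℕ) + 1 = l') (hij : i < j)
    (hne : ¬(i = l ∧ j = l')) : Equiv.swap l l' i < Equiv.swap l l' j := by
  rw [Equiv.swap_apply_def, Equiv.swap_apply_def]
  rw [Fin.ext_iff, Fin.ext_iff] at hne
  rw [Fin.lt_def] at hij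
  split_ifs with h1 h2 h3 h4 h5 h6 h7 h8 <;> rw [Fin.lt_def] <;> rw [Fin.ext_iff] at * <;> omega

/-- As l and l' are adjacent, the transposition permutes the ordered pairs other than (l, l') among
themselves; c is the product over these. -/
theorem pairProd_swap {n : ℕ} (f : ℂ → ℂ → ℂ) (x : Fin n → ℂ) {l l' : Fin n}
    (h : (l : ℕ) + 1 = l') :
    ∃ c, pairProd f x = f (x l) (x l') * c ∧
      pairProd f (x ∘ Equiv.swap l l') = f (x l') (x l) * c := by
  have hmem : (l, l') ∈ (Finset.univ : Finset (Fin n × Fin n)).filter (fun p => p.1 < p.2) :=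
    Finset.mem_filter.2 ⟨Finset.mem_univ _, by show (l : ℕ) < l'; omega⟩
  refine ⟨∏ p ∈ ((Finset.univ : Finset (Fin n × Fin n)).filter (fun p => p.1 < p.2)).erase (l, l'),
    f (x p.1) (x p.2), ?_, ?_⟩
  · rw [pairProd, prod_pairs_eq (fun i j => f (x i) (x j)), ← Finset.mul_prod_erase _ _ hmem]
  · rw [pairProd, prod_pairs_eq (fun i j => f ((x ∘ Equiv.swap l l') i) ((x ∘ Equiv.swap l l') j)),
      ← Finset.mul_prod_erase _ _ hmem]
    simp only [Function.comp, Equiv.swap_apply_left, Equiv.swap_apply_right]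
    congr 1
    have key : ∀ p ∈ ((Finset.univ : Finset (Fin n × Fin n)).filter
        (fun p => p.1 < p.2)).erase (l, l'), (Equiv.swap l l' p.1, Equiv.swap l l' p.2) ∈
        ((Finset.univ : Finset (Fin n × Fin n)).filter (fun p => p.1 < p.2)).erase (l, l') := by
      rintro ⟨i, j⟩ hp
      simp only [Finset.mem_erase, ne_eq, Prod.mk.injEq, Finset.mem_filter, Finset.mem_univ,
        true_and] at hp ⊢
      refine ⟨?_, swap_lt_swap h hp.2 hp.1⟩
      rintro ⟨h1, h2⟩
      rw [Equiv.swap_apply_eq_iff, Equiv.swap_apply_left] at h1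
      rw [Equiv.swap_apply_eq_iff, Equiv.swap_apply_right] at h2
      have := hp.2
      rw [h1, h2, Fin.lt_def] at this
      omega
    exact Finset.prod_nbij' (fun p => (Equiv.swap l l' p.1, Equiv.swap l l' p.2))
      (fun p => (Equiv.swap l l' p.1, Equiv.swap l l' p.2)) key key (by simp) (by simp) (by simp)

theorem pref_swap (q : ℂ) {N : ℕ} (z : Fin N → ℂ) {p p' : Fin N} (h : (p : ℕ) + 1 = p') :
    ∃ c, pref q z = br (q * z p' / z p) * c ∧
      pref q (z ∘ Equiv.swap p p') = br (q * z p / z p') * c := by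
  obtain ⟨c, h1, h2⟩ := pairProd_swap (fun u v => br (q * v / u) * br (q ^ 2 * u * v)) z h
  exact ⟨br (q ^ 2 * z p * z p') * c, by rw [pref, h1]; ring, by
    rw [pref, h2, mul_right_comm (q ^ 2)]; ring⟩

theorem den_comp (q : ℂ) {N : ℕ} (z : Fin N → ℂ) (π : Equiv.Perm (Fin N)) (w : ℂ) :
    den q (z ∘ π) w = den q z w :=
  Equiv.prod_comp π (fun j => br (q * z j / w) * br (q ^ 2 * w * z j))

theorem resWeight_comp {N : ℕ} (z : Fin N → ℂ) (π : Equiv.Perm (Fin N)) (k : Fin N) :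
    resWeight (z ∘ π) k = resWeight z (π k) := by
  rw [resWeight, resWeight]
  congr 1
  refine Finset.prod_nbij' π π.symm ?_ ?_ ?_ ?_ ?_
  · simp
  · intro j hj; simpa [Equiv.symm_apply_eq] using hj
  all_goals simp

theorem numAt_swap_of_ne (q : ℂ) {N : ℕ} (z : Fin N → ℂ) {p p' a : Fin N}
    (h : (p : ℕ) + 1 = p') (h1 : a ≠ p) (h2 : a ≠ p') (w : ℂ) :
    numAt q (z ∘ Equiv.swap p p') a w = numAt q z a w := by
  have ha : Equiv.swap p p' a = a := Equiv.swap_apply_of_ne_of_ne h1 h2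
  have key : ∀ i j : Fin N, i < j → (i = a ∨ j = a) → Equiv.swap p p' i < Equiv.swap p p' j := by
    rintro i j hij (rfl | rfl)
    · exact swap_lt_swap h hij fun e => h1 e.1
    · exact swap_lt_swap h hij fun e => h2 e.2
  rw [numAt, numAt]
  congr 1
  · refine Finset.prod_nbij' (Equiv.swap p p') (Equiv.swap p p') ?_ ?_ ?_ ?_ ?_
    · intro j hj; have := key a j (by simpa using hj) (Or.inl rfl); simpa [ha] using this
    · intro j hj; have := key a j (by simpa using hj) (Or.inl rfl); simpa [ha] using this
    all_goals simp
  · refine Finset.prod_nbij' (Equiv.swap p p') (Equiv.swap p p') ?_ ?_ ?_ ?_ ?_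
    · intro j hj; have := key j a (by simpa using hj) (Or.inr rfl); simpa [ha] using this
    · intro j hj; have := key j a (by simpa using hj) (Or.inr rfl); simpa [ha] using this
    all_goals simp

/-- The common factor c comes from the sites outside {p, p'}. What remains is one bracket in each
case, and these four brackets are the ones occurring in the three-term identities below. -/
theorem numAt_swap (q : ℂ) {N : ℕ} (z : Fin N → ℂ) {p p' : Fin N}
    (h : (p : ℕ) + 1 = p') (w : ℂ) :
    ∃ c, numAt q z p w = br (z p' / w) * c ∧ numAt q z p' w = br (q * z p / w) * c ∧
      numAt q (z ∘ Equiv.swap p p') p w = br (z p / w) * c ∧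
      numAt q (z ∘ Equiv.swap p p') p' w = br (q * z p' / w) * c := by
  have e1 : Finset.Ioi p = insert p' (Finset.Ioi p') := by
    ext j; simp only [Finset.mem_Ioi, Finset.mem_insert, Fin.lt_def, Fin.ext_iff]; omega
  have e2 : Finset.Iio p' = insert p (Finset.Iio p) := by
    ext j; simp only [Finset.mem_Iio, Finset.mem_insert, Fin.lt_def, Fin.ext_iff]; omega
  have hπ : ∀ j, j ∈ Finset.Ioi p' ∨ j ∈ Finset.Iio p → (z ∘ Equiv.swap p p') j = z j := by
    intro j hj
    simp only [Finset.mem_Ioi, Finset.mem_Iio, Fin.lt_def] at hj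
    rw [Function.comp_apply, Equiv.swap_apply_of_ne_of_ne]
    · rintro rfl; omega
    · rintro rfl; omega
  have f1 : ∏ j ∈ Finset.Ioi p', br ((z ∘ Equiv.swap p p') j / w) =
      ∏ j ∈ Finset.Ioi p', br (z j / w) :=
    Finset.prod_congr rfl fun j hj => by rw [hπ j (Or.inl hj)]
  have f2 : ∏ j ∈ Finset.Iio p, br (q * (z ∘ Equiv.swap p p') j / w) =
      ∏ j ∈ Finset.Iio p, br (q * z j / w) :=
    Finset.prod_congr rfl fun j hj => by rw [hπ j (Or.inr hj)]
  refine ⟨(∏ j ∈ Finset.Ioi p', br (z j / w)) * ∏ j ∈ Finset.Iio p, br (q * z j / w),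
    ?_, ?_, ?_, ?_⟩
  · rw [numAt, e1, Finset.prod_insert (by simp)]; ring
  · rw [numAt, e2, Finset.prod_insert (by simp)]; ring
  · rw [numAt, e1, Finset.prod_insert (by simp), f1, f2]
    simp only [Function.comp, Equiv.swap_apply_right]; ring
  · rw [numAt, e2, Finset.prod_insert (by simp), f1, f2]
    simp only [Function.comp, Equiv.swap_apply_left]; ring

/-- The weight `siteWeight` at the same residue, after an exchange of `z_p` and `z_{p'}`. -/
theorem siteWeight_comp (q : ℂ) {N : ℕ} (z : Fin N → ℂ) (π : Equiv.Perm (Fin N)) (a k : Fin N) :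
    siteWeight q (z ∘ π) a (π.symm k) =
      numAt q (z ∘ π) a (z k) / den q z (z k) * resWeight z k := by
  rw [siteWeight, den_comp, resWeight_comp]
  simp

theorem phi_comp (q : ℂ) (B : ℂ → ℂ) {N n : ℕ} (a : Fin n → Fin N) (z : Fin N → ℂ)
    (π : Equiv.Perm (Fin N)) :
    phi q B a (z ∘ π) = br q ^ n * pref q (z ∘ π) * ∑ κ : Fin n → Fin N,
      num q B (z ∘ κ) * ∏ l, siteWeight q (z ∘ π) (a l) (π.symm (κ l)) := by
  rw [phi, ← Equiv.sum_comp (Equiv.arrowCongr (Equiv.refl (Fin n)) π.symm)]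
  congr 1
  refine Finset.sum_congr rfl fun κ _ => ?_
  congr 2
  funext l
  simp

/-- Three-term identity behind the exchange relation when the marked site is the left one of the
pair; the next identity treats the right one. -/
theorem br_exchange_left {x y w q : ℂ} (hx : x ≠ 0) (hy : y ≠ 0) (hw : w ≠ 0) (hq : q ≠ 0) :
    br (q * (x / y)) * br (x / w) = br q * br (y / w) + br (x / y) * br (q * x / w) := by
  simp only [br]; field_simp; ring

theorem br_exchange_right {x y w q : ℂ} (hx : x ≠ 0) (hy : y ≠ 0) (hw : w ≠ 0) (hq : q ≠ 0) :
    br (q * (x / y)) * br (q * y / w) = br q * br (q * x / w) + br (x / y) * br (y / w) := by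
  simp only [br]; field_simp; ring

/-- Each side is an antisymmetrisation in v, w, and the assertion is its symmetry in x, y. For two
marked neighbours the remaining integrand supplies the antisymmetric factor [v/w]. -/
theorem br_exchange_both {x y v w q : ℂ} (hx : x ≠ 0) (hy : y ≠ 0) (hv : v ≠ 0) (hw : w ≠ 0)
    (hq : q ≠ 0) :
    br (q * w / v) * br (y / v) * br (q * x / w) - br (q * v / w) * br (y / w) * br (q * x / v) =
    br (q * w / v) * br (x / v) * br (q * y / w) - br (q * v / w) * br (x / w) * br (q * y / v) := by
  simp only [br]; field_simp; ring

/-- True for each κ separately: once κ is relabelled by the exchange, the numerator is unchanged and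
only the weight of the marked spin l differs. The ratio of the two prefactors provides [q z_p/z_p']
and [q z_p'/z_p]. -/
theorem phi_exchange_mixed {q : ℂ} (hq : q ≠ 0) (B : ℂ → ℂ) {N n : ℕ} (a : Fin n → Fin N)
    {z : Fin N → ℂ} (hz : ∀ j, z j ≠ 0) {p p' : Fin N} (h : (p : ℕ) + 1 = p') {l : Fin n}
    (hl : a l = p ∨ a l = p') (hm : ∀ m, m ≠ l → a m ≠ p ∧ a m ≠ p') :
    br (q / (z p / z p')) * phi q B a (z ∘ Equiv.swap p p') =
      br q * phi q B a z + br (z p / z p') * phi q B (Equiv.swap p p' ∘ a) z := by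
  obtain ⟨C, hC, hC'⟩ := pref_swap q z h
  have e : br (q / (z p / z p')) = br (q * z p' / z p) := by rw [div_div_eq_mul_div]
  have key : ∀ κ : Fin n → Fin N, br (q * (z p / z p')) *
      (num q B (z ∘ κ) * ∏ l, siteWeight q (z ∘ Equiv.swap p p') (a l)
        ((Equiv.swap p p').symm (κ l))) =
      br q * (num q B (z ∘ κ) * ∏ l, siteWeight q z (a l) (κ l)) +
      br (z p / z p') * (num q B (z ∘ κ) * ∏ l, siteWeight q z ((Equiv.swap p p' ∘ a) l) (κ l)) := by
    intro κ
    obtain ⟨c, h1, h2, h3, h4⟩ := numAt_swap q z h (z (κ l))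
    have o1 : ∏ m ∈ Finset.univ.erase l, siteWeight q (z ∘ Equiv.swap p p') (a m)
        ((Equiv.swap p p').symm (κ m)) = ∏ m ∈ Finset.univ.erase l, siteWeight q z (a m) (κ m) := by
      refine Finset.prod_congr rfl fun m hmem => ?_
      have := hm m (Finset.ne_of_mem_erase hmem)
      rw [siteWeight_comp, numAt_swap_of_ne q z h this.1 this.2, siteWeight]
    have o2 : ∏ m ∈ Finset.univ.erase l, siteWeight q z ((Equiv.swap p p' ∘ a) m) (κ m) =
        ∏ m ∈ Finset.univ.erase l, siteWeight q z (a m) (κ m) := by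
      refine Finset.prod_congr rfl fun m hmem => ?_
      have := hm m (Finset.ne_of_mem_erase hmem)
      rw [Function.comp_apply, Equiv.swap_apply_of_ne_of_ne this.1 this.2]
    rw [← Finset.mul_prod_erase _ _ (Finset.mem_univ l), o1,
      ← Finset.mul_prod_erase _ (fun m => siteWeight q z (a m) (κ m)) (Finset.mem_univ l),
      ← Finset.mul_prod_erase _ (fun m => siteWeight q z ((Equiv.swap p p' ∘ a) m) (κ m))
        (Finset.mem_univ l), o2, siteWeight_comp]
    generalize ∏ m ∈ Finset.univ.erase l, siteWeight q z (a m) (κ m) = X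
    simp only [siteWeight, Function.comp_apply]
    rcases hl with hl | hl
    · rw [hl, Equiv.swap_apply_left, h1, h2, h3]
      linear_combination (num q B (z ∘ κ) * (c / den q z (z (κ l)) * resWeight z (κ l)) * X) *
        br_exchange_left (hz p) (hz p') (hz (κ l)) hq
    · rw [hl, Equiv.swap_apply_right, h1, h2, h4]
      linear_combination (num q B (z ∘ κ) * (c / den q z (z (κ l)) * resWeight z (κ l)) * X) *
        br_exchange_right (hz p) (hz p') (hz (κ l)) hq
  rw [phi_comp, phi, phi, hC, hC', e, mul_div_assoc q (z p)]
  have hsum := Finset.sum_congr (rfl : (Finset.univ : Finset (Fin n → Fin N)) = _)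
    fun κ _ => key κ
  rw [Finset.sum_add_distrib, ← Finset.mul_sum, ← Finset.mul_sum, ← Finset.mul_sum] at hsum
  linear_combination (br (q * z p' / z p) * br q ^ n * C) * hsum

theorem phi_exchange_none {q : ℂ} (B : ℂ → ℂ) {N n : ℕ} (a : Fin n → Fin N)
    {z : Fin N → ℂ} {p p' : Fin N} (h : (p : ℕ) + 1 = p')
    (hm : ∀ m, a m ≠ p ∧ a m ≠ p') :
    br (q / (z p / z p')) * phi q B a (z ∘ Equiv.swap p p') =
      br (q * (z p / z p')) * phi q B a z := by
  obtain ⟨C, hC, hC'⟩ := pref_swap q z h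
  have e : br (q / (z p / z p')) = br (q * z p' / z p) := by rw [div_div_eq_mul_div]
  have key : ∀ κ : Fin n → Fin N, ∏ l, siteWeight q (z ∘ Equiv.swap p p') (a l)
        ((Equiv.swap p p').symm (κ l)) = ∏ l, siteWeight q z (a l) (κ l) := by
    intro κ
    refine Finset.prod_congr rfl fun m _ => ?_
    rw [siteWeight_comp, numAt_swap_of_ne q z h (hm m).1 (hm m).2, siteWeight]
  rw [phi_comp, phi, hC, hC', e, mul_div_assoc q (z p)]
  simp only [key]
  ring

/-- Here the terms for a single κ do not match. Only the sum of the terms of κ and κ ∘ (l l') is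
preserved, by `br_exchange_both`; this suffices because summing over all κ counts each such pair
symmetrically. -/
theorem phi_exchange_both {q : ℂ} (hq : q ≠ 0) (B : ℂ → ℂ) {N n : ℕ} (a : Fin n → Fin N)
    {z : Fin N → ℂ} (hz : ∀ j, z j ≠ 0) {p p' : Fin N} (h : (p : ℕ) + 1 = p') {l l' : Fin n}
    (hll' : (l : ℕ) + 1 = l') (hl : a l = p) (hl' : a l' = p')
    (hm : ∀ m, m ≠ l → m ≠ l' → a m ≠ p ∧ a m ≠ p') :
    br (q / (z p / z p')) * phi q B a (z ∘ Equiv.swap p p') =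
      br (q * (z p / z p')) * phi q B a z := by
  obtain ⟨C, hC, hC'⟩ := pref_swap q z h
  have e : br (q / (z p / z p')) = br (q * z p' / z p) := by rw [div_div_eq_mul_div]
  have hne : l' ≠ l := by rintro rfl; omega
  have split : ∀ f : Fin n → ℂ, ∏ m, f m = f l * (f l' *
      ∏ m ∈ (Finset.univ.erase l).erase l', f m) := by
    intro f
    rw [Finset.mul_prod_erase _ _ (Finset.mem_erase.2 ⟨hne, Finset.mem_univ _⟩),
      Finset.mul_prod_erase _ _ (Finset.mem_univ l)]
  set W' : (Fin n → Fin N) → ℂ := fun κ => num q B (z ∘ κ) *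
    ∏ l, siteWeight q (z ∘ Equiv.swap p p') (a l) ((Equiv.swap p p').symm (κ l)) with hW'
  set W : (Fin n → Fin N) → ℂ := fun κ => num q B (z ∘ κ) *
    ∏ l, siteWeight q z (a l) (κ l) with hW
  have symm : ∀ F : (Fin n → Fin N) → ℂ, ∑ κ, F (κ ∘ Equiv.swap l l') = ∑ κ, F κ :=
    fun F => Equiv.sum_comp (Equiv.arrowCongr (Equiv.swap l l') (Equiv.refl (Fin N))) F
  have key : ∀ κ, W' κ + W' (κ ∘ Equiv.swap l l') = W κ + W (κ ∘ Equiv.swap l l') := by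
    intro κ
    obtain ⟨c, h1, h2, h3, h4⟩ := numAt_swap q z h (z (κ l))
    obtain ⟨c', h1', h2', h3', h4'⟩ := numAt_swap q z h (z (κ l'))
    obtain ⟨d, hd, hd'⟩ := pairProd_swap (fun u v => br (q * v / u) * br (u / v) *
      (br (q * u * v) * br (q ^ 2 * u * v))) (z ∘ κ) hll'
    have hB : ∏ m, (br (q ^ 2 * (z ∘ κ ∘ Equiv.swap l l') m * (z ∘ κ ∘ Equiv.swap l l') m) *
        B ((z ∘ κ ∘ Equiv.swap l l') m)) =
        ∏ m, (br (q ^ 2 * (z ∘ κ) m * (z ∘ κ) m) * B ((z ∘ κ) m)) :=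
      Equiv.prod_comp (Equiv.swap l l')
        (fun m => br (q ^ 2 * (z ∘ κ) m * (z ∘ κ) m) * B ((z ∘ κ) m))
    have hx : ∀ m ∈ (Finset.univ.erase l).erase l', (κ ∘ Equiv.swap l l') m = κ m := by
      intro m hm
      rw [Function.comp_apply, Equiv.swap_apply_of_ne_of_ne]
      · exact Finset.ne_of_mem_erase (Finset.mem_of_mem_erase hm)
      · exact Finset.ne_of_mem_erase hm
    have hy : ∀ m ∈ (Finset.univ.erase l).erase l', ∀ k, siteWeight q (z ∘ Equiv.swap p p') (a m)
        ((Equiv.swap p p').symm k) = siteWeight q z (a m) k := by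
      intro m hmem k
      have := hm m (Finset.ne_of_mem_erase (Finset.mem_of_mem_erase hmem))
        (Finset.ne_of_mem_erase hmem)
      rw [siteWeight_comp, numAt_swap_of_ne q z h this.1 this.2, siteWeight]
    have o1 : ∏ m ∈ (Finset.univ.erase l).erase l', siteWeight q (z ∘ Equiv.swap p p') (a m)
        ((Equiv.swap p p').symm (κ m)) =
        ∏ m ∈ (Finset.univ.erase l).erase l', siteWeight q z (a m) (κ m) :=
      Finset.prod_congr rfl fun m hmem => hy m hmem _
    have o2 : ∏ m ∈ (Finset.univ.erase l).erase l', siteWeight q (z ∘ Equiv.swap p p') (a m)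
        ((Equiv.swap p p').symm ((κ ∘ Equiv.swap l l') m)) =
        ∏ m ∈ (Finset.univ.erase l).erase l', siteWeight q z (a m) (κ m) :=
      Finset.prod_congr rfl fun m hmem => by rw [hy m hmem, hx m hmem]
    have o3 : ∏ m ∈ (Finset.univ.erase l).erase l', siteWeight q z (a m)
        ((κ ∘ Equiv.swap l l') m) =
        ∏ m ∈ (Finset.univ.erase l).erase l', siteWeight q z (a m) (κ m) :=
      Finset.prod_congr rfl fun m hmem => by rw [hx m hmem]
    simp only [hW, hW']
    rw [num, hd, num, hB, ← Function.comp_assoc, hd']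
    generalize ∏ m, (br (q ^ 2 * (z ∘ κ) m * (z ∘ κ) m) * B ((z ∘ κ) m)) = Y
    rw [split, split, split, split, o1, o2, o3]
    generalize ∏ m ∈ (Finset.univ.erase l).erase l', siteWeight q z (a m) (κ m) = X
    simp only [siteWeight_comp]
    simp only [siteWeight, Function.comp_apply, Equiv.swap_apply_left,
      Equiv.swap_apply_right, hl, hl', h1, h2, h3, h4, h1', h2', h3', h4']
    rw [br_swap (z (κ l')) (z (κ l)), mul_right_comm q (z (κ l')),
      mul_right_comm (q ^ 2) (z (κ l'))]
    linear_combination (-br (z (κ l') / z (κ l))) *  (br (q * z (κ l) * z (κ l')) *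
      br (q ^ 2 * z (κ l) * z (κ l'))) * d *
      Y * (c / den q z (z (κ l)) * resWeight z (κ l)) *
      (c' / den q z (z (κ l')) * resWeight z (κ l')) * X *
      br_exchange_both (hz p') (hz p) (hz (κ l)) (hz (κ l')) hq
  -- Summing the paired identity over κ gives twice the required one.
  have hsum : ∑ κ, W' κ = ∑ κ, W κ := by
    have := Finset.sum_congr (rfl : (Finset.univ : Finset (Fin n → Fin N)) = _)
      fun κ _ => key κ
    rw [Finset.sum_add_distrib, Finset.sum_add_distrib, symm, symm] at this
    linear_combination (1 / 2) * this
  rw [phi_comp, phi, hC, hC', e, mul_div_assoc q (z p), hsum]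
  ring

/-! ### Vectors and configurations -/

/-- The sites where the configuration takes the value `v`. -/
def marks (v : Fin 2) {N : ℕ} (σ : Config N) : Finset (Fin N) := Finset.univ.filter (σ · = v)

theorem mem_marks {v : Fin 2} {N : ℕ} {σ : Config N} {k : Fin N} : k ∈ marks v σ ↔ σ k = v := by
  simp [marks]

theorem fin_two_eq_iff (a b v : Fin 2) : a = b ↔ (a = v ↔ b = v) := by
  revert a b v; decide

theorem card_marks_comp (v : Fin 2) {N : ℕ} (σ : Config N) (π : Equiv.Perm (Fin N)) :
    (marks v (σ ∘ π)).card = (marks v σ).card := by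
  refine Finset.card_bij' (fun k _ => π k) (fun k _ => π.symm k) ?_ ?_ ?_ ?_
  all_goals simp [mem_marks]

theorem card_marks_zero_add {N : ℕ} (σ : Config N) :
    (marks 0 σ).card + (marks 1 σ).card = N := by
  have : marks 1 σ = (marks 0 σ)ᶜ := by
    ext k
    rw [Finset.mem_compl, mem_marks, mem_marks]
    generalize σ k = s
    revert s; decide
  rw [this, Finset.card_add_card_compl, Fintype.card_fin]

/-- The vector whose components are given by `phi`, the sites being the ones of value `v`. -/
def phiVec (q : ℂ) (B : ℂ → ℂ) (v : Fin 2) (n : ℕ) {N : ℕ} (z : Fin N → ℂ) : VN N := fun σ =>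
  if h : (marks v σ).card = n then phi q B ((marks v σ).orderEmbOfFin h) z else 0

theorem phiVec_of_strictMono (q : ℂ) (B : ℂ → ℂ) (v : Fin 2) {n N : ℕ} (z : Fin N → ℂ)
    {σ : Config N} (h : (marks v σ).card = n) {a : Fin n → Fin N} (ha : StrictMono a)
    (hσ : ∀ l, σ (a l) = v) : phiVec q B v n z σ = phi q B a z := by
  rw [phiVec, dif_pos h, ← Finset.orderEmbOfFin_unique h (fun l => mem_marks.2 (hσ l)) ha]

theorem sum_ket_apply (v : Fin 2) {n N : ℕ} (mk : (Fin n ↪o Fin N) → Config N)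
    (hmk : ∀ a k, mk a k = v ↔ k ∈ Set.range a) (c : (Fin n ↪o Fin N) → ℂ) (σ : Config N) :
    (∑ a, c a • ket (mk a)) σ =
      if h : (marks v σ).card = n then c ((marks v σ).orderEmbOfFin h) else 0 := by
  have hiff : ∀ a, σ = mk a ↔ (marks v σ : Set (Fin N)) = Set.range a := by
    intro a
    rw [funext_iff, Set.ext_iff]
    refine forall_congr' fun k => ?_
    rw [fin_two_eq_iff _ _ v, hmk, Finset.mem_coe, mem_marks]
  rw [Finset.sum_apply]
  split_ifs with h
  · rw [Finset.sum_eq_single ((marks v σ).orderEmbOfFin h)]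
    · have := (hiff ((marks v σ).orderEmbOfFin h)).2 (Finset.range_orderEmbOfFin _ h).symm
      rw [Pi.smul_apply, ket, ← this, Pi.single_eq_same, smul_eq_mul, mul_one]
    · intro a _ ha
      rw [Pi.smul_apply, ket, Pi.single_eq_of_ne, smul_zero]
      intro e
      refine ha (Finset.orderEmbOfFin_unique' h fun l => ?_)
      have := (hiff a).1 e
      rw [← Finset.mem_coe, this]
      exact Set.mem_range_self l
    · simp
  · refine Finset.sum_eq_zero fun a _ => ?_
    rw [Pi.smul_apply, ket, Pi.single_eq_of_ne, smul_zero]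
    intro e
    refine h ?_
    have := (hiff a).1 e
    rw [← Set.ncard_coe_finset, this, Set.ncard_eq_toFinset_card', Set.toFinset_range,
      Finset.card_image_of_injective _ a.injective, Finset.card_univ, Fintype.card_fin]

theorem psi_eq_phiVec {q β : ℂ} (hq0 : q ≠ 0) (hβ : β ≠ 0) {N : ℕ}
    {ρ : (Fin N → ℂ) → Fin (N / 2) → Fin N → ℝ} (hρ : IsContourChoice (singPsi q) ρ)
    {z : Fin N → ℂ} (hz : Good q z) :
    Psi q β ρ z = phiVec q (fun w => br (β * w)) 1 (N / 2) z := by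
  funext σ
  rw [Psi, sum_ket_apply 1 downAt (by intro a k; simp [downAt]), phiVec]
  split_ifs with h
  · exact psiComp_eq hq0 hβ _ hz (hρ z ((mem_generic_singPsi_iff hq0).2 hz))
  · rfl

theorem psiBar_eq_phiVec {q β c : ℂ} (hq0 : q ≠ 0) (hβ : β ≠ 0) (hc : c ^ 2 * q ^ 3 = -1) {N : ℕ}
    {ρ : (Fin N → ℂ) → Fin ((N + 1) / 2) → Fin N → ℝ} (hρ : IsContourChoice (singPsiBar q β) ρ)
    {z : Fin N → ℂ} (hz : z ∈ generic (singPsiBar q β)) (σ : Config N) :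
    PsiBar q β ρ z σ = (∏ i, br (β * z i)) *
      phiVec q (dualB β c) 0 ((N + 1) / 2) (dual c z) (σ ∘ Fin.rev) := by
  rw [PsiBar, sum_ket_apply 0 upAt (by intro a k; simp [upAt])]
  have hcard := card_marks_comp 0 σ Fin.revPerm
  split_ifs with h
  · rw [psiBarComp_eq hq0 hβ hc _ hz (hρ z hz), phiVec_of_strictMono]
    · exact hcard.trans h
    · intro i j hij
      exact Fin.rev_lt_rev.2 ((OrderEmbedding.strictMono _) (Fin.rev_lt_rev.2 hij))
    · intro l
      have := Finset.orderEmbOfFin_mem (marks 0 σ) h l.rev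
      simpa only [Function.comp_apply, Fin.rev_rev] using mem_marks.1 this
  · rw [phiVec, dif_neg, mul_zero]
    exact fun e => h (hcard.symm.trans e)

/-- The exchange relations, for one pair of neighbouring sites, in components. -/
def CompExchange (q : ℂ) {N : ℕ} (Φ : (Fin N → ℂ) → VN N) (z : Fin N → ℂ) (p p' : Fin N) : Prop :=
  ∀ σ : Config N,
    (σ p = σ p' → br (q / (z p / z p')) * Φ (z ∘ Equiv.swap p p') σ =
      br (q * (z p / z p')) * Φ z σ) ∧
    (σ p ≠ σ p' → br (q / (z p / z p')) * Φ (z ∘ Equiv.swap p p') σ =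
      br q * Φ z σ + br (z p / z p') * Φ z (σ ∘ Equiv.swap p p'))

/-- The marked value v is arbitrary because the weights of the six-vertex model do not change when
all spins are flipped; v = 1 serves Ψ_N and v = 0 serves Ψ̄_N. -/
theorem phiVec_exchange {q : ℂ} (hq0 : q ≠ 0) (B : ℂ → ℂ) (v : Fin 2) (n : ℕ) {N : ℕ}
    {z : Fin N → ℂ} (hz : ∀ j, z j ≠ 0) {p p' : Fin N} (h : (p : ℕ) + 1 = p') :
    CompExchange q (phiVec q B v n) z p p' := by
  intro σ
  have hpp' : p ≠ p' := by rintro rfl; omega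
  have hcard := card_marks_comp v σ (Equiv.swap p p')
  by_cases hn : (marks v σ).card = n
  swap
  · have hn' : (marks v (σ ∘ Equiv.swap p p')).card ≠ n := hcard ▸ hn
    simp [phiVec, hn, hn']
  set a := (marks v σ).orderEmbOfFin hn with ha
  have hav : ∀ l, σ (a l) = v := fun l => mem_marks.1 (Finset.orderEmbOfFin_mem _ hn l)
  have hex : ∀ k, σ k = v → ∃ l, a l = k := by
    intro k hk
    have : k ∈ Set.range a := by
      rw [ha, Finset.range_orderEmbOfFin]; exact mem_marks.2 hk
    exact this
  have e : ∀ z : Fin N → ℂ, phiVec q B v n z σ = phi q B a z := fun z => by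
    rw [phiVec, dif_pos hn]
  rw [e, e]
  constructor
  · intro hσ
    by_cases hv : σ p = v
    · obtain ⟨l, hl⟩ := hex p hv
      obtain ⟨l', hl'⟩ := hex p' (hσ ▸ hv)
      have hlt : l < l' := by
        rw [← a.lt_iff_lt, hl, hl', Fin.lt_def]; omega
      -- Marked neighbours carry consecutive indices: an index strictly between would give a marked
      -- site strictly between p and p'.
      have hll' : (l : ℕ) + 1 = l' := by
        by_contra hne
        have hlt' : (l : ℕ) + 1 < l' := by rw [Fin.lt_def] at hlt; omega
        have h1 : a l < a ⟨l + 1, by omega⟩ := a.lt_iff_lt.2 (by rw [Fin.lt_def]; simp)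
        have h2 : a ⟨l + 1, by omega⟩ < a l' := a.lt_iff_lt.2 (by rw [Fin.lt_def]; simpa using hlt')
        rw [hl, Fin.lt_def] at h1
        rw [hl', Fin.lt_def] at h2
        omega
      refine phi_exchange_both hq0 B a hz h hll' hl hl' fun m h1 h2 => ⟨?_, ?_⟩
      · rw [← hl]; exact fun e => h1 (a.injective e)
      · rw [← hl']; exact fun e => h2 (a.injective e)
    · refine phi_exchange_none B a h fun m => ⟨?_, ?_⟩
      · intro e; exact hv (e ▸ hav m)
      · intro e; exact hv (hσ.trans (e ▸ hav m))
  · intro hσ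
    have e' : phiVec q B v n z (σ ∘ Equiv.swap p p') = phi q B (Equiv.swap p p' ∘ a) z := by
      refine phiVec_of_strictMono q B v z (hcard.trans hn) ?_ ?_
      · intro i j hij
        refine swap_lt_swap h (a.strictMono hij) ?_
        rintro ⟨e1, e2⟩
        exact hσ (by rw [← e1, ← e2, hav, hav])
      · intro l; simp [hav]
    rw [e']
    by_cases hv : σ p = v
    · obtain ⟨l, hl⟩ := hex p hv
      refine phi_exchange_mixed hq0 B a hz h (Or.inl hl) fun m hm => ⟨?_, ?_⟩
      · rw [← hl]; exact fun e => hm (a.injective e)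
      · intro e; exact hσ (hv.trans (e ▸ hav m).symm)
    · have hv' : σ p' = v := (by decide : ∀ s t v : Fin 2, s ≠ t → s ≠ v → t = v) _ _ _ hσ hv
      obtain ⟨l, hl⟩ := hex p' hv'
      refine phi_exchange_mixed hq0 B a hz h (Or.inr hl) fun m hm => ⟨?_, ?_⟩
      · intro e; exact hv (e ▸ hav m)
      · rw [← hl]; exact fun e => hm (a.injective e)

theorem Good.comp {q : ℂ} {N : ℕ} {z : Fin N → ℂ} (hz : Good q z) (π : Equiv.Perm (Fin N)) :
    Good q (z ∘ π) :=
  ⟨fun _ => hz.ne _, fun _ _ h => hz.br_ne _ _ (π.injective.ne h), fun _ _ => hz.qbr_ne _ _,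
    fun _ _ => hz.qqbr_ne _ _⟩

theorem generic_singPsiBar_comp {q β : ℂ} {N : ℕ} {z : Fin N → ℂ}
    (hz : z ∈ generic (singPsiBar q β)) (π : Equiv.Perm (Fin N)) :
    z ∘ π ∈ generic (singPsiBar q β) := by
  have : singPsiBar q β (z ∘ π) = singPsiBar q β z := by
    unfold singPsiBar
    congr 1
    exact Equiv.iSup_comp (g := fun j => ({-z j, q⁻¹ * z j, -(q⁻¹ * z j), q⁻¹ * (z j)⁻¹,
      -(q⁻¹ * (z j)⁻¹)} : Set ℂ)) π
  exact ⟨hz.1.comp π.injective, fun j => this ▸ hz.2 _⟩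

theorem exists_dual_constant {q : ℂ} (hq0 : q ≠ 0) : ∃ c : ℂ, c ^ 2 * q ^ 3 = -1 := by
  obtain ⟨c, hc⟩ := IsAlgClosed.exists_pow_nat_eq (-(q ^ 3)⁻¹) (n := 2) (by norm_num)
  exact ⟨c, by rw [hc, neg_mul, inv_mul_cancel₀ (pow_ne_zero 3 hq0)]⟩

/-- The common form of the vector `Ψ̄_N`, as a function of the reflected point. -/
def dualVec (q β c : ℂ) {N : ℕ} (z : Fin N → ℂ) : VN N := fun σ =>
  (∏ i, br (β * z i)) * phiVec q (dualB β c) 0 ((N + 1) / 2) (dual c z) (σ ∘ Fin.rev)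

/-- Reversal sends the pair (p, p') to the adjacent pair (p'.rev, p.rev). As the variables are
inverted as well, the spectral ratio z_p/z_p' is unchanged; the factor ∏ [βz_i] is symmetric. -/
theorem dualVec_exchange {q c : ℂ} (hq0 : q ≠ 0) (β : ℂ) (hc : c ≠ 0) {N : ℕ}
    {z : Fin N → ℂ} (hz : ∀ j, z j ≠ 0) {p p' : Fin N} (h : (p : ℕ) + 1 = p') :
    CompExchange q (dualVec q β c) z p p' := by
  intro σ
  have hr : (p'.rev : ℕ) + 1 = p.rev := by
    rw [Fin.val_rev, Fin.val_rev]; have := p'.isLt; omega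
  have hy : ∀ j, dual c z j ≠ 0 := fun j => div_ne_zero hc (hz _)
  have key := phiVec_exchange hq0 (dualB β c) 0 ((N + 1) / 2) hy hr (σ ∘ Fin.rev)
  have hu : dual c z p'.rev / dual c z p.rev = z p / z p' := by
    have := hz p; have := hz p'
    simp only [dual, Fin.rev_rev]; field_simp
  have hrs : ∀ j, Equiv.swap p p' (Fin.rev j) = Fin.rev (Equiv.swap p'.rev p.rev j) := by
    intro j
    have := (Fin.revPerm : Equiv.Perm (Fin N)).injective.swap_apply p'.rev p.rev j
    simp only [Fin.revPerm_apply, Fin.rev_rev] at this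
    rw [Equiv.swap_comm, this]
  have hd : dual c (z ∘ Equiv.swap p p') = dual c z ∘ Equiv.swap p'.rev p.rev := by
    funext j
    simp only [dual, Function.comp, hrs]
  have hσ : (σ ∘ Equiv.swap p p') ∘ Fin.rev = (σ ∘ Fin.rev) ∘ Equiv.swap p'.rev p.rev := by
    funext j
    simp only [Function.comp, hrs]
  have hprod : ∏ i, br (β * (z ∘ Equiv.swap p p') i) = ∏ i, br (β * z i) :=
    Equiv.prod_comp (Equiv.swap p p') (fun i => br (β * z i))
  rw [dualVec, dualVec, dualVec, hprod, hd, hσ]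
  rw [hu] at key
  simp only [Function.comp_apply, Fin.rev_rev] at key
  constructor
  · intro h
    linear_combination (∏ i, br (β * z i)) * key.1 h.symm
  · intro h
    linear_combination (∏ i, br (β * z i)) * key.2 h.symm

theorem psiBar_exchange {q β : ℂ} (hq0 : q ≠ 0) (hβ : β ≠ 0) {N : ℕ}
    {ρ : (Fin N → ℂ) → Fin ((N + 1) / 2) → Fin N → ℝ} (hρ : IsContourChoice (singPsiBar q β) ρ)
    {z : Fin N → ℂ} (hz : z ∈ generic (singPsiBar q β)) {p p' : Fin N} (h : (p : ℕ) + 1 = p') :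
    CompExchange q (PsiBar q β ρ) z p p' := by
  intro σ
  obtain ⟨c, hc⟩ := exists_dual_constant hq0
  have hc0 : c ≠ 0 := by rintro rfl; simp at hc
  rw [psiBar_eq_phiVec hq0 hβ hc hρ hz, psiBar_eq_phiVec hq0 hβ hc hρ hz,
    psiBar_eq_phiVec hq0 hβ hc hρ (generic_singPsiBar_comp hz _)]
  exact dualVec_exchange hq0 β hc0 (fun j => ((good_dual_of_generic hq0 hc hβ hz).2 j).1) h σ

/-! ### The action of the operators in components -/

theorem Rcheck_apply (q u : ℂ) (s t : Fin 2 × Fin 2) : Rcheck q u s t = R q u s.swap t := by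
  rw [Rcheck, Matrix.mul_apply, Finset.sum_eq_single s.swap]
  · simp [P]
  · intro x _ hx
    have : s ≠ x.swap := fun e => hx (by rw [e, Prod.swap_swap])
    simp [P, this]
  · simp

theorem eq_iff_agree {N : ℕ} (i j : Fin N) (σ τ : Config N) :
    σ = τ ↔ (∀ k, k ≠ i → k ≠ j → σ k = τ k) ∧ σ i = τ i ∧ σ j = τ j := by
  constructor
  · rintro rfl; simp
  · rintro ⟨h, hi, hj⟩
    funext k
    by_cases h1 : k = i
    · rw [h1, hi]
    · by_cases h2 : k = j
      · rw [h2, hj]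
      · exact h k h1 h2

theorem leg₂_Rcheck_mulVec_of_eq (q u : ℂ) {N : ℕ} {i j : Fin N} (v : VN N)
    {σ : Config N} (h : σ i = σ j) :
    (leg₂ i j (Rcheck q u) *ᵥ v) σ = br (q * u) / br (q / u) * v σ := by
  rw [Matrix.mulVec, dotProduct, Finset.sum_eq_single σ]
  · simp [leg₂, Rcheck_apply, R, h]
  · intro τ _ hτ
    simp only [leg₂, Matrix.of_apply, Rcheck_apply, R, Prod.swap_prod_mk, Prod.ext_iff,
      Prod.fst_swap, Prod.snd_swap]
    have := (eq_iff_agree i j σ τ).not.1 (Ne.symm hτ)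
    split_ifs with h1 h2 h3 h4 <;> simp_all
  · simp

theorem leg₂_Rcheck_mulVec_of_ne (q u : ℂ) {N : ℕ} {i j : Fin N} (v : VN N)
    {σ : Config N} (h : σ i ≠ σ j) :
    (leg₂ i j (Rcheck q u) *ᵥ v) σ =
      br q / br (q / u) * v σ + br u / br (q / u) * v (σ ∘ Equiv.swap i j) := by
  have hij : i ≠ j := by rintro rfl; exact h rfl
  have hne : σ ∘ Equiv.swap i j ≠ σ := by
    intro e
    have := congrFun e i
    simp only [Function.comp, Equiv.swap_apply_left] at this
    exact h this.symm
  have hag : ∀ k, k ≠ i → k ≠ j → σ k = (σ ∘ Equiv.swap i j) k := by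
    intro k h1 h2
    rw [Function.comp, Equiv.swap_apply_of_ne_of_ne h1 h2]
  rw [Matrix.mulVec, dotProduct, ← Finset.add_sum_erase _ _ (Finset.mem_univ σ),
    Finset.sum_eq_single (σ ∘ Equiv.swap i j)]
  · congr 1
    · simp [leg₂, Rcheck_apply, R, h, h.symm]
    · rw [leg₂, Matrix.of_apply, if_pos hag]
      simp [Rcheck_apply, R, h.symm]
  · intro τ hτ hτ'
    have h1 := (eq_iff_agree i j σ τ).not.1 (Finset.ne_of_mem_erase hτ).symm
    have h2 := (eq_iff_agree i j (σ ∘ Equiv.swap i j) τ).not.1 hτ'.symm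
    rw [leg₂, Matrix.of_apply]
    split_ifs with h3
    · have h4 : ∀ k, k ≠ i → k ≠ j → (σ ∘ Equiv.swap i j) k = τ k :=
        fun k a b => (hag k a b).symm.trans (h3 k a b)
      simp only [Function.comp, Equiv.swap_apply_left, Equiv.swap_apply_right] at h2 h4
      simp only [Rcheck_apply, R, Matrix.of_apply, Prod.swap_prod_mk, Prod.ext_iff,
        Prod.fst_swap, Prod.snd_swap]
      rw [if_neg, if_neg, zero_mul]
      · exact fun e => h1 ⟨h3, e.2, e.1⟩
      · exact fun e => h2 ⟨h4, e.1, e.2⟩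
    · rw [zero_mul]
  · simp [hne]

theorem exchange_of_compExchange {q : ℂ} {N : ℕ} {Φ : (Fin N → ℂ) → VN N} {z : Fin N → ℂ}
    {p p' : Fin N} (h : CompExchange q Φ z p p') (hne : br (q / (z p / z p')) ≠ 0) :
    leg₂ p p' (Rcheck q (z p / z p')) *ᵥ Φ z = Φ (z ∘ Equiv.swap p p') := by
  funext σ
  by_cases hσ : σ p = σ p'
  · rw [leg₂_Rcheck_mulVec_of_eq q _ _ hσ, div_mul_eq_mul_div, div_eq_iff hne, ← (h σ).1 hσ,
      mul_comm]
  · rw [leg₂_Rcheck_mulVec_of_ne q _ _ hσ, div_mul_eq_mul_div, div_mul_eq_mul_div, ← add_div,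
      div_eq_iff hne, ← (h σ).2 hσ, mul_comm]

theorem leg₁_K_mulVec (u β : ℂ) {N : ℕ} (i : Fin N) (v : VN N) (σ : Config N) :
    (leg₁ i (K u β) *ᵥ v) σ = (if σ i = 0 then 1 else br (β * u) / br (β / u)) * v σ := by
  rw [Matrix.mulVec, dotProduct, Finset.sum_eq_single σ]
  · rw [leg₁, Matrix.of_apply, if_pos (fun _ _ => rfl), K, Matrix.diagonal_apply_eq]
    generalize σ i = s
    congr 1
    fin_cases s <;> simp
  · intro τ _ hτ
    rw [leg₁, Matrix.of_apply]
    split_ifs with h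
    · rw [K, Matrix.diagonal_apply_ne, zero_mul]
      intro e
      refine hτ (funext fun k => ?_)
      by_cases hk : k = i
      · rw [hk, e]
      · exact (h k hk).symm
    · rw [zero_mul]
  · simp

/-! ### Propagation of identities along the exchange relations -/

/-- Induction on the distance through (i j) = (m j)(i m)(m j) with m = j - 1. If the two spins
agree, the exchange does nothing, so `hC` is only needed for unequal spins. -/
theorem comp_swap_mem_of_adjacent {N : ℕ} {C : Set (Config N)} {lo hi : ℕ}
    (hC : ∀ σ ∈ C, ∀ p p' : Fin N, (p : ℕ) + 1 = p' → lo ≤ p → (p' : ℕ) ≤ hi → σ p ≠ σ p' →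
      σ ∘ Equiv.swap p p' ∈ C) (d : ℕ) : ∀ {i j : Fin N}, (i : ℕ) + d + 1 = j → lo ≤ i →
      (j : ℕ) ≤ hi → ∀ σ ∈ C, σ ∘ Equiv.swap i j ∈ C := by
  have hC' : ∀ σ ∈ C, ∀ p p' : Fin N, (p : ℕ) + 1 = p' → lo ≤ p → (p' : ℕ) ≤ hi →
      σ ∘ Equiv.swap p p' ∈ C := by
    intro σ hσ p p' h1 h2 h3
    by_cases h : σ p = σ p'
    · have : σ ∘ Equiv.swap p p' = σ := by
        funext k
        rw [Function.comp, Equiv.swap_apply_def]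
        split_ifs with e1 e2
        · rw [e1, h]
        · rw [e2, h]
        · rfl
      rwa [this]
    · exact hC σ hσ p p' h1 h2 h3 h
  induction d with
  | zero => exact fun h1 h2 h3 σ hσ => hC' σ hσ _ _ h1 h2 h3
  | succ d ih =>
    intro i j h1 h2 h3 σ hσ
    let m : Fin N := ⟨i + d + 1, by have := j.isLt; omega⟩
    have hm : (m : ℕ) + 1 = j := by simp only [m]; omega
    have him : i ≠ m := by intro e; have := congrArg Fin.val e; simp only [m] at this; omega
    have hij : i ≠ j := by rintro rfl; omega
    have hmj : m ≠ j := by intro e; rw [e] at hm; omega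
    have e : Equiv.swap i j = Equiv.swap m j * Equiv.swap i m * Equiv.swap m j := by
      rw [Equiv.swap_mul_swap_mul_swap him hij, Equiv.swap_comm]
    rw [e, Equiv.Perm.coe_mul, Equiv.Perm.coe_mul, ← Function.comp_assoc, ← Function.comp_assoc]
    exact hC' _ (ih rfl h2 (by simp only [m]; omega) _
      (hC' _ hσ _ _ hm (by simp only [m]; omega) h3)) _ _ hm (by simp only [m]; omega) h3

/-- Induction on the number of sites that are down in σ but up in τ. Equality of the numbers of down
spins provides a site of the opposite kind, and both sites lie in the window [lo, hi] because σ and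
τ agree outside it. -/
theorem mem_of_adjacent {N : ℕ} {C : Set (Config N)} {lo hi : ℕ}
    (hC : ∀ σ ∈ C, ∀ p p' : Fin N, (p : ℕ) + 1 = p' → lo ≤ p → (p' : ℕ) ≤ hi → σ p ≠ σ p' →
      σ ∘ Equiv.swap p p' ∈ C) {τ : Config N} (d : ℕ) : ∀ σ ∈ C,
      (marks 1 σ \ marks 1 τ).card = d → (marks 1 σ).card = (marks 1 τ).card →
      (∀ k : Fin N, (k : ℕ) < lo ∨ hi < (k : ℕ) → σ k = τ k) → τ ∈ C := by
  have hswap : ∀ σ ∈ C, ∀ i j : Fin N, i ≠ j → lo ≤ (i : ℕ) → (i : ℕ) ≤ hi → lo ≤ (j : ℕ) →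
      (j : ℕ) ≤ hi → σ ∘ Equiv.swap i j ∈ C := by
    intro σ hσ i j hij h1 h2 h3 h4
    rcases lt_or_gt_of_ne hij with h | h
    · exact comp_swap_mem_of_adjacent hC (j - i - 1) (by rw [Fin.lt_def] at h; omega) h1 h4 σ hσ
    · rw [Equiv.swap_comm]
      exact comp_swap_mem_of_adjacent hC (i - j - 1) (by rw [Fin.lt_def] at h; omega)
        h3 h2 σ hσ
  induction d with
  | zero =>
    intro σ hσ h0 hcard _
    rw [Finset.card_eq_zero, Finset.sdiff_eq_empty_iff_subset] at h0
    have := Finset.eq_of_subset_of_card_le h0 hcard.ge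
    have e : σ = τ := by
      funext k
      rw [fin_two_eq_iff _ _ 1, ← mem_marks, ← mem_marks, this]
    exact e ▸ hσ
  | succ d ih =>
    intro σ hσ hd hcard hag
    obtain ⟨k, hk⟩ : (marks 1 σ \ marks 1 τ).Nonempty := Finset.card_pos.1 (by omega)
    obtain ⟨l, hl⟩ : (marks 1 τ \ marks 1 σ).Nonempty :=
      Finset.card_pos.1 (by rw [← Finset.card_sdiff_comm hcard]; omega)
    simp only [Finset.mem_sdiff, mem_marks] at hk hl
    have hkl : k ≠ l := by rintro rfl; exact hk.2 hl.1
    have hrange : ∀ m : Fin N, σ m ≠ τ m → lo ≤ (m : ℕ) ∧ (m : ℕ) ≤ hi := by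
      intro m hm
      by_contra h
      exact hm (hag m (by omega))
    have hk' := hrange k (by rw [hk.1]; exact fun e => hk.2 e.symm)
    have hl' := hrange l (by rw [hl.1]; exact hl.2)
    refine ih (σ ∘ Equiv.swap k l) (hswap σ hσ k l hkl hk'.1 hk'.2 hl'.1 hl'.2) ?_
      ((card_marks_comp 1 σ _).trans hcard) ?_
    · have : marks 1 (σ ∘ Equiv.swap k l) \ marks 1 τ = (marks 1 σ \ marks 1 τ).erase k := by
        ext m
        simp only [Finset.mem_sdiff, Finset.mem_erase, mem_marks, Function.comp]
        by_cases hmk : m = k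
        · subst hmk; simp [hl.2]
        · by_cases hml : m = l
          · subst hml; simp [hl.1]
          · rw [Equiv.swap_apply_of_ne_of_ne hmk hml]; simp [hmk]
      rw [this, Finset.card_erase_of_mem (by simp [mem_marks, hk]), hd, Nat.add_sub_cancel]
    · intro m hm
      rw [Function.comp, Equiv.swap_apply_of_ne_of_ne]
      · exact hag m hm
      · rintro rfl; omega
      · rintro rfl; omega

/-- For σ_p ≠ σ_p' the relation reads [u] D(z)_{σ∘s} = [q/u] D(z∘s)_σ - [q] D(z)_σ with u = z_p/z_p'
and s the transposition. Vanishing of the component σ on all of Z therefore passes to σ∘s. The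
exchanged point is needed too, hence the stability of Z. -/
theorem eq_zero_of_exchange {q : ℂ} {N : ℕ} {Z : Set (Fin N → ℂ)}
    {D : (Fin N → ℂ) → VN N} {lo hi : ℕ}
    (hZ : ∀ z ∈ Z, ∀ p p' : Fin N, (p : ℕ) + 1 = p' → lo ≤ p → (p' : ℕ) ≤ hi →
      z ∘ Equiv.swap p p' ∈ Z ∧ br (z p / z p') ≠ 0 ∧ CompExchange q D z p p')
    {σ τ : Config N} (hcard : (marks 1 σ).card = (marks 1 τ).card)
    (hag : ∀ k : Fin N, (k : ℕ) < lo ∨ hi < (k : ℕ) → σ k = τ k)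
    (h0 : ∀ z ∈ Z, D z σ = 0) : ∀ z ∈ Z, D z τ = 0 := by
  refine mem_of_adjacent (C := {σ | ∀ z ∈ Z, D z σ = 0}) ?_ _ σ h0 rfl hcard hag
  intro σ hσ p p' h1 h2 h3 hne z hz
  obtain ⟨hz', hbr, hex⟩ := hZ z hz p p' h1 h2 h3
  have := (hex σ).2 hne
  rw [hσ z hz, hσ _ hz', mul_zero, mul_zero, zero_add] at this
  exact (mul_eq_zero.1 this.symm).resolve_left hbr

/-! ### Extremal components -/

theorem pairProd_cons {n : ℕ} (f : ℂ → ℂ → ℂ) (w : ℂ) (x : Fin n → ℂ) :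
    pairProd f (Fin.cons w x : Fin (n + 1) → ℂ) = (∏ l, f w (x l)) * pairProd f x := by
  simp [pairProd, Fin.prod_univ_succ, Fin.prod_Ioi_succ]

theorem pairProd_snoc {n : ℕ} (f : ℂ → ℂ → ℂ) (x : Fin n → ℂ) (w : ℂ) :
    pairProd f (Fin.snoc x w : Fin (n + 1) → ℂ) = pairProd f x * ∏ l, f (x l) w := by
  have e : (Fin.snoc x w : Fin (n + 1) → ℂ) = (Fin.cons w (x ∘ Fin.rev) : Fin (n + 1) → ℂ) ∘ Fin.rev := by
    funext i
    refine Fin.lastCases ?_ (fun j => ?_) i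
    · simp
    · simp [Fin.rev_castSucc]
  rw [e, pairProd_rev, pairProd_cons, pairProd_rev, mul_comm]
  congr 1
  exact Equiv.prod_comp Fin.revPerm (fun l => f (x l) w)

theorem num_snoc (q : ℂ) (B : ℂ → ℂ) {n : ℕ} (x : Fin n → ℂ) (w : ℂ) :
    num q B (Fin.snoc x w : Fin (n + 1) → ℂ) = num q B x *
      ((∏ l, (br (q * w / x l) * br (x l / w) * (br (q * x l * w) * br (q ^ 2 * x l * w)))) *
        (br (q ^ 2 * w * w) * B w)) := by
  rw [num, pairProd_snoc, Fin.prod_univ_castSucc, num]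
  simp only [Fin.snoc_castSucc, Fin.snoc_last]
  ring

theorem br_self {x : ℂ} (hx : x ≠ 0) : br (x / x) = 0 := by
  rw [br_div_eq_zero_iff hx hx]; exact Or.inl rfl

theorem num_eq_zero_of_not_injective (q : ℂ) (B : ℂ → ℂ) {N n : ℕ} {z : Fin N → ℂ}
    (hz : ∀ j, z j ≠ 0) {κ : Fin n → Fin N} (h : ¬Function.Injective κ) : num q B (z ∘ κ) = 0 := by
  obtain ⟨i, j, hij, hne⟩ : ∃ i j, κ i = κ j ∧ i < j := by
    rw [Function.not_injective_iff] at h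
    obtain ⟨i, j, h1, h2⟩ := h
    rcases lt_or_gt_of_ne h2 with h2 | h2
    exacts [⟨i, j, h1, h2⟩, ⟨j, i, h1.symm, h2⟩]
  rw [num, pairProd, Finset.prod_eq_zero (Finset.mem_univ i)
    (Finset.prod_eq_zero (Finset.mem_Ioi.2 hne) (by simp [hij, br_self (hz _)])), zero_mul]

/-- The factor j = k of `numAt` is [z_k/z_k]. This triangularity is what collapses the residue sums
of the extremal components. -/
theorem siteWeight_eq_zero_of_lt (q : ℂ) {N : ℕ} {z : Fin N → ℂ} (hz : ∀ j, z j ≠ 0)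
    {a k : Fin N} (h : a < k) : siteWeight q z a k = 0 := by
  rw [siteWeight, numAt, Finset.prod_eq_zero (Finset.mem_Ioi.2 h) (br_self (hz k))]
  simp

/-- Induction: if the values below l are already taken by the smaller indices, injectivity excludes
κ(l) < l. -/
theorem eq_of_injective_of_le {N n m : ℕ} {κ : Fin n → Fin N} (hκ : Function.Injective κ)
    (hle : ∀ l : Fin n, (l : ℕ) < m → (κ l : ℕ) ≤ l) (l : Fin n) (hl : (l : ℕ) < m) : (κ l : ℕ) = l := by
  obtain ⟨l, hln⟩ := l
  induction l using Nat.strong_induction_on with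
  | _ l ih =>
    rcases (hle _ hl).lt_or_eq with h | h
    · have hlt : (κ ⟨l, hln⟩ : ℕ) < l := h
      have h1 := ih _ hlt (hlt.trans hln) (lt_trans hlt hl)
      have h2 := congrArg Fin.val (hκ (Fin.ext h1))
      simp only at h2
      omega
    · exact h

/-- The component with the marked sites `1, …, m`. -/
def extremal (q : ℂ) (B : ℂ → ℂ) (m : ℕ) {N : ℕ} (z : Fin N → ℂ) : ℂ :=
  (∏ i : Fin N, ∏ j ∈ Finset.Ioi i,
    if (j : ℕ) < m then br (q * z j / z i) * br (q * z i * z j)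
    else if m ≤ (i : ℕ) then br (q * z j / z i) * br (q ^ 2 * z i * z j) else 1) *
  ∏ i : Fin N, if (i : ℕ) < m then B (z i) else 1

theorem prod_castLE {m N : ℕ} (h : m ≤ N) (F : Fin N → ℂ) :
    ∏ l : Fin m, F (Fin.castLE h l) = ∏ i : Fin N, if (i : ℕ) < m then F i else 1 := by
  refine Finset.prod_of_injOn (Fin.castLE h) (Fin.castLE_injective h).injOn (by simp) ?_ ?_
  · intro i _ hi
    rw [if_neg]
    exact fun him => hi ⟨⟨i, him⟩, by simp, rfl⟩
  · intro l _
    rw [if_pos]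
    exact l.isLt

theorem prod_pairs_castLE {m N : ℕ} (h : m ≤ N) (F : Fin N → Fin N → ℂ) :
    ∏ l : Fin m, ∏ l' ∈ Finset.Ioi l, F (Fin.castLE h l) (Fin.castLE h l') =
      ∏ i : Fin N, ∏ j ∈ Finset.Ioi i, if (j : ℕ) < m then F i j else 1 := by
  rw [prod_pairs_eq, prod_pairs_eq]
  refine Finset.prod_of_injOn (fun p => (Fin.castLE h p.1, Fin.castLE h p.2)) ?_ ?_ ?_ ?_
  · intro p _ p' _ hpp
    simp only [Prod.mk.injEq] at hpp
    exact Prod.ext (Fin.castLE_injective h hpp.1) (Fin.castLE_injective h hpp.2)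
  · intro p hp; simpa using hp
  · rintro ⟨i, j⟩ hp hp'
    rw [if_neg]
    intro hj
    simp only [Finset.mem_filter, Finset.mem_univ, true_and] at hp
    have hi : (i : ℕ) < m := lt_trans hp hj
    exact hp' ⟨(⟨i, hi⟩, ⟨j, hj⟩), by simpa using hp, rfl⟩
  · intro p _
    rw [if_pos]
    exact p.2.isLt

theorem prod_Iio_comm {N : ℕ} (F : Fin N → Fin N → ℂ) :
    ∏ i, ∏ j ∈ Finset.Iio i, F i j = ∏ i, ∏ j ∈ Finset.Ioi i, F j i :=
  Finset.prod_comm' (by simp)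

theorem prod_erase_eq {N : ℕ} (i : Fin N) (F : Fin N → ℂ) :
    ∏ j ∈ Finset.univ.erase i, F j = (∏ j ∈ Finset.Ioi i, F j) * ∏ j ∈ Finset.Iio i, F j := by
  rw [← Finset.prod_union]
  · congr 1
    ext j
    simp only [Finset.mem_erase, Finset.mem_univ, and_true, Finset.mem_union, Finset.mem_Ioi,
      Finset.mem_Iio]
    exact ⟨fun h => (lt_or_gt_of_ne h).symm, fun h => h.elim ne_of_gt ne_of_lt⟩
  · rw [Finset.disjoint_left]
    intro j h1 h2
    exact lt_asymm (Finset.mem_Ioi.1 h1) (Finset.mem_Iio.1 h2)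

theorem siteWeight_self {q : ℂ} {N : ℕ} {z : Fin N → ℂ} (hz : Good q z) (i : Fin N) :
    siteWeight q z i i = (br q * br (q ^ 2 * z i * z i))⁻¹ *
      ((∏ j ∈ Finset.Ioi i, (br (q * z j / z i) * br (q ^ 2 * z i * z j))⁻¹) *
        ∏ j ∈ Finset.Iio i, (br (q ^ 2 * z i * z j) * br (z j / z i))⁻¹) := by
  rw [siteWeight, numAt, resWeight, den, prod_erase_eq,
    ← Finset.mul_prod_erase _ _ (Finset.mem_univ i), prod_erase_eq, mul_div_cancel_right₀ q (hz.ne i)]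
  simp only [Finset.prod_mul_distrib, mul_inv, Finset.prod_inv_distrib]
  have n1 : ∏ j ∈ Finset.Ioi i, br (z j / z i) ≠ 0 :=
    Finset.prod_ne_zero_iff.2 fun j hj => hz.br_ne _ _ (Finset.mem_Ioi.1 hj).ne'
  have n2 : ∏ j ∈ Finset.Iio i, br (q * z j / z i) ≠ 0 :=
    Finset.prod_ne_zero_iff.2 fun j _ => hz.qbr_ne _ _
  field_simp

/-- The left side is the residue term of the identity map. The cancellation is checked for each pair
i < j, according to whether both, one or neither of i, j is below m; no denominators survive. -/
theorem extremal_eq {q : ℂ} (hq : br q ≠ 0) (B : ℂ → ℂ) {m N : ℕ} (h : m ≤ N) {z : Fin N → ℂ}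
    (hz : Good q z) :
    br q ^ m * pref q z * (num q B (z ∘ Fin.castLE h) *
      ∏ l, siteWeight q z (Fin.castLE h l) (Fin.castLE h l)) = extremal q B m z := by
  have hsite : ∏ l, siteWeight q z (Fin.castLE h l) (Fin.castLE h l) =
      (∏ l : Fin m, (br q * br (q ^ 2 * z (Fin.castLE h l) * z (Fin.castLE h l)))⁻¹) *
      ((∏ i : Fin N, ∏ j ∈ Finset.Ioi i, if (i : ℕ) < m then
        (br (q * z j / z i) * br (q ^ 2 * z i * z j))⁻¹ else 1) *
      ∏ i : Fin N, ∏ j ∈ Finset.Ioi i, if (j : ℕ) < m then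
        (br (q ^ 2 * z j * z i) * br (z i / z j))⁻¹ else 1) := by
    simp only [siteWeight_self hz]
    rw [Finset.prod_mul_distrib, Finset.prod_mul_distrib,
      prod_castLE h (fun i => ∏ j ∈ Finset.Ioi i, (br (q * z j / z i) * br (q ^ 2 * z i * z j))⁻¹),
      prod_castLE h (fun i => ∏ j ∈ Finset.Iio i, (br (q ^ 2 * z i * z j) * br (z j / z i))⁻¹),
      ← prod_Iio_comm (fun j i => if (j : ℕ) < m then
        (br (q ^ 2 * z j * z i) * br (z i / z j))⁻¹ else 1)]
    congr 2
    · refine Finset.prod_congr rfl fun i _ => ?_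
      split_ifs <;> simp
    · refine Finset.prod_congr rfl fun i _ => ?_
      split_ifs <;> simp
  have hnum : num q B (z ∘ Fin.castLE h) =
      (∏ i : Fin N, ∏ j ∈ Finset.Ioi i, if (j : ℕ) < m then br (q * z j / z i) * br (z i / z j) *
        (br (q * z i * z j) * br (q ^ 2 * z i * z j)) else 1) *
      ∏ l : Fin m, (br (q ^ 2 * z (Fin.castLE h l) * z (Fin.castLE h l)) * B (z (Fin.castLE h l))) := by
    rw [num, ← prod_pairs_castLE h (fun i j => br (q * z j / z i) * br (z i / z j) *
        (br (q * z i * z j) * br (q ^ 2 * z i * z j)))]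
    rfl
  have hdiag : br q ^ m * ((∏ l : Fin m, (br (q ^ 2 * z (Fin.castLE h l) * z (Fin.castLE h l)) *
      B (z (Fin.castLE h l)))) *
      ∏ l : Fin m, (br q * br (q ^ 2 * z (Fin.castLE h l) * z (Fin.castLE h l)))⁻¹) =
      ∏ i : Fin N, if (i : ℕ) < m then B (z i) else 1 := by
    rw [← prod_castLE h (fun i => B (z i)), (by simp : br q ^ m = ∏ _l : Fin m, br q),
      ← Finset.prod_mul_distrib, ← Finset.prod_mul_distrib]
    refine Finset.prod_congr rfl fun l _ => ?_
    have := hz.qqbr_ne (Fin.castLE h l) (Fin.castLE h l)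
    generalize br (q ^ 2 * z (Fin.castLE h l) * z (Fin.castLE h l)) = X at *
    field_simp
  have hpair : pref q z * ((∏ i : Fin N, ∏ j ∈ Finset.Ioi i, if (j : ℕ) < m then
        br (q * z j / z i) * br (z i / z j) *
        (br (q * z i * z j) * br (q ^ 2 * z i * z j)) else 1) *
      ((∏ i : Fin N, ∏ j ∈ Finset.Ioi i, if (i : ℕ) < m then
        (br (q * z j / z i) * br (q ^ 2 * z i * z j))⁻¹ else 1) *
      ∏ i : Fin N, ∏ j ∈ Finset.Ioi i, if (j : ℕ) < m then
        (br (q ^ 2 * z j * z i) * br (z i / z j))⁻¹ else 1)) =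
      ∏ i : Fin N, ∏ j ∈ Finset.Ioi i,
      if (j : ℕ) < m then br (q * z j / z i) * br (q * z i * z j)
      else if m ≤ (i : ℕ) then br (q * z j / z i) * br (q ^ 2 * z i * z j) else 1 := by
    rw [pref, pairProd, ← Finset.prod_mul_distrib, ← Finset.prod_mul_distrib,
      ← Finset.prod_mul_distrib]
    refine Finset.prod_congr rfl fun i _ => ?_
    rw [← Finset.prod_mul_distrib, ← Finset.prod_mul_distrib, ← Finset.prod_mul_distrib]
    refine Finset.prod_congr rfl fun j hj => ?_
    have hij : i < j := Finset.mem_Ioi.1 hj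
    have n1 := hz.qbr_ne j i
    have n2 := hz.qqbr_ne i j
    have n3 := hz.br_ne i j hij.ne
    rw [mul_right_comm (q ^ 2) (z j)]
    generalize br (q * z j / z i) = X1 at *
    generalize br (q ^ 2 * z i * z j) = X2 at *
    generalize br (z i / z j) = X3 at *
    by_cases h1 : (j : ℕ) < m
    · have h2 : (i : ℕ) < m := lt_trans hij h1
      simp only [h1, h2, if_true]
      field_simp
    · by_cases h2 : (i : ℕ) < m
      · have h3 : ¬ m ≤ (i : ℕ) := by omega
        simp only [h1, h2, h3, if_true, if_false]
        field_simp
      · have h3 : m ≤ (i : ℕ) := by omega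
        simp only [h1, h2, h3, if_true, if_false]
        ring
  rw [hsite, hnum, extremal, ← hdiag, ← hpair]
  ring

/-- A term survives only if κ is injective (the factor [w_i/w_j]) and κ(l) ≤ l (triangularity), that
is, only for the identity. -/
theorem phi_castLE {q : ℂ} (hq : br q ≠ 0) (B : ℂ → ℂ) {n N : ℕ} (h : n ≤ N) {z : Fin N → ℂ}
    (hz : Good q z) : phi q B (Fin.castLE h) z = extremal q B n z := by
  rw [← extremal_eq hq B h hz, phi]
  congr 1
  refine Fintype.sum_eq_single _ fun κ hκ => ?_
  by_cases hinj : Function.Injective κ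
  · obtain ⟨l, hl⟩ : ∃ l, Fin.castLE h l < κ l := by
      by_contra! hle
      refine hκ (funext fun l => Fin.ext ?_)
      exact eq_of_injective_of_le hinj (fun l _ => hle l) l l.isLt
    rw [Finset.prod_eq_zero (Finset.mem_univ l) (siteWeight_eq_zero_of_lt q hz.ne hl), mul_zero]
  · rw [num_eq_zero_of_not_injective q B hz.ne hinj, zero_mul]

/-- The same argument pins the first m entries of κ to the identity and leaves the last entry k
free. -/
theorem phi_snoc {q : ℂ} (hq : br q ≠ 0) (B : ℂ → ℂ) {m N : ℕ} (h : m ≤ N) (a : Fin N)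
    {z : Fin N → ℂ} (hz : Good q z) :
    phi q B (Fin.snoc (Fin.castLE h) a : Fin (m + 1) → Fin N) z =
      extremal q B m z * br q * ∑ k : Fin N,
        (∏ l : Fin m, (br (q * z k / z (Fin.castLE h l)) * br (z (Fin.castLE h l) / z k) *
          (br (q * z (Fin.castLE h l) * z k) * br (q ^ 2 * z (Fin.castLE h l) * z k)))) *
        (br (q ^ 2 * z k * z k) * B (z k)) * siteWeight q z a k := by
  rw [← extremal_eq hq B h hz, phi]
  have hsum : ∑ κ : Fin (m + 1) → Fin N, num q B (z ∘ κ) *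
        ∏ l, siteWeight q z ((Fin.snoc (Fin.castLE h) a : Fin (m + 1) → Fin N) l) (κ l) =
      ∑ k : Fin N, num q B (z ∘ Fin.castLE h) *
        (∏ l, siteWeight q z (Fin.castLE h l) (Fin.castLE h l)) *
        ((∏ l : Fin m, (br (q * z k / z (Fin.castLE h l)) * br (z (Fin.castLE h l) / z k) *
          (br (q * z (Fin.castLE h l) * z k) * br (q ^ 2 * z (Fin.castLE h l) * z k)))) *
        (br (q ^ 2 * z k * z k) * B (z k)) * siteWeight q z a k) := by
    symm
    refine Fintype.sum_of_injective (fun k => (Fin.snoc (Fin.castLE h) k : Fin (m + 1) → Fin N))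
      ?_ _ _ ?_ ?_
    · intro k k' hk
      simpa using congrFun hk (Fin.last m)
    · intro κ hκ
      by_cases hinj : Function.Injective κ
      · obtain ⟨l, hl⟩ : ∃ l : Fin m, Fin.castLE h l < κ l.castSucc := by
          by_contra! hle
          refine hκ ⟨κ (Fin.last m), funext fun l => ?_⟩
          refine Fin.lastCases (by simp) (fun l => ?_) l
          simp only [Fin.snoc_castSucc]
          refine Fin.ext (eq_of_injective_of_le (m := m) hinj (fun l hl => ?_) l.castSucc
            l.isLt).symm
          exact hle ⟨l, hl⟩
        rw [Finset.prod_eq_zero (Finset.mem_univ l.castSucc), mul_zero]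
        rw [Fin.snoc_castSucc]
        exact siteWeight_eq_zero_of_lt q hz.ne hl
      · rw [num_eq_zero_of_not_injective q B hz.ne hinj, zero_mul]
    · intro k
      have : z ∘ (Fin.snoc (Fin.castLE h) k : Fin (m + 1) → Fin N) =
          (Fin.snoc (z ∘ Fin.castLE h) (z k) : Fin (m + 1) → ℂ) := by
        funext l
        refine Fin.lastCases (by simp) (fun l => by simp) l
      rw [this, num_snoc, Fin.prod_univ_castSucc]
      simp only [Fin.snoc_castSucc, Fin.snoc_last, Function.comp_apply]
      ring
  rw [hsum, ← Finset.mul_sum, pow_succ]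
  ring

/-- The variable `q² w² + q⁻² w⁻²`. -/
def tau (q w : ℂ) : ℂ := q ^ 2 * w ^ 2 + (q ^ 2 * w ^ 2)⁻¹

/-- The values of `tau q w` at which `[q w/x] [q x w]` vanishes. -/
def nu (x : ℂ) : ℂ := x ^ 2 + (x ^ 2)⁻¹

theorem br_mul_br_eq_tau_sub_tau {q x w : ℂ} (hq : q ≠ 0) (hx : x ≠ 0) (hw : w ≠ 0) :
    br (x / w) * br (q ^ 2 * w * x) = tau q x - tau q w := by
  simp only [br, tau]; field_simp; ring

theorem br_mul_br_eq_tau_sub_nu {q x w : ℂ} (hq : q ≠ 0) (hx : x ≠ 0) (hw : w ≠ 0) :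
    br (q * w / x) * br (q * x * w) = tau q w - nu x := by
  simp only [br, tau, nu]; field_simp; ring

/-- The sites from `m` on (sites being numbered from `0`). -/
def sitesFrom (m N : ℕ) : Finset (Fin N) := Finset.univ.filter fun i : Fin N => m ≤ (i : ℕ)

theorem sum_sitesFrom (m N : ℕ) (F : Fin N → ℂ) :
    ∑ k ∈ sitesFrom m N, F k = ∑ k : Fin N, if m ≤ (k : ℕ) then F k else 0 :=
  Finset.sum_filter _ _

/-- All brackets involving z_k pair up into differences in `tau`, except one: `numAt` at the last
site lacks the factor j = N, so [q z_N/z_k] stays in the denominator. The differences from the first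
m sites cancel, leaving only the polynomial factors in `nu`. -/
theorem phi_snoc_last {q : ℂ} (hq0 : q ≠ 0) (hq : br q ≠ 0) (B : ℂ → ℂ) {m N : ℕ} [NeZero N]
    (h : m ≤ N) {z : Fin N → ℂ} (hz : Good q z) :
    phi q B (Fin.snoc (Fin.castLE h) (lastSite N) : Fin (m + 1) → Fin N) z =
      extremal q B m z * br q * ∑ k ∈ sitesFrom m N, B (z k) *
        (∏ l : Fin m, (tau q (z k) - nu (z (Fin.castLE h l)))) /
        (br (q * z (lastSite N) / z k) *
          ∏ j ∈ (sitesFrom m N).erase k, (tau q (z j) - tau q (z k))) := by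
  rw [phi_snoc hq B h _ hz]
  congr 1
  rw [sum_sitesFrom]
  refine Finset.sum_congr rfl fun k _ => ?_
  split_ifs with hk
  swap
  · have hk' : (k : ℕ) < m := by omega
    have : Fin.castLE h ⟨k, hk'⟩ = k := rfl
    rw [Finset.prod_eq_zero (Finset.mem_univ ⟨k, hk'⟩), zero_mul, zero_mul]
    rw [this, br_self (hz.ne k)]; ring
  have hsplit : ∀ F : Fin N → ℂ, ∏ j ∈ Finset.univ.erase k, F j =
      (∏ l : Fin m, F (Fin.castLE h l)) * ∏ j ∈ (sitesFrom m N).erase k, F j := by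
    intro F
    rw [prod_castLE, ← Finset.prod_filter, ← Finset.prod_filter_mul_prod_filter_not _
      (fun j : Fin N => (j : ℕ) < m)]
    congr 2
    · ext j
      simp only [Finset.mem_filter, Finset.mem_erase, Finset.mem_univ, and_true, true_and,
        and_iff_right_iff_imp]
      rintro hj rfl
      omega
    · ext j
      simp [sitesFrom, and_comm]
  have hnum : numAt q z (lastSite N) (z k) =
      ∏ j ∈ Finset.univ.erase (lastSite N), br (q * z j / z k) := by
    have hlast : ∀ j : Fin N, (j : ℕ) ≤ lastSite N := fun j => by
      have := j.isLt; simp only [lastSite]; omega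
    rw [numAt, prod_erase_eq]
    have : Finset.Ioi (lastSite N) = ∅ := by
      ext j
      simpa using Fin.le_def.2 (hlast j)
    rw [this, Finset.prod_empty, Finset.prod_empty]
  have hden : den q z (z k) = (br (q * z (lastSite N) / z k) *
      ∏ j ∈ Finset.univ.erase (lastSite N), br (q * z j / z k)) *
      (br (q ^ 2 * z k * z k) * ∏ j ∈ Finset.univ.erase k, br (q ^ 2 * z k * z j)) := by
    rw [den, Finset.prod_mul_distrib, Finset.mul_prod_erase _ (fun j => br (q * z j / z k)) (Finset.mem_univ _),
      Finset.mul_prod_erase _ (fun j => br (q ^ 2 * z k * z j)) (Finset.mem_univ _)]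
  have hprod : (∏ j ∈ Finset.univ.erase k, br (q ^ 2 * z k * z j)) *
      (∏ j ∈ Finset.univ.erase k, br (z j / z k)) =
      (∏ l : Fin m, (tau q (z (Fin.castLE h l)) - tau q (z k))) *
        ∏ j ∈ (sitesFrom m N).erase k, (tau q (z j) - tau q (z k)) := by
    rw [← hsplit (fun j => tau q (z j) - tau q (z k)), ← Finset.prod_mul_distrib]
    refine Finset.prod_congr rfl fun j _ => ?_
    rw [← br_mul_br_eq_tau_sub_tau hq0 (hz.ne _) (hz.ne _), mul_comm]
  have hfour : ∏ l : Fin m, (br (q * z k / z (Fin.castLE h l)) * br (z (Fin.castLE h l) / z k) *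
          (br (q * z (Fin.castLE h l) * z k) * br (q ^ 2 * z (Fin.castLE h l) * z k))) =
      (∏ l : Fin m, (tau q (z k) - nu (z (Fin.castLE h l)))) *
      ∏ l : Fin m, (tau q (z (Fin.castLE h l)) - tau q (z k)) := by
    rw [← Finset.prod_mul_distrib]
    refine Finset.prod_congr rfl fun l _ => ?_
    rw [← br_mul_br_eq_tau_sub_tau hq0 (hz.ne _) (hz.ne _),
      ← br_mul_br_eq_tau_sub_nu hq0 (hz.ne _) (hz.ne _), mul_right_comm (q ^ 2)]
    ring
  have n1 : ∏ j ∈ Finset.univ.erase (lastSite N), br (q * z j / z k) ≠ 0 :=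
    Finset.prod_ne_zero_iff.2 fun j _ => hz.qbr_ne _ _
  have n2 := hz.qqbr_ne k k
  have n3 := hz.qbr_ne (lastSite N) k
  have n4 : ∏ j ∈ Finset.univ.erase k, br (q ^ 2 * z k * z j) ≠ 0 :=
    Finset.prod_ne_zero_iff.2 fun j _ => hz.qqbr_ne _ _
  have n5 : ∏ j ∈ Finset.univ.erase k, br (z j / z k) ≠ 0 :=
    Finset.prod_ne_zero_iff.2 fun j hj => hz.br_ne _ _ (Finset.ne_of_mem_erase hj)
  have n6 := mul_ne_zero n4 n5
  rw [hprod] at n6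
  have n7 := left_ne_zero_of_mul n6
  have n8 := right_ne_zero_of_mul n6
  have hweight : siteWeight q z (lastSite N) k = (br (q * z (lastSite N) / z k) *
      br (q ^ 2 * z k * z k) * ((∏ j ∈ Finset.univ.erase k, br (q ^ 2 * z k * z j)) *
      (∏ j ∈ Finset.univ.erase k, br (z j / z k))))⁻¹ := by
    rw [siteWeight, hnum, hden, resWeight]
    generalize br (q * z (lastSite N) / z k) = X1 at *
    generalize br (q ^ 2 * z k * z k) = X2 at *
    generalize ∏ j ∈ Finset.univ.erase (lastSite N), br (q * z j / z k) = X3 at *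
    generalize ∏ j ∈ Finset.univ.erase k, br (z j / z k) = X4 at *
    generalize ∏ j ∈ Finset.univ.erase k, br (q ^ 2 * z k * z j) = X5 at *
    field_simp
  rw [hweight, hprod, hfour]
  generalize br (q * z (lastSite N) / z k) = X1 at *
  generalize br (q ^ 2 * z k * z k) = X2 at *
  generalize ∏ l : Fin m, (tau q (z (Fin.castLE h l)) - tau q (z k)) = X3 at *
  generalize ∏ j ∈ (sitesFrom m N).erase k, (tau q (z j) - tau q (z k)) = X4 at *
  field_simp

/-! ### Reflection of the last variable in components -/

/-- Up to sign this is the coefficient of X^(card s - 1) in the Lagrange interpolant of P at the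
nodes, and the interpolant is P itself, of smaller degree. -/
theorem sum_eval_div_prod_erase {ι : Type*} [DecidableEq ι] {s : Finset ι} {v : ι → ℂ}
    (hv : Set.InjOn v s) {P : Polynomial ℂ} (hP : P.natDegree + 2 ≤ s.card) :
    ∑ i ∈ s, P.eval (v i) / ∏ j ∈ s.erase i, (v j - v i) = 0 := by
  have hdeg : P.degree < s.card := by
    refine lt_of_le_of_lt Polynomial.degree_le_natDegree ?_
    exact_mod_cast (by omega : P.natDegree < s.card)
  have h := Lagrange.coeff_eq_sum hv hdeg
  rw [Polynomial.coeff_eq_zero_of_natDegree_lt (by omega)] at h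
  have : ∑ i ∈ s, P.eval (v i) / ∏ j ∈ s.erase i, (v j - v i) =
      (-1) ^ (s.card - 1) * ∑ i ∈ s, P.eval (v i) / ∏ j ∈ s.erase i, (v i - v j) := by
    rw [Finset.mul_sum]
    refine Finset.sum_congr rfl fun i hi => ?_
    have e : ∏ j ∈ s.erase i, (v j - v i) =
        (-1) ^ (s.card - 1) * ∏ j ∈ s.erase i, (v i - v j) := by
      rw [← Finset.card_erase_of_mem hi, ← Finset.prod_const, ← Finset.prod_mul_distrib]
      exact Finset.prod_congr rfl fun j _ => by ring
    have hsq : ((-1 : ℂ) ^ (s.card - 1)) * (-1) ^ (s.card - 1) = 1 := by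
      rw [← mul_pow]; simp
    rw [e, ← div_div, div_eq_mul_inv _ ((-1 : ℂ) ^ (s.card - 1)), inv_eq_of_mul_eq_one_left hsq]
    ring
  rw [this, ← h, mul_zero]

/-- The previous identity with t adjoined as one more node; this is why the degree may be larger by
one. -/
theorem sum_eval_div_prod_erase_add {ι : Type*} [DecidableEq ι] {s : Finset ι} {v : ι → ℂ}
    (hv : ∀ i ∈ s, ∀ j ∈ s, i ≠ j → v i ≠ v j) {t : ℂ} (ht : ∀ i ∈ s, v i ≠ t)
    {P : Polynomial ℂ} (hP : P.natDegree + 1 ≤ s.card) :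
    ∑ i ∈ s, P.eval (v i) / ((∏ j ∈ s.erase i, (v j - v i)) * (t - v i)) +
      P.eval t / ∏ j ∈ s, (v j - t) = 0 := by
  have h := sum_eval_div_prod_erase (s := Finset.insertNone s)
    (v := fun o : Option ι => o.elim t v) (P := P) ?_ ?_
  · rw [Finset.sum_insertNone] at h
    rw [← h, add_comm]
    congr 1
    · congr 1
      have : (Finset.insertNone s).erase none = s.map Function.Embedding.some := by
        ext o; cases o <;> simp
      rw [this, Finset.prod_map]
      rfl
    · refine Finset.sum_congr rfl fun i hi => ?_
      congr 1
      have : (Finset.insertNone s).erase (some i) = Finset.insertNone (s.erase i) := by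
        ext o; cases o <;> simp
      rw [this, Finset.prod_insertNone, mul_comm]
      rfl
  · rintro (_ | i) hi (_ | j) hj e
    · rfl
    · exact absurd e.symm (ht j (by simpa using hj))
    · exact absurd e (ht i (by simpa using hi))
    · by_contra hne
      exact hv i (by simpa using hi) j (by simpa using hj) (fun e => hne (by rw [e])) e
  · rw [Finset.card_insertNone]; omega

/-- The last variable x enters only through [qx/u][q²ux] with u = z_i, m ≤ i. The substitution x ↦
ε/(q³x) interchanges these two brackets up to the common factor -ε, of square 1. -/
theorem extremal_update_last {q ε : ℂ} (hq0 : q ≠ 0) (hε : ε ^ 2 = 1) (B : ℂ → ℂ) {m N : ℕ}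
    [NeZero N] (h : m < N) {z : Fin N → ℂ} (hz : ∀ j, z j ≠ 0) :
    extremal q B m (Function.update z (lastSite N) (ε * (q ^ 3 * z (lastSite N))⁻¹)) =
      extremal q B m z := by
  have hlast : ∀ j : Fin N, (j : ℕ) < m → j ≠ lastSite N := by
    rintro j hj rfl; simp only [lastSite] at hj; omega
  have hlt : ∀ i j : Fin N, i < j → i ≠ lastSite N := by
    rintro i j hij rfl
    have := j.isLt; rw [Fin.lt_def] at hij; simp only [lastSite] at hij; omega
  have hε0 : ε ≠ 0 := by rintro rfl; norm_num at hε
  have hεi : ε⁻¹ = ε := inv_eq_of_mul_eq_one_left (by rw [← sq, hε])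
  unfold extremal
  congr 1
  · refine Finset.prod_congr rfl fun i _ => Finset.prod_congr rfl fun j hj => ?_
    have hi := hlt i j (Finset.mem_Ioi.1 hj)
    rw [Function.update_of_ne hi]
    split_ifs with h1 h2
    · rw [Function.update_of_ne (hlast j h1)]
    · by_cases hjl : j = lastSite N
      · rw [hjl, Function.update_self]
        have := hz i; have := hz (lastSite N)
        simp only [br]
        field_simp
        rw [hε]
        ring
      · rw [Function.update_of_ne hjl]
    · rfl
  · refine Finset.prod_congr rfl fun i _ => ?_
    split_ifs with h1
    · rw [Function.update_of_ne (hlast i h1)]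
    · rfl

/-- For m > 0 the first variable x enters through [qz_j/x][qxz_j], which is invariant under
inversion of x, and through the single factor B(x). -/
theorem extremal_update_first {q : ℂ} (B : ℂ → ℂ) {m N : ℕ} [NeZero N] (h : 0 < m)
    (z : Fin N → ℂ) :
    B (z (firstSite N)) *
      extremal q B m (Function.update z (firstSite N) (z (firstSite N))⁻¹) =
      B (z (firstSite N))⁻¹ * extremal q B m z := by
  unfold extremal
  rw [← Finset.mul_prod_erase Finset.univ (fun i : Fin N => if (i : ℕ) < m then
      B (Function.update z (firstSite N) (z (firstSite N))⁻¹ i) else 1)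
      (Finset.mem_univ (firstSite N)),
    ← Finset.mul_prod_erase Finset.univ (fun i : Fin N => if (i : ℕ) < m then B (z i) else 1)
      (Finset.mem_univ (firstSite N))]
  have h0 : ((firstSite N : Fin N) : ℕ) < m := h
  rw [if_pos h0, if_pos h0, Function.update_self]
  have e1 : ∀ i : Fin N, ∀ j ∈ Finset.Ioi i, j ≠ firstSite N := by
    rintro i j hj rfl
    exact absurd (Finset.mem_Ioi.1 hj) (Fin.not_lt_zero i)
  have e2 : ∏ i ∈ Finset.univ.erase (firstSite N), (if (i : ℕ) < m then
      B (Function.update z (firstSite N) (z (firstSite N))⁻¹ i) else 1) =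
      ∏ i ∈ Finset.univ.erase (firstSite N), (if (i : ℕ) < m then B (z i) else 1) := by
    refine Finset.prod_congr rfl fun i hi => ?_
    rw [Function.update_of_ne (Finset.ne_of_mem_erase hi)]
  have e3 : (∏ i : Fin N, ∏ j ∈ Finset.Ioi i,
      if (j : ℕ) < m then
        br (q * Function.update z (firstSite N) (z (firstSite N))⁻¹ j /
          Function.update z (firstSite N) (z (firstSite N))⁻¹ i) *
        br (q * Function.update z (firstSite N) (z (firstSite N))⁻¹ i *
          Function.update z (firstSite N) (z (firstSite N))⁻¹ j)
      else if m ≤ (i : ℕ) then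
        br (q * Function.update z (firstSite N) (z (firstSite N))⁻¹ j /
          Function.update z (firstSite N) (z (firstSite N))⁻¹ i) *
        br (q ^ 2 * Function.update z (firstSite N) (z (firstSite N))⁻¹ i *
          Function.update z (firstSite N) (z (firstSite N))⁻¹ j) else 1) =
      ∏ i : Fin N, ∏ j ∈ Finset.Ioi i,
        if (j : ℕ) < m then br (q * z j / z i) * br (q * z i * z j)
        else if m ≤ (i : ℕ) then br (q * z j / z i) * br (q ^ 2 * z i * z j) else 1 := by
    refine Finset.prod_congr rfl fun i _ => Finset.prod_congr rfl fun j hj => ?_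
    rw [Function.update_of_ne (e1 i j hj)]
    by_cases hi : i = firstSite N
    · have : ¬ m ≤ ((firstSite N : Fin N) : ℕ) := by omega
      rw [hi, if_neg this, if_neg this, Function.update_self]
      split_ifs
      · rw [div_inv_eq_mul, mul_right_comm q, ← div_eq_mul_inv, mul_right_comm q, mul_comm,
          div_eq_mul_inv, div_eq_mul_inv, mul_right_comm q]
      · rfl
    · rw [Function.update_of_ne hi]
  rw [e2, e3]
  ring

/-- Put Y = z_N and Y' = ε/(q³Y). The two residue sums have the nodes tau(z_k), k ≥ m, except that
tau(Y) is replaced by tau(Y') on the right. Condition `hB` says that the combined numerator is a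
polynomial in tau, so the difference of the sides is a Lagrange sum over all these nodes together,
for Q·p with Q = ∏ (X - nu(z_l)). There are N - m + 1 nodes and the degree is at most m + deg p, so
`hp` makes it vanish. `hY` separates tau(Y') from tau(Y). -/
theorem phi_snoc_last_update {q ε : ℂ} (hq0 : q ≠ 0) (hq : br q ≠ 0) (hε : ε = 1 ∨ ε = -1)
    (B : ℂ → ℂ) {m N : ℕ} [NeZero N] (h : m < N) {z : Fin N → ℂ} (hz : Good q z)
    (hz' : Good q (Function.update z (lastSite N) (ε * (q ^ 3 * z (lastSite N))⁻¹)))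
    (hY : br (q ^ 3 * z (lastSite N) * z (lastSite N)) ≠ 0) {C C' : ℂ} {p : Polynomial ℂ}
    (hp : p.natDegree + 2 * m + 1 ≤ N)
    (hB : ∀ y, (y = ε * (q ^ 3 * z (lastSite N))⁻¹ ∨ ∃ k, y = z k) →
      B y * (C * br (q ^ 3 * z (lastSite N) * y) + ε * C' * br (z (lastSite N) / y)) =
        p.eval (tau q y)) :
    C * phi q B (Fin.snoc (Fin.castLE h.le) (lastSite N) : Fin (m + 1) → Fin N) z =
      C' * phi q B (Fin.snoc (Fin.castLE h.le) (lastSite N) : Fin (m + 1) → Fin N)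
        (Function.update z (lastSite N) (ε * (q ^ 3 * z (lastSite N))⁻¹)) := by
  have hε2 : ε ^ 2 = 1 := by rcases hε with rfl | rfl <;> norm_num
  rw [phi_snoc_last hq0 hq B h.le hz, phi_snoc_last hq0 hq B h.le hz',
    extremal_update_last hq0 hε2 B h hz.ne]
  set Y := z (lastSite N) with hYdef
  set Y' := ε * (q ^ 3 * Y)⁻¹ with hY'
  have hY0 : Y ≠ 0 := hz.ne _
  have hε0 : ε ≠ 0 := by rintro rfl; norm_num at hε2
  have hY'0 : Y' ≠ 0 := by rw [hY']; positivity
  have hmem : lastSite N ∈ sitesFrom m N := by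
    simp only [sitesFrom, Finset.mem_filter, Finset.mem_univ, true_and, lastSite]; omega
  set S := sitesFrom m N
  -- The reflected node vanishes against y exactly through [q³Yy] and [qY/y]; the second bracket is
  -- the exceptional denominator of `phi_snoc_last`.
  have hτ : ∀ y, y ≠ 0 → tau q Y' - tau q y = br (q ^ 3 * Y * y) * br (q * Y / y) := by
    intro y hy
    have : Y' ^ 2 = ((q ^ 3 * Y) ^ 2)⁻¹ := by rw [hY', mul_pow, hε2, one_mul, inv_pow]
    simp only [br, tau, this]; field_simp; ring
  have hττ : ∀ j k : Fin N, tau q (z j) - tau q (z k) = br (z j / z k) * br (q ^ 2 * z k * z j) :=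
    fun j k => (br_mul_br_eq_tau_sub_tau hq0 (hz.ne _) (hz.ne _)).symm
  have hττ0 : ∀ j k : Fin N, j ≠ k → tau q (z j) - tau q (z k) ≠ 0 := fun j k hjk => by
    rw [hττ]; exact mul_ne_zero (hz.br_ne j k hjk) (hz.qqbr_ne k j)
  have hτ'0 : ∀ k : Fin N, tau q Y' - tau q (z k) ≠ 0 := by
    intro k
    by_cases hk : k = lastSite N
    · rw [hk, ← hYdef, hτ _ hY0, mul_div_cancel_right₀ q hY0]; exact mul_ne_zero hY hq
    · have h1 := hz'.br_ne (lastSite N) k (Ne.symm hk)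
      have h2 := hz'.qqbr_ne k (lastSite N)
      rw [Function.update_self, Function.update_of_ne hk] at h1 h2
      rw [← br_mul_br_eq_tau_sub_tau hq0 hY'0 (hz.ne _)]
      exact mul_ne_zero h1 h2
  set Q : Polynomial ℂ := ∏ l : Fin m,
    (Polynomial.X - Polynomial.C (nu (z (Fin.castLE h.le l)))) with hQ
  have hQe : ∀ t, Q.eval t = ∏ l : Fin m, (t - nu (z (Fin.castLE h.le l))) := by
    intro t; rw [hQ, Polynomial.eval_prod]; simp
  have hQd : Q.natDegree ≤ m := by
    rw [hQ, Polynomial.natDegree_prod_of_monic _ _ fun _ _ => Polynomial.monic_X_sub_C _]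
    simp
  have hcard : S.card = N - m := by
    have h1 : (Finset.univ.filter fun i : Fin N => (i : ℕ) < m).card + S.card = N := by
      have := Finset.card_filter_add_card_filter_not (s := (Finset.univ : Finset (Fin N)))
        (fun i : Fin N => (i : ℕ) < m)
      simpa [S, sitesFrom] using this
    have h2 : (Finset.univ.filter fun i : Fin N => (i : ℕ) < m).card = m := by
      rw [Fin.card_filter_val_lt]; omega
    omega
  have hlag := sum_eval_div_prod_erase_add (s := S) (v := fun k => tau q (z k)) (t := tau q Y')
    (fun i _ j _ hij e => hττ0 i j hij (sub_eq_zero.2 e))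
    (fun i _ e => hτ'0 i (sub_eq_zero.2 e.symm)) (P := Q * p)
    (by have := Polynomial.natDegree_mul_le (p := Q) (q := p); omega)
  have hupd : ∀ l : Fin m, Function.update z (lastSite N) Y' (Fin.castLE h.le l) =
      z (Fin.castLE h.le l) := by
    intro l
    rw [Function.update_of_ne]
    intro e
    have hl := l.isLt
    have := congrArg Fin.val e
    simp only [lastSite, Fin.val_castLE] at this
    omega
  simp only [hupd, ← hQe, Function.update_self]
  suffices hs : C * ∑ k ∈ S, B (z k) * Q.eval (tau q (z k)) /
        (br (q * Y / z k) * ∏ j ∈ S.erase k, (tau q (z j) - tau q (z k))) -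
      C' * ∑ k ∈ S, B (Function.update z (lastSite N) Y' k) *
        Q.eval (tau q (Function.update z (lastSite N) Y' k)) /
        (br (q * Y' / Function.update z (lastSite N) Y' k) * ∏ j ∈ S.erase k,
          (tau q (Function.update z (lastSite N) Y' j) -
            tau q (Function.update z (lastSite N) Y' k))) = 0 by
    linear_combination (extremal q B m z * br q) * hs
  rw [← hlag, ← Finset.add_sum_erase S _ hmem, ← Finset.add_sum_erase S _ hmem,
    ← Finset.add_sum_erase S _ hmem, Function.update_self, ← Finset.mul_prod_erase S _ hmem]
  have hne : ∀ j ∈ S.erase (lastSite N), Function.update z (lastSite N) Y' j = z j :=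
    fun j hj => Function.update_of_ne (Finset.ne_of_mem_erase hj) _ _
  have hP1 : ∏ j ∈ S.erase (lastSite N), (tau q (Function.update z (lastSite N) Y' j) - tau q Y') =
      ∏ j ∈ S.erase (lastSite N), (tau q (z j) - tau q Y') :=
    Finset.prod_congr rfl fun j hj => by rw [hne j hj]
  -- The node Y occurs only in the sum for z. There [Y/y] = 0 at y = Y, so `hB` reduces to its C
  -- term; likewise Y' occurs only in the reflected sum, and q³YY' = ε kills the C term.
  have t1 : C * (B Y * Q.eval (tau q Y) / (br (q * Y / Y) *
      ∏ j ∈ S.erase (lastSite N), (tau q (z j) - tau q Y))) =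
      (Q * p).eval (tau q Y) / ((∏ j ∈ S.erase (lastSite N), (tau q (z j) - tau q Y)) *
        (tau q Y' - tau q Y)) := by
    have hb := hB Y (Or.inr ⟨_, hYdef⟩)
    rw [br_self hY0] at hb
    rw [hτ Y hY0, Polynomial.eval_mul, ← hb, mul_div_cancel_right₀ q hY0]
    generalize br (q ^ 3 * Y * Y) = X at *
    generalize ∏ j ∈ S.erase (lastSite N), (tau q (z j) - tau q Y) = X'
    field_simp
    ring
  have t2 : C' * (B Y' * Q.eval (tau q Y') / (br (q * Y' / Y') *
      ∏ j ∈ S.erase (lastSite N), (tau q (z j) - tau q Y'))) =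
      -((Q * p).eval (tau q Y') / ((tau q Y - tau q Y') *
        ∏ j ∈ S.erase (lastSite N), (tau q (z j) - tau q Y'))) := by
    have hb := hB Y' (Or.inl rfl)
    have e1 : br (q ^ 3 * Y * Y') = 0 := by
      rw [hY']
      have : q ^ 3 * Y * (ε * (q ^ 3 * Y)⁻¹) = ε := by field_simp
      rw [this]
      rcases hε with rfl | rfl <;> norm_num [br]
    have e2 : ε * br (Y / Y') = br (q ^ 3 * Y * Y) := by
      rw [hY']
      simp only [br]; field_simp; rw [hε2]
    have e3 : tau q Y - tau q Y' = -(br (q ^ 3 * Y * Y) * br q) := by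
      rw [← neg_sub, hτ Y hY0, mul_div_cancel_right₀ q hY0]
    rw [e1, mul_zero, zero_add, mul_right_comm ε, e2] at hb
    rw [e3, Polynomial.eval_mul, ← hb, mul_div_cancel_right₀ q hY'0, neg_mul, div_neg, neg_neg]
    generalize br (q ^ 3 * Y * Y) = X at *
    generalize ∏ j ∈ S.erase (lastSite N), (tau q (z j) - tau q Y') = X'
    field_simp
  -- At a common node the denominators combine into [qY/z_k][q³Yz_k] · [Y/z_k][q²z_kY], that is, the
  -- differences from tau(Y') and tau(Y); the numerator is then the left side of `hB`.
  have t3 : C * ∑ k ∈ S.erase (lastSite N), B (z k) * Q.eval (tau q (z k)) /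
        (br (q * Y / z k) * ∏ j ∈ S.erase k, (tau q (z j) - tau q (z k))) -
      C' * ∑ k ∈ S.erase (lastSite N), B (Function.update z (lastSite N) Y' k) *
        Q.eval (tau q (Function.update z (lastSite N) Y' k)) /
        (br (q * Y' / Function.update z (lastSite N) Y' k) * ∏ j ∈ S.erase k,
          (tau q (Function.update z (lastSite N) Y' j) -
            tau q (Function.update z (lastSite N) Y' k))) =
      ∑ k ∈ S.erase (lastSite N), (Q * p).eval (tau q (z k)) /
        ((∏ j ∈ S.erase k, (tau q (z j) - tau q (z k))) * (tau q Y' - tau q (z k))) := by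
    rw [Finset.mul_sum, Finset.mul_sum, ← Finset.sum_sub_distrib]
    refine Finset.sum_congr rfl fun k hk => ?_
    have hkl := Finset.ne_of_mem_erase hk
    have hmem' : lastSite N ∈ S.erase k := Finset.mem_erase.2 ⟨hkl.symm, hmem⟩
    rw [hne k hk, ← Finset.mul_prod_erase (S.erase k) _ hmem',
      ← Finset.mul_prod_erase (S.erase k) (fun j => tau q (Function.update z (lastSite N) Y' j) -
            tau q (z k)) hmem', Function.update_self]
    have hP : ∏ j ∈ (S.erase k).erase (lastSite N),
        (tau q (Function.update z (lastSite N) Y' j) - tau q (z k)) =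
        ∏ j ∈ (S.erase k).erase (lastSite N), (tau q (z j) - tau q (z k)) :=
      Finset.prod_congr rfl fun j hj => by
        rw [Function.update_of_ne (Finset.ne_of_mem_erase hj)]
    have hb := hB (z k) (Or.inr ⟨_, rfl⟩)
    have e1 : br (q * Y' / z k) = -ε * br (q ^ 2 * z k * Y) := by
      have := hz.ne k
      rw [hY']
      simp only [br]; field_simp; linear_combination (q ^ 4 * z k ^ 2 * Y ^ 2) * hε2
    have n1 := hz.qbr_ne (lastSite N) k
    have n2 := hz.qqbr_ne k (lastSite N)
    have n3 := hz.br_ne (lastSite N) k hkl.symm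
    have n4 := hτ'0 k
    have n5 : ∏ j ∈ (S.erase k).erase (lastSite N), (tau q (z j) - tau q (z k)) ≠ 0 :=
      Finset.prod_ne_zero_iff.2 fun j hj =>
        hττ0 _ _ (Finset.ne_of_mem_erase (Finset.mem_of_mem_erase hj))
    rw [hτ _ (hz.ne k)] at n4
    have n6 := left_ne_zero_of_mul n4
    rw [hP, hττ, e1, hτ _ (hz.ne k), Polynomial.eval_mul, ← hb]
    rw [← hYdef] at *
    generalize br (q * Y / z k) = X1 at *
    generalize br (q ^ 2 * z k * Y) = X2 at *
    generalize br (Y / z k) = X3 at *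
    generalize br (q ^ 3 * Y * z k) = X4 at *
    generalize ∏ j ∈ (S.erase k).erase (lastSite N), (tau q (z j) - tau q (z k)) = X5 at *
    field_simp
    linear_combination (-(B (z k) * Q.eval (tau q (z k)) * X3 * C')) * hε2
  rw [hP1, mul_add, mul_add, t1, t2]
  linear_combination t3

/-! ### Reflection relations for the vectors -/

/-- The vector `Ψ_N`, as a sum of residues. -/
def psiVec (q β : ℂ) {N : ℕ} (z : Fin N → ℂ) : VN N := phiVec q (fun w => br (β * w)) 1 (N / 2) z

theorem psiVec_exchange {q : ℂ} (hq0 : q ≠ 0) (β : ℂ) {N : ℕ} {z : Fin N → ℂ} (hz : Good q z)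
    {p p' : Fin N} (h : (p : ℕ) + 1 = p') : CompExchange q (psiVec q β) z p p' :=
  phiVec_exchange hq0 _ 1 (N / 2) hz.ne h

theorem card_marks_eq {v : Fin 2} {n N : ℕ} {σ : Config N} {a : Fin n → Fin N}
    (ha : Function.Injective a) (hσ : ∀ k, σ k = v ↔ ∃ l, a l = k) : (marks v σ).card = n := by
  have : marks v σ = Finset.univ.map ⟨a, ha⟩ := by
    ext k; simp [mem_marks, hσ]
  rw [this, Finset.card_map, Finset.card_univ, Fintype.card_fin]

theorem phiVec_eq_phi (q : ℂ) (B : ℂ → ℂ) {v : Fin 2} {n N : ℕ} (z : Fin N → ℂ) {σ : Config N}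
    {a : Fin n → Fin N} (ha : StrictMono a) (hσ : ∀ k, σ k = v ↔ ∃ l, a l = k) :
    phiVec q B v n z σ = phi q B a z :=
  phiVec_of_strictMono q B v z (card_marks_eq ha.injective hσ) ha fun l => (hσ _).2 ⟨l, rfl⟩

theorem exists_castLE_iff {m N : ℕ} (h : m ≤ N) (k : Fin N) :
    (∃ l : Fin m, Fin.castLE h l = k) ↔ (k : ℕ) < m :=
  ⟨fun ⟨l, hl⟩ => hl ▸ l.isLt, fun hk => ⟨⟨k, hk⟩, rfl⟩⟩

theorem exists_snoc_castLE_iff {m N : ℕ} (h : m ≤ N) (a k : Fin N) :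
    (∃ l, (Fin.snoc (Fin.castLE h) a : Fin (m + 1) → Fin N) l = k) ↔ (k : ℕ) < m ∨ k = a := by
  rw [Fin.exists_fin_succ', ← exists_castLE_iff h]
  simp [eq_comm]

theorem strictMono_snoc_castLE {m N : ℕ} [NeZero N] (h : m < N) :
    StrictMono (Fin.snoc (Fin.castLE h.le) (lastSite N) : Fin (m + 1) → Fin N) := by
  intro l l'
  refine Fin.lastCases ?_ (fun l' => ?_) l'
  · refine Fin.lastCases (fun hl => absurd hl (lt_irrefl _)) (fun l _ => ?_) l
    rw [Fin.snoc_castSucc, Fin.snoc_last, Fin.lt_def]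
    have := l.isLt
    simp only [Fin.val_castLE, lastSite]; omega
  · refine Fin.lastCases (fun hl => absurd hl (Fin.castSucc_lt_last l').asymm) (fun l hl => ?_) l
    rw [Fin.snoc_castSucc, Fin.snoc_castSucc]
    exact hl

theorem phiVec_eq_extremal {q : ℂ} (hq : br q ≠ 0) (B : ℂ → ℂ) {v : Fin 2} {m N : ℕ} (h : m ≤ N)
    {z : Fin N → ℂ} (hz : Good q z) {σ : Config N} (hσ : ∀ k, σ k = v ↔ (k : ℕ) < m) :
    phiVec q B v m z σ = extremal q B m z := by
  rw [← phi_castLE hq B h hz]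
  exact phiVec_eq_phi q B z (fun _ _ hl => hl) fun k => (hσ k).trans (exists_castLE_iff h k).symm

theorem phiVec_eq_phi_snoc (q : ℂ) (B : ℂ → ℂ) {v : Fin 2} {m N : ℕ} [NeZero N] (h : m < N)
    (z : Fin N → ℂ) {σ : Config N} (hσ : ∀ k, σ k = v ↔ (k : ℕ) < m ∨ k = lastSite N) :
    phiVec q B v (m + 1) z σ =
      phi q B (Fin.snoc (Fin.castLE h.le) (lastSite N) : Fin (m + 1) → Fin N) z :=
  phiVec_eq_phi q B z (strictMono_snoc_castLE h) fun k =>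
    (hσ k).trans (exists_snoc_castLE_iff h.le _ k).symm

/-! ### Extremal components of the dual vector -/

theorem prod_pairs_rev {N : ℕ} (F : Fin N → Fin N → ℂ) :
    ∏ i, ∏ j ∈ Finset.Ioi i, F i j = ∏ i : Fin N, ∏ j ∈ Finset.Ioi i, F j.rev i.rev := by
  rw [prod_pairs_eq, prod_pairs_eq (fun i j => F j.rev i.rev)]
  refine Finset.prod_nbij' (fun p => (p.2.rev, p.1.rev)) (fun p => (p.2.rev, p.1.rev)) ?_ ?_ ?_ ?_ ?_
  all_goals simp

/-- The m' = N - m up spins at the end become the first m' sites after reversal. Pairs below m and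
pairs from m on change roles, as [quv] and [q²uv] do, and `dualB` cancels [βz_i] exactly at the up
spins. -/
theorem extremal_dual {q β c : ℂ} (hq0 : q ≠ 0) (hc : c ^ 2 * q ^ 3 = -1) {m m' N : ℕ}
    (hm : m + m' = N) {z : Fin N → ℂ} (hz : ∀ j, z j ≠ 0) (hβz : ∀ j, br (β * z j) ≠ 0) :
    (∏ i, br (β * z i)) * extremal q (dualB β c) m' (dual c z) =
      extremal q (fun w => br (β * w)) m z := by
  have hc0 : c ≠ 0 := by rintro rfl; simp at hc
  have e1 : ∀ u v : ℂ, u ≠ 0 → v ≠ 0 → br (q ^ 2 * (c / u) * (c / v)) = br (q * v * u) := by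
    intro u v hu hv
    have : q ^ 2 * (c / u) * (c / v) = -(q * v * u)⁻¹ := by
      field_simp; linear_combination hc
    rw [this, br_neg, br_inv, neg_neg]
  have e2 : ∀ u v : ℂ, u ≠ 0 → v ≠ 0 → br (q * (c / u) * (c / v)) = br (q ^ 2 * v * u) := by
    intro u v hu hv
    have : q * (c / u) * (c / v) = -(q ^ 2 * v * u)⁻¹ := by
      field_simp; linear_combination hc
    rw [this, br_neg, br_inv, neg_neg]
  have e4 : ∀ u v : ℂ, u ≠ 0 → v ≠ 0 → q * (c / u) / (c / v) = q * v / u := by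
    intro u v hu hv; field_simp
  unfold extremal
  rw [prod_pairs_rev, mul_left_comm, ← Equiv.prod_comp Fin.revPerm (fun i : Fin N =>
    if (i : ℕ) < m' then dualB β c (dual c z i) else 1), ← Finset.prod_mul_distrib]
  congr 1
  · refine Finset.prod_congr rfl fun i _ => Finset.prod_congr rfl fun j hj => ?_
    have hij := Fin.lt_def.1 (Finset.mem_Ioi.1 hj)
    have := j.isLt
    simp only [dual, Fin.rev_rev]
    rw [e4 _ _ (hz _) (hz _), e1 _ _ (hz _) (hz _), e2 _ _ (hz _) (hz _)]
    by_cases h1 : (j : ℕ) < m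
    · rw [if_pos h1, if_neg (by rw [Fin.val_rev]; omega), if_pos (by rw [Fin.val_rev]; omega)]
    · by_cases h2 : m ≤ (i : ℕ)
      · rw [if_neg h1, if_pos h2, if_pos (by rw [Fin.val_rev]; omega)]
      · rw [if_neg h1, if_neg h2, if_neg (by rw [Fin.val_rev]; omega),
          if_neg (by rw [Fin.val_rev]; omega)]
  · refine Finset.prod_congr rfl fun i _ => ?_
    have := i.isLt
    simp only [dual, Fin.rev_rev, Fin.revPerm_apply, dualB]
    have e : β * c / (c / z i) = β * z i := by have := hz i; field_simp
    rw [e]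
    by_cases h : (i : ℕ) < m
    · rw [if_pos h, if_neg (by rw [Fin.val_rev]; omega), mul_one]
    · rw [if_neg h, if_pos (by rw [Fin.val_rev]; omega), mul_inv_cancel₀ (hβz i)]

/-! ### Stability of the exchange relations under differences, diagonal factors and substitutions -/

theorem CompExchange.sub {q : ℂ} {N : ℕ} {Φ Φ' : (Fin N → ℂ) → VN N} {z : Fin N → ℂ}
    {p p' : Fin N} (h : CompExchange q Φ z p p') (h' : CompExchange q Φ' z p p') :
    CompExchange q (fun z σ => Φ z σ - Φ' z σ) z p p' := by
  intro σ
  constructor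
  · intro hσ; linear_combination (h σ).1 hσ - (h' σ).1 hσ
  · intro hσ; linear_combination (h σ).2 hσ - (h' σ).2 hσ

theorem CompExchange.diagonal {q : ℂ} {N : ℕ} {Φ : (Fin N → ℂ) → VN N} {z : Fin N → ℂ}
    {i p p' : Fin N} (h : CompExchange q Φ z p p') (hp : p ≠ i) (hp' : p' ≠ i)
    (f : Fin 2 → ℂ → ℂ) : CompExchange q (fun z σ => f (σ i) (z i) * Φ z σ) z p p' := by
  have hi : Equiv.swap p p' i = i := Equiv.swap_apply_of_ne_of_ne hp.symm hp'.symm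
  intro σ
  simp only [Function.comp_apply, hi]
  constructor
  · intro hσ; linear_combination f (σ i) (z i) * (h σ).1 hσ
  · intro hσ; linear_combination f (σ i) (z i) * (h σ).2 hσ

theorem update_comp_swap {N : ℕ} (z : Fin N → ℂ) {i p p' : Fin N} (hp : p ≠ i) (hp' : p' ≠ i)
    (w : ℂ) : Function.update (z ∘ Equiv.swap p p') i w = Function.update z i w ∘ Equiv.swap p p' := by
  have hi : Equiv.swap p p' i = i := Equiv.swap_apply_of_ne_of_ne hp.symm hp'.symm
  rw [Function.update_comp_equiv, Equiv.symm_swap, hi]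

theorem CompExchange.update {q : ℂ} {N : ℕ} {Φ : (Fin N → ℂ) → VN N} {z : Fin N → ℂ}
    {i p p' : Fin N} {g : ℂ → ℂ} (h : CompExchange q Φ (Function.update z i (g (z i))) p p')
    (hp : p ≠ i) (hp' : p' ≠ i) :
    CompExchange q (fun z => Φ (Function.update z i (g (z i)))) z p p' := by
  have hi : Equiv.swap p p' i = i := Equiv.swap_apply_of_ne_of_ne hp.symm hp'.symm
  intro σ
  have := h σ
  rw [Function.update_of_ne hp, Function.update_of_ne hp', ← update_comp_swap z hp hp'] at this
  simpa only [Function.comp_apply, hi] using this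

theorem psiVec_of_card_ne (q β : ℂ) {N : ℕ} (z : Fin N → ℂ) {σ : Config N}
    (h : (marks 1 σ).card ≠ N / 2) : psiVec q β z σ = 0 := by
  rw [psiVec, phiVec, dif_neg h]

/-- The difference of the two sides satisfies the exchange relations at all pairs avoiding i, since
both the diagonal factor and the substitution concern the site i alone. By `hlo` the window [lo, hi]
contains exactly the sites other than i. -/
theorem reflection_of_component {q β : ℂ} (hq0 : q ≠ 0) {N : ℕ} {i : Fin N} {lo hi : ℕ}
    (hlo : ∀ k : Fin N, (k : ℕ) < lo ∨ hi < (k : ℕ) ↔ k = i) {Z : Set (Fin N → ℂ)}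
    {f : Fin 2 → ℂ → ℂ} {g : ℂ → ℂ}
    (hZ : ∀ z ∈ Z, Good q z ∧ Good q (Function.update z i (g (z i))))
    (hswap : ∀ z ∈ Z, ∀ p p', p ≠ i → p' ≠ i → z ∘ Equiv.swap p p' ∈ Z)
    {σ τ : Config N} (hcard : (marks 1 σ).card = (marks 1 τ).card) (hστ : σ i = τ i)
    (h : ∀ z ∈ Z, f (σ i) (z i) * psiVec q β z σ =
      psiVec q β (Function.update z i (g (z i))) σ) :
    ∀ z ∈ Z, f (τ i) (z i) * psiVec q β z τ = psiVec q β (Function.update z i (g (z i))) τ := by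
  intro z hz
  rw [← sub_eq_zero]
  refine eq_zero_of_exchange (Z := Z) (σ := σ) (lo := lo) (hi := hi)
    (D := fun z τ => f (τ i) (z i) * psiVec q β z τ -
      psiVec q β (Function.update z i (g (z i))) τ) (q := q) ?_ hcard ?_ ?_ z hz
  · intro z hz p p' hpp h1 h2
    have hp : p ≠ i := fun e => by have := (hlo p).2 e; omega
    have hp' : p' ≠ i := fun e => by have := (hlo p').2 e; omega
    refine ⟨hswap z hz p p' hp hp', (hZ z hz).1.br_ne _ _ (by rintro rfl; omega), ?_⟩
    exact ((psiVec_exchange hq0 β (hZ z hz).1 hpp).diagonal hp hp' f).sub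
      ((psiVec_exchange hq0 β (hZ z hz).2 hpp).update hp hp')
  · intro k hk
    rw [(hlo k).1 hk, hστ]
  · intro z hz
    rw [h z hz, sub_self]

theorem exists_card_marks {N m : ℕ} (h : m ≤ N) :
    ∃ σ : Config N, (marks 1 σ).card = m ∧ (∀ k, σ k = 1 ↔ (k : ℕ) < m) ∧
      ∀ k, σ k = 0 ↔ m ≤ (k : ℕ) := by
  have h1 : ∀ k : Fin N, (if (k : ℕ) < m then (1 : Fin 2) else 0) = 1 ↔ (k : ℕ) < m := by
    intro k; split_ifs with hk <;> simp [hk]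
  refine ⟨fun k => if (k : ℕ) < m then 1 else 0,
    card_marks_eq (Fin.castLE_injective h) (fun k => (h1 k).trans (exists_castLE_iff h k).symm), h1,
    fun k => ?_⟩
  beta_reduce
  split_ifs with hk <;> simpa using hk

/-- Both vectors solve the same exchange relations, so one component decides. For all down spins on
the left, the down spins are extremal in one form and the reversed up spins are extremal in the
other. -/
theorem psiVec_eq_dualVec {q β c : ℂ} (hq0 : q ≠ 0) (hq : br q ≠ 0) (hc : c ^ 2 * q ^ 3 = -1)
    {N : ℕ} {z : Fin N → ℂ} (hz : Good q z) (hy : Good q (dual c z))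
    (hβz : ∀ j, br (β * z j) ≠ 0) : psiVec q β z = dualVec q β c z := by
  have hc0 : c ≠ 0 := by rintro rfl; simp at hc
  have hN : (N + 1) / 2 = N - N / 2 := by omega
  obtain ⟨σ, hσ, hσ1, hσ0⟩ := exists_card_marks (N := N) (Nat.div_le_self N 2)
  funext τ
  by_cases hτ : (marks 1 τ).card = N / 2
  swap
  · have hτ0 : (marks 0 (τ ∘ Fin.rev)).card ≠ (N + 1) / 2 := by
      have h1 := card_marks_comp 0 τ Fin.revPerm
      have h2 := card_marks_zero_add τ
      change (marks 0 (τ ∘ Fin.rev)).card = _ at h1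
      omega
    rw [psiVec_of_card_ne q β z hτ, dualVec, phiVec, dif_neg hτ0, mul_zero]
  rw [← sub_eq_zero]
  refine eq_zero_of_exchange (q := q) (σ := σ) (lo := 0) (hi := N)
    (Z := {z : Fin N → ℂ | Good q z ∧ Good q (dual c z) ∧ ∀ j, br (β * z j) ≠ 0})
    (D := fun z τ => psiVec q β z τ - dualVec q β c z τ) ?_ (hσ.trans hτ.symm) ?_ ?_ z
    ⟨hz, hy, hβz⟩
  · rintro z ⟨hz, hy, hβz⟩ p p' h _ _
    refine ⟨⟨hz.comp _, ?_, fun j => hβz _⟩, hz.br_ne _ _ (by rintro rfl; omega),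
      (psiVec_exchange hq0 β hz h).sub (dualVec_exchange hq0 β hc0 hz.ne h)⟩
    have : dual c (z ∘ Equiv.swap p p') =
        dual c z ∘ (Fin.revPerm.trans ((Equiv.swap p p').trans Fin.revPerm)) := by
      funext j; simp [dual]
    rw [this]
    exact hy.comp _
  · intro k hk
    have := k.isLt
    omega
  · rintro z ⟨hz, hy, hβz⟩
    rw [psiVec, dualVec, phiVec_eq_extremal hq _ (Nat.div_le_self N 2) hz hσ1,
      phiVec_eq_extremal (m := (N + 1) / 2) hq _ (by omega) hy (fun k => ?_),
      extremal_dual (m := N / 2) hq0 hc (by omega) hz.ne hβz, sub_self]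
    rw [Function.comp, hσ0, Fin.val_rev]
    have := k.isLt
    omega

/-- One component is checked for each value of the last spin. Up: the extremal product is invariant.
Down: the extremal product with one further spin at the end obeys the Lagrange identity. -/
theorem psiVec_reflect_last {q β ε : ℂ} (hq0 : q ≠ 0) (hq : br q ≠ 0) (hβ : β ≠ 0)
    (hε : ε = 1 ∨ ε = -1) {N : ℕ} [NeZero N] {z : Fin N → ℂ} (hz : Good q z)
    (hz' : Good q (Function.update z (lastSite N) (ε * (q ^ 3 * z (lastSite N))⁻¹)))
    (hβz : br (β * q * z (lastSite N)) ≠ 0)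
    (hY : br (q ^ 3 * z (lastSite N) * z (lastSite N)) ≠ 0) (τ : Config N) :
    (if τ (lastSite N) = 0 then 1 else
      -ε * br (q ^ 2 * z (lastSite N) / β) / br (β * q * z (lastSite N))) * psiVec q β z τ =
      psiVec q β (Function.update z (lastSite N) (ε * (q ^ 3 * z (lastSite N))⁻¹)) τ := by
  by_cases hτ : (marks 1 τ).card = N / 2
  swap
  · rw [psiVec_of_card_ne q β _ hτ, psiVec_of_card_ne q β _ hτ, mul_zero]
  have hε2 : ε ^ 2 = 1 := by rcases hε with rfl | rfl <;> norm_num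
  have hN : 0 < N := Nat.pos_of_ne_zero (NeZero.ne N)
  obtain ⟨lo, hi, hrange⟩ : ∃ lo hi : ℕ, ∀ k : Fin N, (k : ℕ) < lo ∨ hi < (k : ℕ) ↔
      k = lastSite N := by
    -- For N = 1 the window must be empty, whereas truncated subtraction would give the window {0}.
    by_cases h1 : N = 1
    · refine ⟨1, 1, fun k => ?_⟩
      have := k.isLt
      simp only [lastSite, Fin.ext_iff]
      omega
    · refine ⟨0, N - 2, fun k => ?_⟩
      have := k.isLt
      simp only [lastSite, Fin.ext_iff]
      omega
  set Z : Set (Fin N → ℂ) := {z | Good q z ∧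
    Good q (Function.update z (lastSite N) (ε * (q ^ 3 * z (lastSite N))⁻¹)) ∧
    br (β * q * z (lastSite N)) ≠ 0 ∧ br (q ^ 3 * z (lastSite N) * z (lastSite N)) ≠ 0}
  have hZ : ∀ z ∈ Z, Good q z ∧
    Good q (Function.update z (lastSite N) (ε * (q ^ 3 * z (lastSite N))⁻¹)) :=
    fun z hz => ⟨hz.1, hz.2.1⟩
  have hswap : ∀ z ∈ Z, ∀ p p', p ≠ lastSite N → p' ≠ lastSite N → z ∘ Equiv.swap p p' ∈ Z := by
    rintro z ⟨h1, h2, h3, h4⟩ p p' hp hp'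
    have hi : Equiv.swap p p' (lastSite N) = lastSite N :=
      Equiv.swap_apply_of_ne_of_ne hp.symm hp'.symm
    refine ⟨h1.comp _, ?_, ?_, ?_⟩
    · rw [update_comp_swap z hp hp']
      simpa only [Function.comp_apply, hi] using h2.comp (Equiv.swap p p')
    all_goals simpa only [Function.comp_apply, hi]
  obtain ⟨σ, hσ, hστ, hbase⟩ : ∃ σ : Config N, (marks 1 σ).card = N / 2 ∧
      σ (lastSite N) = τ (lastSite N) ∧ ∀ z ∈ Z, (if σ (lastSite N) = 0 then 1 else
        -ε * br (q ^ 2 * z (lastSite N) / β) / br (β * q * z (lastSite N))) * psiVec q β z σ =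
        psiVec q β (Function.update z (lastSite N) (ε * (q ^ 3 * z (lastSite N))⁻¹)) σ := by
    by_cases hτl : τ (lastSite N) = 0
    · obtain ⟨σ, hσ, hσ1, hσ0⟩ := exists_card_marks (N := N) (Nat.div_le_self N 2)
      have hσl : σ (lastSite N) = 0 := by
        rw [hσ0]; simp only [lastSite]; omega
      refine ⟨σ, hσ, hσl.trans hτl.symm, fun z hz => ?_⟩
      rw [if_pos hσl, one_mul, psiVec, psiVec,
        phiVec_eq_extremal hq _ (Nat.div_le_self N 2) hz.1 hσ1,
        phiVec_eq_extremal hq _ (Nat.div_le_self N 2) hz.2.1 hσ1,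
        extremal_update_last hq0 hε2 _ (by omega) hz.1.ne]
    · have hτl' : τ (lastSite N) = 1 := by
        generalize τ (lastSite N) = t at hτl; revert t; decide
      obtain ⟨m, hm⟩ : ∃ m, N / 2 = m + 1 := by
        refine Nat.exists_eq_succ_of_ne_zero ?_
        rw [← hτ, Finset.card_ne_zero]
        exact ⟨_, mem_marks.2 hτl'⟩
      have hmN : m < N := by omega
      let σ : Config N := fun k => if (k : ℕ) < m ∨ k = lastSite N then 1 else 0
      have hσ1 : ∀ k, σ k = 1 ↔ (k : ℕ) < m ∨ k = lastSite N := by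
        intro k
        simp only [σ]
        split_ifs with h <;> simp [h]
      have hσl : σ (lastSite N) = 1 := (hσ1 _).2 (Or.inr rfl)
      refine ⟨σ, hm ▸ card_marks_eq (strictMono_snoc_castLE hmN).injective
        (fun k => (hσ1 k).trans (exists_snoc_castLE_iff hmN.le _ k).symm), hσl.trans hτl'.symm,
        fun z hz => ?_⟩
      obtain ⟨h1, h2, h3, h4⟩ := hz
      rw [psiVec, psiVec, hm, phiVec_eq_phi_snoc q _ hmN _ hσ1, phiVec_eq_phi_snoc q _ hmN _ hσ1,
        hσl, if_neg (by decide)]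
      -- C and C' are the numerator and denominator of the reflection factor, up to the sign -ε. The
      -- root of p is the value of tau at the zeros of [βy]. As deg p ≤ 1 and m = ⌊N/2⌋ - 1, the
      -- degree condition becomes 2⌊N/2⌋ ≤ N.
      have key := phi_snoc_last_update hq0 hq hε (fun w => br (β * w)) hmN h1 h2 h4
        (C := br (q ^ 2 * z (lastSite N) / β)) (C' := -ε * br (β * q * z (lastSite N)))
        (p := Polynomial.C (br (q ^ 3 * z (lastSite N) * z (lastSite N))) *
          (Polynomial.X - Polynomial.C (β ^ 2 / q ^ 2 + q ^ 2 / β ^ 2))) ?_ ?_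
      · rw [div_mul_eq_mul_div, div_eq_iff h3]
        linear_combination (-ε) * key + br (β * q * z (lastSite N)) *
          phi q (fun w => br (β * w)) (Fin.snoc (Fin.castLE hmN.le) (lastSite N)) (Function.update z
            (lastSite N) (ε * (q ^ 3 * z (lastSite N))⁻¹)) * hε2
      · have := Polynomial.natDegree_C_mul_le (br (q ^ 3 * z (lastSite N) * z (lastSite N)))
          (Polynomial.X - Polynomial.C (β ^ 2 / q ^ 2 + q ^ 2 / β ^ 2))
        rw [Polynomial.natDegree_X_sub_C] at this
        omega
      · intro y hy
        have hy0 : y ≠ 0 := by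
          rcases hy with rfl | ⟨k, rfl⟩
          · simpa using h2.ne (lastSite N)
          · exact h1.ne k
        have := h1.ne (lastSite N)
        simp only [Polynomial.eval_mul, Polynomial.eval_C, Polynomial.eval_sub, Polynomial.eval_X]
        have e : ε * (-ε * br (β * q * z (lastSite N))) = -br (β * q * z (lastSite N)) := by
          linear_combination (-br (β * q * z (lastSite N))) * hε2
        rw [e]
        simp only [br, tau]; field_simp; ring
  exact reflection_of_component hq0 hrange (f := fun t y => if t = 0 then 1 else
    -ε * br (q ^ 2 * y / β) / br (β * q * y)) (g := fun y => ε * (q ^ 3 * y)⁻¹)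
    hZ hswap (hσ.trans hτ.symm) hστ hbase z ⟨hz, hz', hβz, hY⟩

/-- A down spin at site 1 is visible in the extremal product. For an up spin at site 1 the dual form
is used, in which the inversion of z_1 is a reflection of the last variable. -/
theorem psiVec_reflect_first {q β c : ℂ} (hq0 : q ≠ 0) (hq : br q ≠ 0) (hc : c ^ 2 * q ^ 3 = -1)
    {N : ℕ} [NeZero N] {z : Fin N → ℂ} (hz : Good q z)
    (hz' : Good q (Function.update z (firstSite N) (z (firstSite N))⁻¹))
    (hy : Good q (dual c z))
    (hy' : Good q (dual c (Function.update z (firstSite N) (z (firstSite N))⁻¹)))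
    (hβz : ∀ j, br (β * z j) ≠ 0) (hβz' : br (β * (z (firstSite N))⁻¹) ≠ 0)
    (hz1 : br (z (firstSite N) * z (firstSite N)) ≠ 0) (τ : Config N) :
    (if τ (firstSite N) = 0 then 1 else
      br (β * (z (firstSite N))⁻¹) / br (β * z (firstSite N))) * psiVec q β z τ =
      psiVec q β (Function.update z (firstSite N) (z (firstSite N))⁻¹) τ := by
  by_cases hτ : (marks 1 τ).card = N / 2
  swap
  · rw [psiVec_of_card_ne q β _ hτ, psiVec_of_card_ne q β _ hτ, mul_zero]
  have hc0 : c ≠ 0 := by rintro rfl; simp at hc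
  have hN : 0 < N := Nat.pos_of_ne_zero (NeZero.ne N)
  have hrange : ∀ k : Fin N, (k : ℕ) < 1 ∨ N < (k : ℕ) ↔ k = firstSite N := by
    intro k
    have := k.isLt
    simp only [firstSite, Fin.ext_iff, Fin.val_zero]
    omega
  set Z : Set (Fin N → ℂ) := {z | Good q z ∧
    Good q (Function.update z (firstSite N) (z (firstSite N))⁻¹) ∧ Good q (dual c z) ∧
    Good q (dual c (Function.update z (firstSite N) (z (firstSite N))⁻¹)) ∧
    (∀ j, br (β * z j) ≠ 0) ∧ br (β * (z (firstSite N))⁻¹) ≠ 0 ∧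
    br (z (firstSite N) * z (firstSite N)) ≠ 0}
  have hdual : ∀ (z : Fin N → ℂ) (π : Equiv.Perm (Fin N)), Good q (dual c z) →
      Good q (dual c (z ∘ π)) := by
    intro z π h
    have : dual c (z ∘ π) = dual c z ∘ (Fin.revPerm.trans (π.trans Fin.revPerm)) := by
      funext j; simp [dual]
    rw [this]
    exact h.comp _
  have hswap : ∀ z ∈ Z, ∀ p p', p ≠ firstSite N → p' ≠ firstSite N →
      z ∘ Equiv.swap p p' ∈ Z := by
    rintro z ⟨h1, h2, h3, h4, h5, h6, h7⟩ p p' hp hp'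
    have hi : Equiv.swap p p' (firstSite N) = firstSite N :=
      Equiv.swap_apply_of_ne_of_ne hp.symm hp'.symm
    refine ⟨h1.comp _, ?_, hdual _ _ h3, ?_, fun j => h5 _, ?_, ?_⟩
    · rw [update_comp_swap z hp hp']
      simpa only [Function.comp_apply, hi] using h2.comp (Equiv.swap p p')
    · rw [update_comp_swap z hp hp']
      simpa only [Function.comp_apply, hi] using hdual _ (Equiv.swap p p') h4
    all_goals simpa only [Function.comp_apply, hi]
  obtain ⟨σ, hσ, hστ, hbase⟩ : ∃ σ : Config N, (marks 1 σ).card = N / 2 ∧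
      σ (firstSite N) = τ (firstSite N) ∧ ∀ z ∈ Z, (if σ (firstSite N) = 0 then 1 else
        br (β * (z (firstSite N))⁻¹) / br (β * z (firstSite N))) * psiVec q β z σ =
        psiVec q β (Function.update z (firstSite N) (z (firstSite N))⁻¹) σ := by
    by_cases hτl : τ (firstSite N) = 0
    -- Up spins at site 1 and at the far right: reversed, they occupy the first m sites and the last
    -- one.
    · let σ : Config N := fun k => if k = firstSite N ∨ N / 2 < (k : ℕ) then 0 else 1
      have hσ0 : ∀ k, σ k = 0 ↔ k = firstSite N ∨ N / 2 < (k : ℕ) := by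
        intro k
        simp only [σ]
        split_ifs with h <;> simp [h]
      have hσl : σ (firstSite N) = 0 := (hσ0 _).2 (Or.inl rfl)
      obtain ⟨m, hm⟩ : ∃ m, (N + 1) / 2 = m + 1 := ⟨(N + 1) / 2 - 1, by omega⟩
      have hmN : m < N := by omega
      have hσr : ∀ k, (σ ∘ Fin.rev) k = 0 ↔ (k : ℕ) < m ∨ k = lastSite N := by
        intro k
        have := k.isLt
        rw [Function.comp, hσ0]
        simp only [firstSite, lastSite, Fin.ext_iff, Fin.val_zero, Fin.val_rev]
        omega
      have hcard : (marks 1 σ).card = N / 2 := by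
        have h1 : (marks 0 (σ ∘ Fin.rev)).card = m + 1 :=
          card_marks_eq (strictMono_snoc_castLE hmN).injective
            (fun k => (hσr k).trans (exists_snoc_castLE_iff hmN.le _ k).symm)
        have h2 := card_marks_comp 0 σ Fin.revPerm
        have h3 := card_marks_zero_add σ
        change (marks 0 (σ ∘ Fin.rev)).card = _ at h2
        omega
      refine ⟨σ, hcard, hσl.trans hτl.symm, fun z hz => ?_⟩
      obtain ⟨h1, h2, h3, h4, h5, h6, h7⟩ := hz
      have h5' : ∀ j, br (β * Function.update z (firstSite N) (z (firstSite N))⁻¹ j) ≠ 0 := by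
        intro j
        by_cases hj : j = firstSite N
        · rwa [hj, Function.update_self]
        · rw [Function.update_of_ne hj]; exact h5 j
      set x := z (firstSite N) with hx
      have hx0 : x ≠ 0 := h1.ne _
      have hlast : dual c z (lastSite N) = c / x := by
        have : (lastSite N).rev = firstSite N := by
          ext; rw [Fin.val_rev]; simp only [lastSite, firstSite, Fin.val_zero]; omega
        rw [dual, this]
      -- By c²q³ = -1 the inversion x ↦ x⁻¹ acts on the dual variable Y = c/x as Y ↦ -1/(q³Y), the
      -- case ε = -1.
      have hcx : c * x = -1 * (q ^ 3 * dual c z (lastSite N))⁻¹ := by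
        rw [hlast]; field_simp; linear_combination hc
      have hupd : dual c (Function.update z (firstSite N) x⁻¹) =
          Function.update (dual c z) (lastSite N) (-1 * (q ^ 3 * dual c z (lastSite N))⁻¹) := by
        rw [← hcx]
        funext j
        by_cases hj : j = lastSite N
        · have : (lastSite N).rev = firstSite N := by
            ext; rw [Fin.val_rev]; simp only [lastSite, firstSite, Fin.val_zero]; omega
          rw [hj, Function.update_self, dual, this, Function.update_self, div_inv_eq_mul]
        · rw [Function.update_of_ne hj, dual, dual, Function.update_of_ne]
          intro e
          apply hj
          have := congrArg Fin.val e
          have := j.isLt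
          rw [Fin.val_rev] at *
          ext
          simp only [lastSite, firstSite, Fin.val_zero] at *
          omega
      have hY : br (q ^ 3 * dual c z (lastSite N) * dual c z (lastSite N)) ≠ 0 := by
        have : q ^ 3 * dual c z (lastSite N) * dual c z (lastSite N) = -(x * x)⁻¹ := by
          rw [hlast]; field_simp; linear_combination hc
        rw [this, br_neg, br_inv, neg_neg]
        exact h7
      have hprod : br (β * x) * ∏ i, br (β * Function.update z (firstSite N) x⁻¹ i) =
          br (β * x⁻¹) * ∏ i, br (β * z i) := by
        rw [← Finset.mul_prod_erase Finset.univ (fun i => br (β * Function.update z _ _ i))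
          (Finset.mem_univ (firstSite N)), ← Finset.mul_prod_erase Finset.univ
          (fun i => br (β * z i)) (Finset.mem_univ (firstSite N)), Function.update_self,
          Finset.prod_congr rfl fun i hi => by
            rw [Function.update_of_ne (Finset.ne_of_mem_erase hi)]]
        ring
      rw [if_pos hσl, one_mul, psiVec_eq_dualVec hq0 hq hc h1 h3 h5,
        psiVec_eq_dualVec hq0 hq hc h2 h4 h5', dualVec, dualVec, hm,
        phiVec_eq_phi_snoc q _ hmN _ hσr, phiVec_eq_phi_snoc q _ hmN _ hσr]
      rw [hupd] at h4 ⊢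
      -- Here [βx][q³Yy] - [βx⁻¹][Y/y] is a constant multiple of [βc/y], so p is constant. Degree 0
      -- is what m = ⌈N/2⌉ - 1 allows: 2⌈N/2⌉ - 1 ≤ N.
      have key := phi_snoc_last_update hq0 hq (Or.inr rfl) (dualB β c) hmN h3 h4 hY
        (C := br (β * x)) (C' := br (β * x⁻¹))
        (p := Polynomial.C (br (q ^ 3 * dual c z (lastSite N) * dual c z (lastSite N)))) ?_ ?_
      · refine mul_left_cancel₀ (h5 (firstSite N)) ?_
        rw [← hx]
        linear_combination (∏ i, br (β * z i)) * key -
          phi q (dualB β c) (Fin.snoc (Fin.castLE hmN.le) (lastSite N)) (Function.update (dual c z)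
            (lastSite N) (-1 * (q ^ 3 * dual c z (lastSite N))⁻¹)) * hprod
      · rw [Polynomial.natDegree_C]; omega
      · intro y hy
        have hy0 : y ≠ 0 ∧ br (β * c / y) ≠ 0 := by
          rcases hy with rfl | ⟨k, rfl⟩
          · rw [← hcx]
            refine ⟨mul_ne_zero hc0 hx0, ?_⟩
            have : β * c / (c * x) = β * x⁻¹ := by field_simp
            rwa [this]
          · refine ⟨h3.ne k, ?_⟩
            have := h1.ne k.rev
            have : β * c / dual c z k = β * z k.rev := by rw [dual]; field_simp
            rw [this]
            exact h5 _
        rw [Polynomial.eval_C, dualB, hlast]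
        have hy1 := hy0.1
        have e1 : br (β * x⁻¹) = -br (β * c * q ^ 3 * (c / x)) := by
          rw [← br_neg, (by ring : -(β * c * q ^ 3 * (c / x)) = β * x⁻¹ * -(c ^ 2 * q ^ 3)), hc,
            neg_neg, mul_one]
        rw [e1, inv_mul_eq_iff_eq_mul₀ hy0.2]
        have e2 : β * x = β * c / (c / x) := by field_simp
        have hcx0 : c / x ≠ 0 := div_ne_zero hc0 hx0
        by_cases hβ0 : β = 0
        · simp [hβ0, br]
        rw [e2]
        generalize c / x = Y at *
        simp only [br]; field_simp; ring
    · have hτl' : τ (firstSite N) = 1 := by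
        generalize τ (firstSite N) = t at hτl; revert t; decide
      have hn : 0 < N / 2 := by
        rw [← hτ, Finset.card_pos]
        exact ⟨_, mem_marks.2 hτl'⟩
      obtain ⟨σ, hσ, hσ1, -⟩ := exists_card_marks (N := N) (Nat.div_le_self N 2)
      have hσl : σ (firstSite N) = 1 := (hσ1 _).2 hn
      refine ⟨σ, hσ, hσl.trans hτl'.symm, fun z hz => ?_⟩
      obtain ⟨h1, h2, -, -, h5, -, -⟩ := hz
      rw [psiVec, psiVec, phiVec_eq_extremal hq _ (Nat.div_le_self N 2) h1 hσ1,
        phiVec_eq_extremal hq _ (Nat.div_le_self N 2) h2 hσ1, hσl, if_neg (by decide),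
        div_mul_eq_mul_div, div_eq_iff (h5 _), mul_comm (extremal _ _ _ _)]
      exact (extremal_update_first (fun w => br (β * w)) hn z).symm
  exact reflection_of_component hq0 hrange (f := fun t y => if t = 0 then 1 else
    br (β * y⁻¹) / br (β * y)) (g := fun y => y⁻¹) (fun z hz => ⟨hz.1, hz.2.1⟩) hswap
    (hσ.trans hτ.symm) hστ hbase z ⟨hz, hz', hy, hy', hβz, hβz', hz1⟩

/-! ### Approximation by points satisfying more conditions -/

open Filter Topology

theorem eventually_pow_ne {n : ℕ} (hn : 0 < n) (c : ℂ) : ∀ᶠ t in 𝓝[≠] (1 : ℂ), t ^ n ≠ c := by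
  have hfin : {t : ℂ | t ^ n = c}.Finite := by
    refine (Polynomial.nthRoots n c).toFinset.finite_toSet.subset fun t ht => ?_
    simpa [Polynomial.mem_nthRoots hn] using ht
  have hmem : ({t : ℂ | t ^ n = c} \ {1})ᶜ ∈ 𝓝 (1 : ℂ) :=
    (hfin.subset Set.sdiff_subset).isClosed.isOpen_compl.mem_nhds (by simp)
  filter_upwards [nhdsWithin_le_nhds hmem, self_mem_nhdsWithin] with t h1 h2 h3
  exact h1 ⟨h3, h2⟩

theorem eventually_ne_zero : ∀ᶠ t in 𝓝[≠] (1 : ℂ), t ≠ 0 :=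
  nhdsWithin_le_nhds (isOpen_ne.mem_nhds one_ne_zero)

theorem eventually_br_ne {a : ℂ} (ha : a ≠ 0) {e : ℤ} (he : e ≠ 0) :
    ∀ᶠ t in 𝓝[≠] (1 : ℂ), br (a * t ^ e) ≠ 0 := by
  have hn : 0 < e.natAbs * 2 := by omega
  filter_upwards [eventually_pow_ne hn ((a ^ 2)⁻¹), eventually_pow_ne hn (a ^ 2),
    eventually_ne_zero] with t h1 h2 ht h
  have h3 : (a * t ^ e) ^ 2 = 1 := by
    rcases (br_eq_zero_iff (mul_ne_zero ha (zpow_ne_zero _ ht))).1 h with h | h <;> simp [h]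
  rw [mul_pow] at h3
  rcases Int.natAbs_eq e with he' | he'
  · apply h1
    rw [he', zpow_natCast, ← pow_mul] at h3
    exact eq_inv_of_mul_eq_one_right h3
  · apply h2
    rw [he', zpow_neg, zpow_natCast, inv_pow, ← pow_mul] at h3
    exact (eq_of_mul_inv_eq_one h3).symm

/-- If the exponents are nonzero and pairwise distinct up to sign, every bracket is [a t^e] with e ≠
0 and has finitely many zeros t; t = 1 may be one, hence the punctured neighbourhood. The only
constant bracket is [q z_j/z_j] = [q]. -/
theorem eventually_good {q : ℂ} (hq0 : q ≠ 0) (hq : br q ≠ 0) {N : ℕ} {a : Fin N → ℂ}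
    (ha : ∀ j, a j ≠ 0) {e : Fin N → ℤ} (he : ∀ j, e j ≠ 0)
    (hinj : ∀ j k, j ≠ k → e j ≠ e k ∧ e j ≠ -e k) {w : ℂ → Fin N → ℂ}
    (hw : ∀ t ≠ 0, ∀ j, w t j = a j * t ^ e j) : ∀ᶠ t in 𝓝[≠] (1 : ℂ), Good q (w t) := by
  have h1 : ∀ᶠ t in 𝓝[≠] (1 : ℂ), ∀ j k, j ≠ k → br (a j / a k * t ^ (e j - e k)) ≠ 0 ∧
      br (q * a j / a k * t ^ (e j - e k)) ≠ 0 := by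
    refine eventually_all.2 fun j => eventually_all.2 fun k => ?_
    by_cases hjk : j = k
    · exact Eventually.of_forall fun t h => absurd hjk h
    · have h0 : e j - e k ≠ 0 := sub_ne_zero.2 (hinj j k hjk).1
      exact ((eventually_br_ne (div_ne_zero (ha j) (ha k)) h0).and (eventually_br_ne
        (div_ne_zero (mul_ne_zero hq0 (ha j)) (ha k)) h0)).mono fun t h _ => h
  have h2 : ∀ᶠ t in 𝓝[≠] (1 : ℂ), ∀ j k, br (q ^ 2 * a j * a k * t ^ (e j + e k)) ≠ 0 := by
    refine eventually_all.2 fun j => eventually_all.2 fun k => eventually_br_ne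
      (mul_ne_zero (mul_ne_zero (pow_ne_zero 2 hq0) (ha j)) (ha k)) ?_
    by_cases hjk : j = k
    · have := he k; rw [hjk]; omega
    · have := (hinj j k hjk).2; omega
  filter_upwards [h1, h2, eventually_ne_zero] with t h1 h2 ht
  have hd : ∀ j k, w t j / w t k = a j / a k * t ^ (e j - e k) := by
    intro j k
    rw [hw t ht, hw t ht, zpow_sub₀ ht, mul_div_mul_comm]
  refine ⟨fun j => ?_, fun j k hjk => ?_, fun j k => ?_, fun j k => ?_⟩
  · rw [hw t ht]
    exact mul_ne_zero (ha j) (zpow_ne_zero _ ht)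
  · rw [hd]
    exact (h1 j k hjk).1
  · rw [mul_div_assoc, hd]
    by_cases hjk : j = k
    · rw [hjk, div_self (ha k), sub_self, zpow_zero, mul_one, mul_one]
      exact hq
    · rw [← mul_assoc, ← mul_div_assoc]
      exact (h1 j k hjk).2
  · have : q ^ 2 * w t j * w t k = q ^ 2 * a j * a k * t ^ (e j + e k) := by
      rw [hw t ht, hw t ht, zpow_add₀ ht]; ring
    rw [this]
    exact h2 j k

/-- A path through `z` with distinct exponents. -/
def path {N : ℕ} (z : Fin N → ℂ) (t : ℂ) : Fin N → ℂ := fun j => z j * t ^ ((j : ℤ) + 1)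

theorem tendsto_path {N : ℕ} (z : Fin N → ℂ) : Tendsto (path z) (𝓝[≠] 1) (𝓝 z) := by
  have : ContinuousAt (path z) 1 := by
    refine continuousAt_pi.2 fun j => ?_
    exact continuousAt_const.mul (continuousAt_zpow₀ _ _ (Or.inl one_ne_zero))
  have h1 : path z 1 = z := by funext j; simp [path]
  have h := this.tendsto
  rw [h1] at h
  exact h.mono_left nhdsWithin_le_nhds

/-- This removes auxiliary conditions: they hold on the path near t = 1, and the identity itself
passes to the limit. -/
theorem eq_of_eventually_path {N : ℕ} {z : Fin N → ℂ} {F G : (Fin N → ℂ) → ℂ}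
    (hF : ContinuousAt F z) (hG : ContinuousAt G z)
    (h : ∀ᶠ t in 𝓝[≠] (1 : ℂ), F (path z t) = G (path z t)) : F z = G z :=
  tendsto_nhds_unique_of_eventuallyEq (hF.tendsto.comp (tendsto_path z))
    (hG.tendsto.comp (tendsto_path z)) h

theorem eventually_good_path {q : ℂ} (hq0 : q ≠ 0) (hq : br q ≠ 0) {N : ℕ} {z : Fin N → ℂ}
    (hz : ∀ j, z j ≠ 0) : ∀ᶠ t in 𝓝[≠] (1 : ℂ), Good q (path z t) :=
  eventually_good hq0 hq hz (e := fun j => (j : ℤ) + 1) (fun j => by omega)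
    (fun j k hjk => by have := Fin.val_ne_of_ne hjk; omega) fun _ _ _ => rfl

theorem update_path_inv {N : ℕ} (z : Fin N → ℂ) (i : Fin N) (s t : ℂ) (j : Fin N) :
    Function.update (path z t) i (s * (path z t i)⁻¹) j =
      Function.update z i (s * (z i)⁻¹) j *
        t ^ Function.update (fun j : Fin N => (j : ℤ) + 1) i (-((i : ℤ) + 1)) j := by
  by_cases hj : j = i
  · rw [hj, Function.update_self, Function.update_self, Function.update_self, path, mul_inv,
      zpow_neg, mul_assoc]
  · rw [Function.update_of_ne hj, Function.update_of_ne hj, Function.update_of_ne hj, path]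

theorem update_exponent_ne {N : ℕ} (i : Fin N) (j : Fin N) :
    Function.update (fun j : Fin N => (j : ℤ) + 1) i (-((i : ℤ) + 1)) j = (j : ℤ) + 1 ∨
    Function.update (fun j : Fin N => (j : ℤ) + 1) i (-((i : ℤ) + 1)) j = -((j : ℤ) + 1) := by
  by_cases hj : j = i
  · rw [hj, Function.update_self]; exact Or.inr rfl
  · rw [Function.update_of_ne hj]; exact Or.inl rfl

theorem update_ne_zero {N : ℕ} {z : Fin N → ℂ} (hz : ∀ j, z j ≠ 0) (i : Fin N) {w : ℂ} (hw : w ≠ 0)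
    (j : Fin N) : Function.update z i w j ≠ 0 := by
  by_cases hj : j = i
  · rwa [hj, Function.update_self]
  · rw [Function.update_of_ne hj]; exact hz j

/-- Reflecting the i-th variable changes its exponent i + 1 to -(i + 1), so the exponents remain
distinct up to sign. -/
theorem eventually_good_update_path {q : ℂ} (hq0 : q ≠ 0) (hq : br q ≠ 0) {N : ℕ} {z : Fin N → ℂ}
    (hz : ∀ j, z j ≠ 0) (i : Fin N) {s : ℂ} (hs : s ≠ 0) :
    ∀ᶠ t in 𝓝[≠] (1 : ℂ), Good q (Function.update (path z t) i (s * (path z t i)⁻¹)) := by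
  refine eventually_good hq0 hq (update_ne_zero hz i (mul_ne_zero hs (inv_ne_zero (hz i))))
    (fun j => ?_) (fun j k hjk => ?_) fun t _ j => update_path_inv z i s t j
  · have := update_exponent_ne i j; omega
  · have := update_exponent_ne i j
    have := update_exponent_ne i k
    have := Fin.val_ne_of_ne hjk
    omega

theorem eventually_good_dual_path {q c : ℂ} (hq0 : q ≠ 0) (hq : br q ≠ 0) (hc : c ≠ 0) {N : ℕ}
    {z : Fin N → ℂ} (hz : ∀ j, z j ≠ 0) : ∀ᶠ t in 𝓝[≠] (1 : ℂ), Good q (dual c (path z t)) := by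
  refine eventually_good hq0 hq (a := dual c z) (fun j => div_ne_zero hc (hz _))
    (e := fun j => -((j.rev : ℤ) + 1)) (fun j => by omega) (fun j k hjk => ?_) fun t _ j => ?_
  · have := Fin.val_ne_of_ne (Fin.rev_injective.ne hjk); omega
  · rw [dual, dual, path, zpow_neg, div_mul_eq_div_div, div_eq_mul_inv]

theorem eventually_good_dual_update_path {q c : ℂ} (hq0 : q ≠ 0) (hq : br q ≠ 0) (hc : c ≠ 0)
    {N : ℕ} {z : Fin N → ℂ} (hz : ∀ j, z j ≠ 0) (i : Fin N) {s : ℂ} (hs : s ≠ 0) :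
    ∀ᶠ t in 𝓝[≠] (1 : ℂ),
      Good q (dual c (Function.update (path z t) i (s * (path z t i)⁻¹))) := by
  refine eventually_good hq0 hq (a := dual c (Function.update z i (s * (z i)⁻¹)))
    (fun j => div_ne_zero hc (update_ne_zero hz i (mul_ne_zero hs (inv_ne_zero (hz i))) _))
    (e := fun j => -Function.update (fun j : Fin N => (j : ℤ) + 1) i (-((i : ℤ) + 1)) j.rev)
    (fun j => ?_) (fun j k hjk => ?_) fun t _ j => ?_
  · have := update_exponent_ne i j.rev; omega
  · have := update_exponent_ne i j.rev
    have := update_exponent_ne i k.rev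
    have := Fin.val_ne_of_ne (Fin.rev_injective.ne hjk)
    omega
  · rw [dual, dual, update_path_inv z i s t, zpow_neg, div_mul_eq_div_div, div_eq_mul_inv]

/-! ### Continuity -/

theorem differentiableAt_phi {q β : ℂ} (hq0 : q ≠ 0) (hβ : β ≠ 0) {N n : ℕ} (a : Fin n → Fin N)
    {z : Fin N → ℂ} (hz : Good q z) :
    DifferentiableAt ℂ (fun z => phi q (fun w => br (β * w)) a z) z := by
  have hq2 : q ^ 2 ≠ 0 := pow_ne_zero 2 hq0
  have d1 : ∀ j k : Fin N, DifferentiableAt ℂ (fun z : Fin N → ℂ => br (z j / z k)) z := fun j k =>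
    DifferentiableAt.br_div (by fun_prop) (by fun_prop) (hz.ne j) (hz.ne k)
  have dq : ∀ j k : Fin N, DifferentiableAt ℂ (fun z : Fin N → ℂ => br (q * z j / z k)) z :=
    fun j k => DifferentiableAt.br_div (by fun_prop) (by fun_prop) (mul_ne_zero hq0 (hz.ne j))
      (hz.ne k)
  have dm : ∀ j k : Fin N, DifferentiableAt ℂ (fun z : Fin N → ℂ => br (q * z j * z k)) z :=
    fun j k => DifferentiableAt.br (by fun_prop)
      (mul_ne_zero (mul_ne_zero hq0 (hz.ne j)) (hz.ne k))
  have dmm : ∀ j k : Fin N, DifferentiableAt ℂ (fun z : Fin N → ℂ => br (q ^ 2 * z j * z k)) z :=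
    fun j k => DifferentiableAt.br (by fun_prop)
      (mul_ne_zero (mul_ne_zero hq2 (hz.ne j)) (hz.ne k))
  have dβ : ∀ j : Fin N, DifferentiableAt ℂ (fun z : Fin N → ℂ => br (β * z j)) z := fun j =>
    DifferentiableAt.br (by fun_prop) (mul_ne_zero hβ (hz.ne j))
  unfold phi pref num siteWeight numAt den resWeight pairProd
  refine DifferentiableAt.mul (DifferentiableAt.mul (by fun_prop) ?_) (DifferentiableAt.fun_sum
    fun κ _ => DifferentiableAt.mul (DifferentiableAt.mul ?_ ?_) ?_)
  · exact DifferentiableAt.prod_of_forall fun i _ => DifferentiableAt.prod_of_forall fun j _ =>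
      (dq _ _).mul (dmm _ _)
  · exact DifferentiableAt.prod_of_forall fun i _ => DifferentiableAt.prod_of_forall fun j _ =>
      ((dq _ _).mul (d1 _ _)).mul ((dm _ _).mul (dmm _ _))
  · exact DifferentiableAt.prod_of_forall fun i _ => (dmm _ _).mul (dβ _)
  · refine DifferentiableAt.prod_of_forall fun l _ => DifferentiableAt.mul
      (DifferentiableAt.div_of_ne (DifferentiableAt.mul ?_ ?_) ?_ ?_)
        (DifferentiableAt.fun_inv ?_ ?_)
    · exact DifferentiableAt.prod_of_forall fun j _ => d1 _ _
    · exact DifferentiableAt.prod_of_forall fun j _ => dq _ _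
    · exact DifferentiableAt.prod_of_forall fun j _ => (dq _ _).mul (dmm _ _)
    · exact Finset.prod_ne_zero_iff.2 fun j _ => mul_ne_zero (hz.qbr_ne _ _) (hz.qqbr_ne _ _)
    · exact DifferentiableAt.prod_of_forall fun j _ => d1 _ _
    · exact Finset.prod_ne_zero_iff.2 fun j hj => hz.br_ne _ _ (Finset.ne_of_mem_erase hj)

theorem continuousAt_psiVec {q β : ℂ} (hq0 : q ≠ 0) (hβ : β ≠ 0) {N : ℕ} {z : Fin N → ℂ}
    (hz : Good q z) (σ : Config N) : ContinuousAt (fun z => psiVec q β z σ) z := by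
  unfold psiVec phiVec
  by_cases h : (marks 1 σ).card = N / 2
  · simp only [dif_pos h]
    exact (differentiableAt_phi hq0 hβ _ hz).continuousAt
  · simp only [dif_neg h]
    exact continuousAt_const

theorem continuousAt_psiVec_update {q β : ℂ} (hq0 : q ≠ 0) (hβ : β ≠ 0) {N : ℕ} {z : Fin N → ℂ}
    {i : Fin N} {g : (Fin N → ℂ) → ℂ} (hg : ContinuousAt g z)
    (hz : Good q (Function.update z i (g z))) (σ : Config N) :
    ContinuousAt (fun z => psiVec q β (Function.update z i (g z)) σ) z :=
  ContinuousAt.comp (f := fun z => Function.update z i (g z)) (continuousAt_psiVec hq0 hβ hz σ)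
    (continuousAt_id.update i hg)

/-! ### The reflection relations -/

/-- `psiVec_reflect_first` also asks that the dual points be good and that several brackets be
nonzero. These conditions hold on the path, while both sides are continuous at z under the present
hypotheses. -/
theorem psiVec_leftReflection {q β : ℂ} (hq0 : q ≠ 0) (hq : br q ≠ 0) (hβ : β ≠ 0) {N : ℕ}
    [NeZero N] {z : Fin N → ℂ} (hz : Good q z)
    (hz' : Good q (Function.update z (firstSite N) (z (firstSite N))⁻¹))
    (hK : KRegular (z (firstSite N))⁻¹ β) :
    leg₁ (firstSite N) (K (z (firstSite N))⁻¹ β) *ᵥ psiVec q β z =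
      psiVec q β (Function.update z (firstSite N) (z (firstSite N))⁻¹) := by
  obtain ⟨c, hc⟩ := exists_dual_constant hq0
  have hc0 : c ≠ 0 := by rintro rfl; simp at hc
  have hz0 := hz.ne (firstSite N)
  rw [KRegular, div_inv_eq_mul] at hK
  funext τ
  rw [leg₁_K_mulVec, div_inv_eq_mul]
  refine eq_of_eventually_path (z := z)
    (F := fun z => (if τ (firstSite N) = 0 then 1 else
      br (β * (z (firstSite N))⁻¹) / br (β * z (firstSite N))) * psiVec q β z τ)
    (G := fun z => psiVec q β (Function.update z (firstSite N) (z (firstSite N))⁻¹) τ) ?_ ?_ ?_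
  · refine ContinuousAt.mul ?_ (continuousAt_psiVec hq0 hβ hz τ)
    split_ifs
    · exact continuousAt_const
    · refine ContinuousAt.div (ContinuousAt.br ?_ (mul_ne_zero hβ (inv_ne_zero hz0)))
        (ContinuousAt.br (continuousAt_const.mul (continuousAt_apply _ _)) (mul_ne_zero hβ hz0)) hK
      exact continuousAt_const.mul ((continuousAt_apply _ _).inv₀ hz0)
  · exact continuousAt_psiVec_update hq0 hβ ((continuousAt_apply _ _).inv₀ hz0) hz' τ
  · have e1 := eventually_good_update_path hq0 hq hz.ne (firstSite N) one_ne_zero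
    have e2 := eventually_good_dual_update_path hq0 hq hc0 hz.ne (firstSite N) one_ne_zero
    simp only [one_mul] at e1 e2
    filter_upwards [eventually_good_path hq0 hq hz.ne, e1, eventually_good_dual_path hq0 hq hc0 hz.ne,
      e2, eventually_all.2 fun j : Fin N => eventually_br_ne (mul_ne_zero hβ (hz.ne j))
        (by omega : (j : ℤ) + 1 ≠ 0),
      eventually_br_ne (mul_ne_zero hβ (inv_ne_zero hz0))
        (by omega : -(((firstSite N : Fin N) : ℤ) + 1) ≠ 0),
      eventually_br_ne (mul_ne_zero hz0 hz0)
        (by omega : (((firstSite N : Fin N) : ℤ) + 1) + (((firstSite N : Fin N) : ℤ) + 1) ≠ 0),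
      eventually_ne_zero] with t h1 h2 h3 h4 h5 h6 h7 ht
    refine psiVec_reflect_first hq0 hq hc h1 h2 h3 h4 (fun j => ?_) ?_ ?_ τ
    · rw [path, ← mul_assoc]; exact h5 j
    · rw [path, mul_inv, ← mul_assoc, ← zpow_neg]; exact h6
    · rw [path, mul_mul_mul_comm, ← zpow_add₀ ht]; exact h7

theorem br_mul_of_sign {ε : ℂ} (hε : ε = 1 ∨ ε = -1) (x : ℂ) : br (ε * x) = ε * br x := by
  rcases hε with rfl | rfl
  · rw [one_mul, one_mul]
  · rw [neg_one_mul, br_neg, neg_one_mul]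

theorem exists_sign {q s : ℂ} (hq0 : q ≠ 0) (hs : s ^ 4 = q ^ 6) :
    ∃ ε : ℂ, (ε = 1 ∨ ε = -1) ∧ s ^ 2 = ε * q ^ 3 := by
  refine ⟨s ^ 2 / q ^ 3, sq_eq_sq_iff_eq_or_eq_neg.1 ?_, by field_simp⟩
  rw [one_pow]
  field_simp
  linear_combination hs

/-- The parameters are fixed up to signs, s² = εq³ and β̄ = δ/(βq). The sign δ cancels in the
K-matrix and ε is the sign of `psiVec_reflect_last`; the extra condition [q³z_N²] ≠ 0 is removed by
the limit. -/
theorem psiVec_rightReflection {q β s βbar : ℂ} (hq0 : q ≠ 0) (hq : br q ≠ 0) (hβ : β ≠ 0)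
    (hs : s ^ 4 = q ^ 6) (hβbar : βbar ^ 2 * β ^ 2 * q ^ 2 = 1) {N : ℕ}
    [NeZero N] {z : Fin N → ℂ} (hz : Good q z)
    (hz' : Good q (Function.update z (lastSite N) (s⁻¹ ^ 2 * (z (lastSite N))⁻¹)))
    (hK : KRegular (s * z (lastSite N)) (s * βbar)) :
    leg₁ (lastSite N) (K (s * z (lastSite N)) (s * βbar)) *ᵥ psiVec q β z =
      psiVec q β (Function.update z (lastSite N) (s⁻¹ ^ 2 * (z (lastSite N))⁻¹)) := by
  have hz0 := hz.ne (lastSite N)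
  have hs0 : s ≠ 0 := by
    rintro rfl
    exact pow_ne_zero 6 hq0 (by rw [← hs]; norm_num)
  obtain ⟨ε, hε, hsε⟩ := exists_sign hq0 hs
  obtain ⟨δ, hδ, hβδ⟩ : ∃ δ : ℂ, (δ = 1 ∨ δ = -1) ∧ βbar = δ * (β * q)⁻¹ := by
    refine ⟨βbar * β * q, sq_eq_sq_iff_eq_or_eq_neg.1 ?_, by field_simp⟩
    rw [one_pow]; linear_combination hβbar
  have hε2 : ε ^ 2 = 1 := by rcases hε with rfl | rfl <;> norm_num
  have hδ0 : δ ≠ 0 := by rcases hδ with rfl | rfl <;> norm_num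
  have hε0 : ε ≠ 0 := by rcases hε with rfl | rfl <;> norm_num
  have hg : ∀ y : ℂ, s⁻¹ ^ 2 * y⁻¹ = ε * (q ^ 3 * y)⁻¹ := by
    intro y
    have : ε⁻¹ = ε := inv_eq_of_mul_eq_one_left (by rw [← sq, hε2])
    rw [inv_pow, hsε, mul_inv, mul_inv, this, mul_assoc]
  have hden : ∀ y : ℂ, y ≠ 0 → br (s * βbar / (s * y)) = -δ * br (β * q * y) := by
    intro y hy
    have : s * βbar / (s * y) = δ * (β * q * y)⁻¹ := by
      rw [hβδ]; field_simp
    rw [this, br_mul_of_sign hδ, br_inv]; ring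
  have hnum : ∀ y : ℂ, br (s * βbar * (s * y)) = ε * (δ * br (q ^ 2 * y / β)) := by
    intro y
    have : s * βbar * (s * y) = ε * (δ * (q ^ 2 * y / β)) := by
      rw [(by ring : s * βbar * (s * y) = s ^ 2 * βbar * y), hsε, hβδ]; field_simp
    rw [this, br_mul_of_sign hε, br_mul_of_sign hδ]
  rw [KRegular, hden _ hz0] at hK
  have hK' := right_ne_zero_of_mul hK
  rw [hg] at hz' ⊢
  have hratio : br (s * βbar * (s * z (lastSite N))) / br (s * βbar / (s * z (lastSite N))) =
      -ε * br (q ^ 2 * z (lastSite N) / β) / br (β * q * z (lastSite N)) := by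
    rw [hden _ hz0, hnum]
    generalize br (β * q * z (lastSite N)) = X at *
    generalize br (q ^ 2 * z (lastSite N) / β) = X'
    field_simp
  have hgc : ContinuousAt (fun z : Fin N → ℂ => ε * (q ^ 3 * z (lastSite N))⁻¹) z :=
    continuousAt_const.mul ((continuousAt_const.mul (continuousAt_apply _ _)).inv₀
      (mul_ne_zero (pow_ne_zero 3 hq0) hz0))
  funext τ
  rw [leg₁_K_mulVec, hratio]
  refine eq_of_eventually_path (z := z)
    (F := fun z => (if τ (lastSite N) = 0 then 1 else
      -ε * br (q ^ 2 * z (lastSite N) / β) / br (β * q * z (lastSite N))) * psiVec q β z τ)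
    (G := fun z => psiVec q β (Function.update z (lastSite N)
      (ε * (q ^ 3 * z (lastSite N))⁻¹)) τ) ?_ ?_ ?_
  · refine ContinuousAt.mul ?_ (continuousAt_psiVec hq0 hβ hz τ)
    split_ifs
    · exact continuousAt_const
    · exact ContinuousAt.div (continuousAt_const.mul (ContinuousAt.br
        ((continuousAt_const.mul (continuousAt_apply _ _)).div_const _) (div_ne_zero (mul_ne_zero (pow_ne_zero 2 hq0) hz0) hβ)))
        (ContinuousAt.br (continuousAt_const.mul (continuousAt_apply _ _))
          (mul_ne_zero (mul_ne_zero hβ hq0) hz0)) hK'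
  · exact continuousAt_psiVec_update hq0 hβ hgc hz' τ
  · have e1 := eventually_good_update_path hq0 hq hz.ne (lastSite N)
      (pow_ne_zero 2 (inv_ne_zero hs0))
    simp only [hg] at e1
    filter_upwards [eventually_good_path hq0 hq hz.ne, e1,
      eventually_br_ne (mul_ne_zero (mul_ne_zero hβ hq0) hz0)
        (by omega : ((lastSite N : Fin N) : ℤ) + 1 ≠ 0),
      eventually_br_ne (mul_ne_zero (mul_ne_zero (pow_ne_zero 3 hq0) hz0) hz0)
        (by omega : (((lastSite N : Fin N) : ℤ) + 1) + (((lastSite N : Fin N) : ℤ) + 1) ≠ 0),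
      eventually_ne_zero] with t h1 h2 h3 h4 ht
    refine psiVec_reflect_last hq0 hq hβ hε h1 h2 ?_ ?_ τ
    · rw [path, ← mul_assoc]; exact h3
    · have : q ^ 3 * path z t (lastSite N) * path z t (lastSite N) =
          q ^ 3 * z (lastSite N) * z (lastSite N) *
            t ^ ((((lastSite N : Fin N) : ℤ) + 1) + (((lastSite N : Fin N) : ℤ) + 1)) := by
        rw [path, zpow_add₀ ht (((lastSite N : Fin N) : ℤ) + 1)]; ring
      rw [this]; exact h4

/-! ### The boundary quantum Knizhnik–Zamolodchikov equations -/

theorem psiVec_exchangeRelation {q : ℂ} (hq0 : q ≠ 0) (β : ℂ) {N : ℕ} {z : Fin N → ℂ}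
    (hz : Good q z) {p p' : Fin N} (h : (p : ℕ) + 1 = p') :
    leg₂ p p' (Rcheck q (z p / z p')) *ᵥ psiVec q β z = psiVec q β (z ∘ Equiv.swap p p') := by
  refine exchange_of_compExchange (psiVec_exchange hq0 β hz h) ?_
  rw [div_div_eq_mul_div]
  exact hz.qbr_ne p' p

/-- The sequence obtained by inserting `x` at the position `p` of the sequence `r`. -/
def insertAt (N p : ℕ) (x : ℂ) (r : ℕ → ℂ) : Fin N → ℂ := fun k =>
  if (k : ℕ) < p then r k else if (k : ℕ) = p then x else r (k - 1)

theorem insertAt_of_lt {N p : ℕ} (x : ℂ) (r : ℕ → ℂ) {k : Fin N} (h : (k : ℕ) < p) :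
    insertAt N p x r k = r k := if_pos h

theorem insertAt_of_eq {N p : ℕ} (x : ℂ) (r : ℕ → ℂ) {k : Fin N} (h : (k : ℕ) = p) :
    insertAt N p x r k = x := by
  rw [insertAt, if_neg (by omega), if_pos h]

theorem insertAt_of_gt {N p : ℕ} (x : ℂ) (r : ℕ → ℂ) {k : Fin N} (h : p < (k : ℕ)) :
    insertAt N p x r k = r (k - 1) := by
  rw [insertAt, if_neg (by omega), if_neg (by omega)]

theorem insertAt_comp_swap {N p : ℕ} (x : ℂ) (r : ℕ → ℂ) {i j : Fin N} (hi : (i : ℕ) = p)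
    (hj : (j : ℕ) = p + 1) : insertAt N p x r ∘ Equiv.swap i j = insertAt N (p + 1) x r := by
  funext k
  rw [Function.comp, Equiv.swap_apply_def]
  split_ifs with h1 h2
  · rw [insertAt_of_gt x r (by omega), insertAt_of_lt x r (by rw [h1]; omega)]
    congr 1
    rw [h1]; omega
  · rw [insertAt_of_eq x r hi, insertAt_of_eq x r (by rw [h2]; omega)]
  · have h1' := Fin.val_ne_of_ne h1
    have h2' := Fin.val_ne_of_ne h2
    rcases lt_trichotomy (k : ℕ) p with h | h | h
    · rw [insertAt_of_lt x r h, insertAt_of_lt x r (by omega)]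
    · omega
    · rw [insertAt_of_gt x r h, insertAt_of_gt x r (by omega)]

theorem update_insertAt {N p : ℕ} (x y : ℂ) (r : ℕ → ℂ) {i : Fin N} (hi : (i : ℕ) = p) :
    Function.update (insertAt N p x r) i y = insertAt N p y r := by
  funext k
  by_cases hk : k = i
  · rw [hk, Function.update_self, insertAt_of_eq y r hi]
  · have := Fin.val_ne_of_ne hk
    rw [Function.update_of_ne hk, insertAt, insertAt, if_neg (c := (k : ℕ) = p) (by omega),
      if_neg (c := (k : ℕ) = p) (by omega)]

theorem good_insertAt_succ_iff {q : ℂ} {N p : ℕ} (h : p + 1 < N) (x : ℂ) (r : ℕ → ℂ) :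
    Good q (insertAt N (p + 1) x r) ↔ Good q (insertAt N p x r) := by
  have e := insertAt_comp_swap x r (i := (⟨p, by omega⟩ : Fin N)) (j := ⟨p + 1, h⟩) rfl rfl
  constructor
  · intro hg
    rw [← e] at hg
    have := hg.comp (Equiv.swap (⟨p, by omega⟩ : Fin N) ⟨p + 1, h⟩)
    rwa [Function.comp_assoc, ← Equiv.Perm.coe_mul, Equiv.swap_mul_self, Equiv.Perm.coe_one,
      Function.comp_id] at this
  · intro hg
    rw [← e]
    exact hg.comp _

/-- Being good is invariant under permutations, so one condition per inserted value serves all its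
positions. -/
theorem good_insertAt_iff {q : ℂ} {N p : ℕ} (h : p < N) (x : ℂ) (r : ℕ → ℂ) :
    Good q (insertAt N p x r) ↔ Good q (insertAt N 0 x r) := by
  induction p with
  | zero => rfl
  | succ p ih => rw [good_insertAt_succ_iff h, ih (by omega)]

theorem psiVec_insertAt_right {q : ℂ} (hq0 : q ≠ 0) (β : ℂ) {N p : ℕ} {x : ℂ} {r : ℕ → ℂ}
    (hz : Good q (insertAt N 0 x r)) {i j : Fin N} (hi : (i : ℕ) = p) (hj : (j : ℕ) = p + 1) :
    leg₂ i j (Rcheck q (x / r p)) *ᵥ psiVec q β (insertAt N p x r) =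
      psiVec q β (insertAt N (p + 1) x r) := by
  have h := psiVec_exchangeRelation hq0 β
    ((good_insertAt_iff (p := p) (by have := i.isLt; omega) x r).2 hz) (p := i) (p' := j) (by omega)
  rw [insertAt_comp_swap x r hi hj, insertAt_of_eq x r hi, insertAt_of_gt x r (by omega), hj,
    Nat.add_sub_cancel] at h
  exact h

theorem psiVec_insertAt_left {q : ℂ} (hq0 : q ≠ 0) (β : ℂ) {N p : ℕ} {x : ℂ} {r : ℕ → ℂ}
    (hz : Good q (insertAt N 0 x r)) {i j : Fin N} (hi : (i : ℕ) = p) (hj : (j : ℕ) = p + 1) :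
    leg₂ i j (Rcheck q (r p / x)) *ᵥ psiVec q β (insertAt N (p + 1) x r) =
      psiVec q β (insertAt N p x r) := by
  have h := psiVec_exchangeRelation hq0 β
    ((good_insertAt_iff (p := p + 1) (by have := j.isLt; omega) x r).2 hz) (p := i) (p' := j) (by omega)
  rw [← insertAt_comp_swap x r hi hj, Function.comp_assoc, ← Equiv.Perm.coe_mul,
    Equiv.swap_mul_self, Equiv.Perm.coe_one, Function.comp_id, insertAt_comp_swap x r hi hj,
    insertAt_of_eq x r hj, insertAt_of_lt x r (by omega), hi] at h
  exact h

theorem reverse_prod_mulVec {N n : ℕ} {g : Fin n → Op N} {v : ℕ → VN N}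
    (h : ∀ k : Fin n, g k *ᵥ v k = v (k + 1)) : (List.ofFn g).reverse.prod *ᵥ v 0 = v n := by
  induction n generalizing v with
  | zero => simp
  | succ n ih =>
    rw [List.ofFn_succ, List.reverse_cons, List.prod_append, List.prod_singleton,
      ← Matrix.mulVec_mulVec, (by simpa using h 0 : g 0 *ᵥ v 0 = v 1)]
    exact ih (v := fun k => v (k + 1)) fun k => by simpa using h k.succ

theorem prod_mulVec {N n : ℕ} {g : Fin n → Op N} {v : ℕ → VN N}
    (h : ∀ k : Fin n, g k *ᵥ v (k + 1) = v k) : (List.ofFn g).prod *ᵥ v n = v 0 := by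
  induction n generalizing v with
  | zero => simp
  | succ n ih =>
    rw [List.ofFn_succ, List.prod_cons, ← Matrix.mulVec_mulVec,
      ih (v := fun k => v (k + 1)) fun k => by simpa using h k.succ]
    simpa using h 0

/-- Read from right to left, the six blocks of the operator carry x to the right end, reflect it to
y = s⁻²x⁻¹, carry y to the site i and on to the left end, reflect it to y⁻¹ = s²x, and carry this
back to the site i. Goodness at y is an extra hypothesis here. -/
theorem scattering_mulVec_psiVec {q β s βbar : ℂ} (hq0 : q ≠ 0) (hq : br q ≠ 0) (hβ : β ≠ 0)
    (hs : s ^ 4 = q ^ 6) (hβbar : βbar ^ 2 * β ^ 2 * q ^ 2 = 1) {N : ℕ}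
    [NeZero N] {z : Fin N → ℂ} (i : Fin N) (hz : Good q z)
    (hz1 : Good q (Function.update z i (s⁻¹ ^ 2 * (z i)⁻¹)))
    (hz2 : Good q (Function.update z i (s ^ 2 * z i)))
    (hK : KRegular (s ^ 2 * z i) β) (hK' : KRegular (s * z i) (s * βbar)) :
    scattering q β s βbar i z *ᵥ psiVec q β z = psiVec q β (Function.update z i (s ^ 2 * z i)) := by
  have hs0 : s ≠ 0 := by
    rintro rfl
    exact pow_ne_zero 6 hq0 (by rw [← hs]; norm_num)
  have hiN := i.isLt
  obtain ⟨x, hx⟩ : ∃ x, x = z i := ⟨_, rfl⟩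
  have hx0 : x ≠ 0 := hx ▸ hz.ne i
  obtain ⟨r, hr1, hr2⟩ : ∃ r : ℕ → ℂ, (∀ k : Fin N, (k : ℕ) < i → r k = z k) ∧
      ∀ k : Fin N, (i : ℕ) < k → r (k - 1) = z k := by
    -- r lists the variables other than z_i in order; the default 0 is never reached.
    refine ⟨fun k => if k < (i : ℕ) then (if h : k < N then z ⟨k, h⟩ else 0)
      else (if h : k + 1 < N then z ⟨k + 1, h⟩ else 0), fun k hk => ?_, fun k hk => ?_⟩
    · beta_reduce
      rw [if_pos hk, dif_pos k.isLt]
    · have hk' : (k : ℕ) - 1 + 1 = k := by omega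
      have := k.isLt
      beta_reduce
      rw [if_neg (by omega), dif_pos (by omega)]
      congr 1
      exact Fin.ext hk'
  have hzr : z = insertAt N i x r := by
    funext k
    rcases lt_trichotomy (k : ℕ) i with h | h | h
    · rw [insertAt_of_lt x r h, hr1 k h]
    · rw [insertAt_of_eq x r h, hx, Fin.ext h]
    · rw [insertAt_of_gt x r h, hr2 k h]
  have hupd : ∀ y, Function.update z i y = insertAt N i y r := by
    intro y
    conv_lhs => rw [hzr]
    exact update_insertAt x y r rfl
  rw [← hx] at hz1 hz2 hK hK' ⊢
  rw [hupd] at hz1 hz2 ⊢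
  have hz0 := hz
  rw [hzr, good_insertAt_iff hiN] at hz0
  rw [good_insertAt_iff hiN] at hz1 hz2
  set y := s⁻¹ ^ 2 * x⁻¹ with hy
  have hyi : y⁻¹ = s ^ 2 * x := by rw [hy]; field_simp
  have hlast : ((lastSite N : Fin N) : ℕ) = N - 1 := rfl
  have hlen : (i : ℕ) + (N - 1 - i) = N - 1 := by omega
  have t1 : (List.ofFn fun k : Fin (N - 1 - i) =>
      rightRcheck q i (x / z (rightSiteSucc i k)) k).reverse.prod *ᵥ psiVec q β z =
      psiVec q β (insertAt N (N - 1) x r) := by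
    have := reverse_prod_mulVec (g := fun k : Fin (N - 1 - i) =>
      rightRcheck q i (x / z (rightSiteSucc i k)) k)
      (v := fun k => psiVec q β (insertAt N (i + k) x r)) fun k => by
        have hrk : r (i + k) = z (rightSiteSucc i k) := by
          rw [← hr2 (rightSiteSucc i k) (by simp only [rightSiteSucc]; omega)]
          rfl
        rw [← hrk]
        exact psiVec_insertAt_right hq0 β hz0 rfl rfl
    rw [hlen, Nat.add_zero, ← hzr] at this
    exact this
  have t2 : leg₁ (lastSite N) (K (s * x) (s * βbar)) *ᵥ psiVec q β (insertAt N (N - 1) x r) =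
      psiVec q β (insertAt N (N - 1) y r) := by
    have := psiVec_rightReflection hq0 hq hβ hs hβbar (z := insertAt N (N - 1) x r)
    rw [insertAt_of_eq x r hlast, update_insertAt _ _ _ hlast] at this
    exact this ((good_insertAt_iff (by omega) x r).2 hz0) ((good_insertAt_iff (by omega) y r).2 hz1)
      hK'
  have t3 : (List.ofFn fun k : Fin (N - 1 - i) =>
      rightRcheck q i (s ^ 2 * x * z (rightSiteSucc i k)) k).prod *ᵥ
        psiVec q β (insertAt N (N - 1) y r) = psiVec q β (insertAt N i y r) := by
    have := prod_mulVec (g := fun k : Fin (N - 1 - i) =>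
      rightRcheck q i (s ^ 2 * x * z (rightSiteSucc i k)) k)
      (v := fun k => psiVec q β (insertAt N (i + k) y r)) fun k => by
        -- A variable moving to the left meets its neighbour in the ratio r/y, which is s²x·r.
        have hrk : s ^ 2 * x * z (rightSiteSucc i k) = r (i + k) / y := by
          rw [← hr2 (rightSiteSucc i k) (by simp only [rightSiteSucc]; omega), ← hyi,
            div_eq_mul_inv, mul_comm]
          rfl
        rw [hrk]
        exact psiVec_insertAt_left hq0 β hz1 rfl rfl
    rw [hlen, Nat.add_zero] at this
    exact this
  have t4 : (List.ofFn fun j : Fin i =>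
      leftRcheck q i (s ^ 2 * x * z (j.castLE i.isLt.le)) j).prod *ᵥ
        psiVec q β (insertAt N i y r) = psiVec q β (insertAt N 0 y r) := by
    refine prod_mulVec (v := fun k => psiVec q β (insertAt N k y r)) fun j => ?_
    have hrk : s ^ 2 * x * z (j.castLE i.isLt.le) = r j / y := by
      rw [← hr1 (j.castLE i.isLt.le) j.isLt, ← hyi, div_eq_mul_inv, mul_comm]
      rfl
    rw [hrk]
    exact psiVec_insertAt_left hq0 β hz1 rfl rfl
  have t5 : leg₁ (firstSite N) (K (s ^ 2 * x) β) *ᵥ psiVec q β (insertAt N 0 y r) =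
      psiVec q β (insertAt N 0 (s ^ 2 * x) r) := by
    have hfirst : ((firstSite N : Fin N) : ℕ) = 0 := rfl
    have := psiVec_leftReflection hq0 hq hβ (z := insertAt N 0 y r)
    rw [insertAt_of_eq y r hfirst, update_insertAt _ _ _ hfirst, hyi] at this
    exact this hz1 hz2 hK
  have t6 : (List.ofFn fun j : Fin i =>
      leftRcheck q i (s ^ 2 * x / z (j.castLE i.isLt.le)) j).reverse.prod *ᵥ
        psiVec q β (insertAt N 0 (s ^ 2 * x) r) = psiVec q β (insertAt N i (s ^ 2 * x) r) := by
    refine reverse_prod_mulVec (v := fun k => psiVec q β (insertAt N k (s ^ 2 * x) r)) fun j => ?_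
    have hrk : r j = z (j.castLE i.isLt.le) := hr1 (j.castLE i.isLt.le) j.isLt
    rw [← hrk]
    exact psiVec_insertAt_right hq0 β hz2 rfl rfl
  rw [scattering, ← hx]
  simp only [← Matrix.mulVec_mulVec]
  rw [t1, t2, t3, t4, t5, t6]

/-! ### Regularity of the scattering operator and the limit -/

open Filter Topology

theorem continuousAt_leg₂_Rcheck {q : ℂ} (hq0 : q ≠ 0) {X : Type*} [TopologicalSpace X]
    {u : X → ℂ} {x : X} (hu : ContinuousAt u x) (hu0 : u x ≠ 0) (h : br (q / u x) ≠ 0) {N : ℕ}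
    (i j : Fin N) : ContinuousAt (fun x => leg₂ i j (Rcheck q (u x))) x := by
  have hd : ContinuousAt (fun x => br (q / u x)) x :=
    ContinuousAt.br (continuousAt_const.div hu hu0) (div_ne_zero hq0 hu0)
  refine continuousAt_pi.2 fun σ => continuousAt_pi.2 fun τ => ?_
  simp only [leg₂, Matrix.of_apply, Rcheck_apply, R]
  split_ifs
  · exact ContinuousAt.div (ContinuousAt.br (continuousAt_const.mul hu) (mul_ne_zero hq0 hu0)) hd h
  · exact ContinuousAt.div (ContinuousAt.br hu hu0) hd h
  · exact ContinuousAt.div continuousAt_const hd h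
  · exact continuousAt_const
  · exact continuousAt_const

theorem continuousAt_leg₁_K {b : ℂ} (hb : b ≠ 0) {X : Type*} [TopologicalSpace X]
    {u : X → ℂ} {x : X} (hu : ContinuousAt u x) (hu0 : u x ≠ 0) (h : KRegular (u x) b) {N : ℕ}
    (i : Fin N) : ContinuousAt (fun x => leg₁ i (K (u x) b)) x := by
  have hk : ContinuousAt (fun x => br (b * u x) / br (b / u x)) x :=
    ContinuousAt.div (ContinuousAt.br (continuousAt_const.mul hu) (mul_ne_zero hb hu0))
      (ContinuousAt.br (continuousAt_const.div hu hu0) (div_ne_zero hb hu0)) h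
  refine continuousAt_pi.2 fun σ => continuousAt_pi.2 fun τ => ?_
  simp only [leg₁, Matrix.of_apply, K, Matrix.diagonal_apply]
  generalize σ i = a
  generalize τ i = a'
  split_ifs
  · fin_cases a
    · exact continuousAt_const
    · exact hk
  · exact continuousAt_const
  · exact continuousAt_const

theorem continuousAt_prod_ofFn {N n : ℕ} {X : Type*} [TopologicalSpace X] {g : Fin n → X → Op N}
    {x : X} (hg : ∀ k, ContinuousAt (g k) x) :
    ContinuousAt (fun x => (List.ofFn fun k => g k x).prod) x := by
  simp only [List.ofFn_eq_map]
  exact tendsto_list_prod _ fun k _ => hg k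

theorem continuousAt_reverse_prod_ofFn {N n : ℕ} {X : Type*} [TopologicalSpace X]
    {g : Fin n → X → Op N} {x : X} (hg : ∀ k, ContinuousAt (g k) x) :
    ContinuousAt (fun x => (List.ofFn fun k => g k x).reverse.prod) x := by
  simp only [List.ofFn_eq_map, ← List.map_reverse]
  exact tendsto_list_prod _ fun k _ => hg k

theorem continuousAt_mulVec_apply {N : ℕ} {X : Type*} [TopologicalSpace X] {A : X → Op N}
    {v : X → VN N} {x : X} (hA : ContinuousAt A x) (hv : ∀ τ, ContinuousAt (fun x => v x τ) x)
    (σ : Config N) : ContinuousAt (fun x => (A x *ᵥ v x) σ) x := by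
  simp only [Matrix.mulVec, dotProduct]
  exact tendsto_finsetSum _ fun τ _ =>
    ((continuousAt_pi.1 (continuousAt_pi.1 hA σ) τ).mul (hv τ)).tendsto

/-- The operator is regular even where the intermediate point s⁻²z_i⁻¹ is not good: the poles of its
factors are excluded by goodness of z and of the shifted point, and by regularity of the two
K-matrices. -/
theorem continuousAt_scattering {q β s βbar : ℂ} (hq0 : q ≠ 0) (hβ : β ≠ 0)
    (hs : s ^ 4 = q ^ 6) (hβbar : βbar ≠ 0) {N : ℕ} [NeZero N] {z : Fin N → ℂ} {i : Fin N}
    (hz : Good q z) (hz2 : Good q (Function.update z i (s ^ 2 * z i)))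
    (hK : KRegular (s ^ 2 * z i) β) (hK' : KRegular (s * z i) (s * βbar)) :
    ContinuousAt (fun z => scattering q β s βbar i z) z := by
  have hs0 : s ≠ 0 := by
    rintro rfl
    exact pow_ne_zero 6 hq0 (by rw [← hs]; norm_num)
  have hs2 : s ^ 2 ≠ 0 := pow_ne_zero 2 hs0
  obtain ⟨ε, hε, hsε⟩ := exists_sign hq0 hs
  have hc : ∀ j : Fin N, ContinuousAt (fun z : Fin N → ℂ => z j) z := fun j => continuousAt_apply _ _
  -- By s² = εq³ the argument is ε(q²z_iz_j)⁻¹, so these denominators are, up to sign, brackets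
  -- already nonzero at z; j = i is harmless.
  have hmul : ∀ j, br (q / (s ^ 2 * z i * z j)) ≠ 0 := by
    intro j
    have h1 := hz.ne i
    have h2 := hz.ne j
    have hε0 : ε ≠ 0 := by rcases hε with rfl | rfl <;> norm_num
    have hεi : ε⁻¹ = ε := by rcases hε with rfl | rfl <;> norm_num
    have : q / (s ^ 2 * z i * z j) = ε * (q ^ 2 * z i * z j)⁻¹ := by
      rw [hsε]
      nth_rw 2 [← hεi]
      field_simp
    rw [this, br_mul_of_sign hε, br_inv]
    exact mul_ne_zero hε0 (neg_ne_zero.2 (hz.qqbr_ne i j))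
  have hdiv : ∀ j, br (q / (z i / z j)) ≠ 0 := fun j => by
    rw [div_div_eq_mul_div]; exact hz.qbr_ne j i
  have hdiv2 : ∀ j, j ≠ i → br (q / (s ^ 2 * z i / z j)) ≠ 0 := fun j hj => by
    have := hz2.qbr_ne j i
    rw [Function.update_self, Function.update_of_ne hj] at this
    rwa [div_div_eq_mul_div]
  unfold scattering leftRcheck rightRcheck
  refine ContinuousAt.mul (ContinuousAt.mul (ContinuousAt.mul (ContinuousAt.mul (ContinuousAt.mul
    ?_ ?_) ?_) ?_) ?_) ?_
  · refine continuousAt_reverse_prod_ofFn fun j => continuousAt_leg₂_Rcheck hq0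
      ((continuousAt_const.mul (hc i)).div (hc _) (hz.ne _))
      (div_ne_zero (mul_ne_zero hs2 (hz.ne i)) (hz.ne _)) (hdiv2 _ fun e => ?_) _ _
    have := congrArg Fin.val e
    have := j.isLt
    simp only [Fin.val_castLE] at *
    omega
  · exact continuousAt_leg₁_K hβ (continuousAt_const.mul (hc i)) (mul_ne_zero hs2 (hz.ne i)) hK _
  · exact continuousAt_prod_ofFn fun j => continuousAt_leg₂_Rcheck hq0
      ((continuousAt_const.mul (hc i)).mul (hc _))
      (mul_ne_zero (mul_ne_zero hs2 (hz.ne i)) (hz.ne _)) (hmul _) _ _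
  · exact continuousAt_prod_ofFn fun j => continuousAt_leg₂_Rcheck hq0
      ((continuousAt_const.mul (hc i)).mul (hc _))
      (mul_ne_zero (mul_ne_zero hs2 (hz.ne i)) (hz.ne _)) (hmul _) _ _
  · exact continuousAt_leg₁_K (mul_ne_zero hs0 hβbar) (continuousAt_const.mul (hc i))
      (mul_ne_zero hs0 (hz.ne i)) hK' _
  · exact continuousAt_reverse_prod_ofFn fun j => continuousAt_leg₂_Rcheck hq0
      ((hc i).div (hc _) (hz.ne _)) (div_ne_zero (hz.ne i) (hz.ne _)) (hdiv _) _ _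

theorem update_path_mul {N : ℕ} (z : Fin N → ℂ) (i : Fin N) (s t : ℂ) :
    Function.update (path z t) i (s * path z t i) = path (Function.update z i (s * z i)) t := by
  funext j
  by_cases hj : j = i
  · rw [hj, Function.update_self, path, path, Function.update_self, mul_assoc]
  · rw [Function.update_of_ne hj, path, path, Function.update_of_ne hj]

/-- On the path the intermediate point is good as well, so the composed relation holds there, and
both sides are continuous at z. -/
theorem psiVec_boundaryQKZ {q β s βbar : ℂ} (hq0 : q ≠ 0) (hq : br q ≠ 0) (hβ : β ≠ 0)
    (hs : s ^ 4 = q ^ 6) (hβbar : βbar ^ 2 * β ^ 2 * q ^ 2 = 1) {N : ℕ}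
    [NeZero N] {z : Fin N → ℂ} (i : Fin N) (hz : Good q z)
    (hz2 : Good q (Function.update z i (s ^ 2 * z i)))
    (hK : KRegular (s ^ 2 * z i) β) (hK' : KRegular (s * z i) (s * βbar)) :
    scattering q β s βbar i z *ᵥ psiVec q β z = psiVec q β (Function.update z i (s ^ 2 * z i)) := by
  have hs0 : s ≠ 0 := by
    rintro rfl
    exact pow_ne_zero 6 hq0 (by rw [← hs]; norm_num)
  have hβbar0 : βbar ≠ 0 := by rintro rfl; norm_num at hβbar
  have hz0 := hz.ne i
  funext σ
  refine eq_of_eventually_path (z := z)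
    (F := fun z => (scattering q β s βbar i z *ᵥ psiVec q β z) σ)
    (G := fun z => psiVec q β (Function.update z i (s ^ 2 * z i)) σ)
    (continuousAt_mulVec_apply (continuousAt_scattering hq0 hβ hs hβbar0 hz hz2 hK hK')
      (fun τ => continuousAt_psiVec hq0 hβ hz τ) σ)
    (continuousAt_psiVec_update hq0 hβ (continuousAt_const.mul (continuousAt_apply _ _)) hz2 σ) ?_
  have e2 := eventually_good_path hq0 hq hz2.ne
  simp only [← update_path_mul] at e2
  filter_upwards [eventually_good_path hq0 hq hz.ne,
    eventually_good_update_path hq0 hq hz.ne i (pow_ne_zero 2 (inv_ne_zero hs0)), e2,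
    eventually_br_ne (div_ne_zero hβ (mul_ne_zero (pow_ne_zero 2 hs0) hz0))
      (by omega : -((i : ℤ) + 1) ≠ 0),
    eventually_br_ne (div_ne_zero (mul_ne_zero hs0 hβbar0) (mul_ne_zero hs0 hz0))
      (by omega : -((i : ℤ) + 1) ≠ 0)] with t h1 h2 h3 h4 h5
  refine congrFun (scattering_mulVec_psiVec hq0 hq hβ hs hβbar i h1 h2 h3 ?_ ?_) σ
  · rw [KRegular, path, ← mul_assoc, div_mul_eq_div_div, div_eq_mul_inv _ (t ^ _), ← zpow_neg]
    exact h4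
  · rw [KRegular, path, ← mul_assoc, div_mul_eq_div_div, div_eq_mul_inv _ (t ^ _), ← zpow_neg]
    exact h5

end BqKZ

end

theorem mainTheorem7 (N : ℕ) [NeZero N] (q β : ℂ)
    (hq0 : q ≠ 0) (hq1 : q ≠ 1) (hq2 : q ≠ -1) (hβ : β ≠ 0)
    (ρ : (Fin N → ℂ) → Fin (N / 2) → Fin N → ℝ)
    (hρ : BqKZ.IsContourChoice (BqKZ.singPsi q) ρ)
    (ρbar : (Fin N → ℂ) → Fin ((N + 1) / 2) → Fin N → ℝ)
    (hρbar : BqKZ.IsContourChoice (BqKZ.singPsiBar q β) ρbar) :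
    BqKZ.ExchangeRelations q (BqKZ.generic (BqKZ.singPsi q)) (BqKZ.Psi q β ρ) ∧
    BqKZ.ExchangeRelations q (BqKZ.generic (BqKZ.singPsiBar q β)) (BqKZ.PsiBar q β ρbar) ∧
    ∀ s βbar : ℂ, s ^ 4 = q ^ 6 → βbar ^ 2 * β ^ 2 * q ^ 2 = 1 →
      BqKZ.LeftReflectionRelation β (BqKZ.generic (BqKZ.singPsi q)) (BqKZ.Psi q β ρ) ∧
      BqKZ.RightReflectionRelation s βbar (BqKZ.generic (BqKZ.singPsi q)) (BqKZ.Psi q β ρ) ∧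
      BqKZ.BoundaryQKZ q β s βbar (BqKZ.generic (BqKZ.singPsi q)) (BqKZ.Psi q β ρ) := by
  have hq := BqKZ.br_ne_zero_of_ne hq0 hq1 hq2
  -- The residue form does not involve the radii, so the chosen contours may differ between the two
  -- sides of a relation.
  have hΨ : ∀ z : Fin N → ℂ, BqKZ.Good q z → BqKZ.Psi q β ρ z = BqKZ.psiVec q β z :=
    fun z hz => BqKZ.psi_eq_phiVec hq0 hβ hρ hz
  have hgen : ∀ z : Fin N → ℂ, z ∈ BqKZ.generic (BqKZ.singPsi q) ↔ BqKZ.Good q z :=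
    fun z => BqKZ.mem_generic_singPsi_iff hq0
  refine ⟨fun z hz i j hij => ?_, fun z hz i j hij => ?_, fun s βbar hs hβbar =>
    ⟨fun z hz hz' hK => ?_, fun z hz hz' hK => ?_, fun z hz i hz' hK hK' => ?_⟩⟩
  · rw [hgen] at hz
    rw [hΨ z hz, hΨ _ (hz.comp _)]
    exact BqKZ.psiVec_exchangeRelation hq0 β hz hij
  · obtain ⟨c, hc⟩ := BqKZ.exists_dual_constant hq0
    have hc0 : c ≠ 0 := by rintro rfl; simp at hc
    obtain ⟨hy, hz0⟩ := BqKZ.good_dual_of_generic hq0 hc hβ hz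
    refine BqKZ.exchange_of_compExchange (BqKZ.psiBar_exchange hq0 hβ hρbar hz hij) ?_
    -- Goodness of the dual point supplies the nonvanishing denominator of the R-matrix for Ψ̄_N.
    have h := hy.qbr_ne i.rev j.rev
    have h1 := (hz0 i).1
    have h2 := (hz0 j).1
    have e : q / (z i / z j) = q * BqKZ.dual c z i.rev / BqKZ.dual c z j.rev := by
      simp only [BqKZ.dual, Fin.rev_rev]
      field_simp
    rwa [e]
  · rw [hgen] at hz hz'
    rw [hΨ z hz, hΨ _ hz']
    exact BqKZ.psiVec_leftReflection hq0 hq hβ hz hz' hK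
  · rw [hgen] at hz hz'
    rw [hΨ z hz, hΨ _ hz']
    exact BqKZ.psiVec_rightReflection hq0 hq hβ hs hβbar hz hz' hK
  · rw [hgen] at hz hz'
    rw [hΨ z hz, hΨ _ hz']
    exact BqKZ.psiVec_boundaryQKZ hq0 hq hβ hs hβbar i hz hz' hK hK'
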